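/- Fix $0<\alpha\le\beta<1$, $A>0$, $B>0$, $T>0$ and a measurable function $\gamma:[0,1]\to[0,1]$. Let $\mathscr M$ be the set of non-negative measures on $[0,1]$ with total mass at most $1$, endowed with the weak topology, and let $D([0,T],\mathscr M)$ be the space of right-continuous functions $[0,T]\to\mathscr M$ with left limits, endowed with the Skorohod topology. Let $\mathscr M_{\rm ac}\subset\mathscr M$ be the set of measures $g(x)\,dx$ with $0\le g\le 1$. For a path $\pi(t,dx)=u(t,x)\,dx$ in $D([0,T],\mathscr M_{\rm ac})$ define the energy $$\mathcal Q_{[0,T]}(u)=\sup_G\Big\{\int_0^T\!\!\int_0^1 u\,\partial_xG\,dx\,dt-\frac12\int_0^T\!\!\int_0^1 G^2\,dx\,dt\Big\},$$ the supremum being over smooth functions $G:[0,T]\times(0,1)\to\mathbb R$ with compact support, and let $D_{\mathcal E}$ be the set of paths in $D([0,T],\mathscr M_{\rm ac})$ with finite energy. For $\pi=u\,dx\in D_{\mathcal E}$, for almost every $t$ the function $u_t=u(t,\cdot)$ has a continuous version, and $u_t(0),u_t(1)$ denote its boundary values. Let $\sigma(a)=a(1-a)$ and $$\mathfrak b_{\varrho,D}(a,M)=\frac1D\big\{(1-a)\varrho\,(e^M-1)+a(1-\varrho)(e^{-M}-1)\big\}.$$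 For $H\in C^{1,2}([0,T]\times[0,1])$ (that is, $H,\partial_tH,\partial_xH,\partial_x^2H$ exist and are continuous up to the boundary) and $\pi=u\,dx\in D_{\mathcal E}$ let, with $\langle f,g\rangle=\int_0^1 fg\,dx$, $$\begin{aligned}J_{T,H}(\pi)={}&\langle u_T,H_T\rangle-\langle u_0,H_0\rangle-\int_0^T\langle u_t,\partial_tH_t\rangle\,dt-\int_0^T\langle u_t,\partial_x^2H_t\rangle\,dt\\&+\int_0^Tu_t(1)\,\partial_xH_t(1)\,dt-\int_0^Tu_t(0)\,\partial_xH_t(0)\,dt-\int_0^T\langle\sigma(u_t),(\partial_xH_t)^2\rangle\,dt\\&-\int_0^T\big\{\mathfrak b_{\alpha,A}(u_t(0),H_t(0))+\mathfrak b_{\beta,B}(u_t(1),H_t(1))\big\}\,dt,\end{aligned}$$ and let $J_{T,H}(\pi)=+\infty$ for $\pi\notin D_{\mathcal E}$. Put $I_{[0,T]}(\pi)=\sup_{H\in C^{1,2}([0,T]\times[0,1])}J_{T,H}(\pi)$, and let $I_{[0,T]}(\pi|\gamma)=I_{[0,T]}(\pi)$ if $\pi(0,dx)$ has density $\gamma$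 (almost everywhere), and $I_{[0,T]}(\pi|\gamma)=+\infty$ otherwise. Then $I_{[0,T]}(\,\cdot\,|\gamma)$ takes values in $[0,\infty]$ on $D([0,T],\mathscr M)$, it is convex, it is lower semicontinuous, and it has compact level sets: for every $q\in\mathbb R$ the set $\{\pi\in D([0,T],\mathscr M): I_{[0,T]}(\pi|\gamma)\le q\}$ is compact. -/

import Mathlib

open Set Filter Topology MeasureTheory
open scoped NNReal ENNReal ContDiff

noncomputable section

namespace RobinExclusion

/-! ### The Skorohod space `D([0,T], X)` -/

/-- Right-continuous functions `[0,T] → X` with left limits. One-sided neighbourhoods are taken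
inside `[0,T]`, so there is no condition from the left at `0` and none from the right at `T`. -/
structure SkorohodPath (T : ℝ) (X : Type*) [TopologicalSpace X] where
  toFun : Icc (0 : ℝ) T → X
  right_continuous : ∀ t, ContinuousWithinAt toFun (Ici t) t
  left_limit : ∀ t, ∃ l, Tendsto toFun (𝓝[<] t) (𝓝 l)

instance {T : ℝ} {X : Type*} [TopologicalSpace X] :
    CoeFun (SkorohodPath T X) (fun _ => Icc (0 : ℝ) T → X) := ⟨SkorohodPath.toFun⟩

/-- `y` belongs to the Skorohod neighbourhood of `x` of size `ε` in time and `V` in space: up to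
an increasing time change `l` of `[0,T]` that moves no point by `ε` or more, the paths `x` and `y`
are uniformly `V`-close. For a metric space `X` and `V = {p | dist p.1 p.2 < ε}` this is
`sup_t |l t - t| < ε`, `sup_t dist (x t) (y (l t)) < ε` (up to strictness of the inequalities). -/
def SkorohodClose {T : ℝ} {X : Type*} [UniformSpace X] (ε : ℝ) (V : Set (X × X))
    (x y : SkorohodPath T X) : Prop :=
  ∃ l : Icc (0 : ℝ) T ≃o Icc (0 : ℝ) T,
    (∀ t, |(l t : ℝ) - t| < ε) ∧ ∀ t, (x t, y (l t)) ∈ V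

/-- The Skorohod (J1) topology on `D([0,T], X)`. For a metric space `X` this is the topology of
the metric `d(x, y) = inf_l max (sup_t |l t - t|, sup_t dist (x t) (y (l t)))`. -/
instance {T : ℝ} {X : Type*} [UniformSpace X] : TopologicalSpace (SkorohodPath T X) where
  IsOpen U := ∀ x ∈ U, ∃ ε > 0, ∃ V ∈ uniformity X, ∀ y, SkorohodClose ε V x y → y ∈ U
  isOpen_univ := fun _ _ => ⟨1, one_pos, univ, univ_mem, fun _ _ => mem_univ _⟩
  isOpen_inter := by
    rintro U W hU hW x ⟨hxU, hxW⟩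
    obtain ⟨ε, hε, V, hV, h⟩ := hU x hxU
    obtain ⟨ε', hε', V', hV', h'⟩ := hW x hxW
    refine ⟨min ε ε', lt_min hε hε', V ∩ V', inter_mem hV hV', ?_⟩
    rintro y ⟨l, hl, hy⟩
    exact ⟨h y ⟨l, fun t => (hl t).trans_le (min_le_left _ _), fun t => (hy t).1⟩,
      h' y ⟨l, fun t => (hl t).trans_le (min_le_right _ _), fun t => (hy t).2⟩⟩
  isOpen_sUnion := by
    rintro S hS x ⟨U, hUS, hxU⟩
    obtain ⟨ε, hε, V, hV, h⟩ := hS U hUS x hxU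
    exact ⟨ε, hε, V, hV, fun y hy => ⟨U, hUS, h y hy⟩⟩

/-! ### Measures on `[0,1]` of mass at most one -/

/-- Nonnegative measures on `[0,1]` with total mass at most `1`. -/
structure SubMeasure where
  fin : FiniteMeasure unitInterval
  mass_le : fin.mass ≤ 1

namespace SubMeasure

/-- The underlying measure. -/
def meas (π : SubMeasure) : Measure unitInterval := (π.fin : Measure unitInterval)

/-- The pairings `F ↦ ∫ F dπ` with continuous functions. -/
def pairing (π : SubMeasure) (F : C(unitInterval, ℝ)) : ℝ := ∫ x, F x ∂π.meas

/-- The weak topology, as the subspace topology of Mathlib's topology of weak convergence of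
finite measures. -/
abbrev weakTopology : TopologicalSpace SubMeasure := TopologicalSpace.induced fin inferInstance

theorem weakTopology_eq : weakTopology = TopologicalSpace.induced pairing inferInstance := by
  let _ : TopologicalSpace SubMeasure := weakTopology
  have hfin : IsInducing fin := ⟨rfl⟩
  refine IsInducing.eq_induced (f := pairing) ?_
  rw [isInducing_iff_nhds]
  intro π
  have key : ∀ f : Filter SubMeasure, f ≤ 𝓝 π ↔ Tendsto pairing f (𝓝 (pairing π)) := by
    intro f
    have h1 : f ≤ 𝓝 π ↔ Tendsto fin f (𝓝 π.fin) := by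
      rw [hfin.nhds_eq_comap, tendsto_iff_comap]
    rw [h1, FiniteMeasure.tendsto_iff_forall_integral_tendsto, tendsto_pi_nhds]
    constructor
    · intro h F
      exact h (BoundedContinuousFunction.mkOfCompact F)
    · intro h F
      exact h F.toContinuousMap
  apply le_antisymm
  · exact tendsto_iff_comap.1 ((key _).1 le_rfl)
  · exact (key _).2 tendsto_comap

/-- The uniform structure of the weak topology: the coarsest one for which all pairings with
continuous functions are uniformly continuous. Its topology is `weakTopology`. Since the space is
compact and Hausdorff, this is the only uniform structure compatible with that topology; in
particular it is the one given by any metric that induces the weak topology. -/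
instance : UniformSpace SubMeasure :=
  @UniformSpace.replaceTopology _ weakTopology (UniformSpace.comap pairing inferInstance)
    weakTopology_eq

theorem isInducing_fin : IsInducing fin := ⟨rfl⟩

/-- The convex combination `a π + b ν`. -/
def comb (a b : ℝ≥0) (hab : a + b = 1) (π ν : SubMeasure) : SubMeasure :=
  ⟨a • π.fin + b • ν.fin, by
    have h : (a • π.fin + b • ν.fin).mass = a * π.fin.mass + b * ν.fin.mass := by
      rw [FiniteMeasure.mass, FiniteMeasure.coeFn_add, Pi.add_apply,
        FiniteMeasure.coeFn_smul, FiniteMeasure.coeFn_smul]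
      rfl
    calc (a • π.fin + b • ν.fin).mass = a * π.fin.mass + b * ν.fin.mass := h
      _ ≤ a * 1 + b * 1 := by gcongr <;> exact mass_le _
      _ = 1 := by rw [mul_one, mul_one, hab]⟩

theorem tendsto_comb (a b : ℝ≥0) (hab : a + b = 1) {ι : Type*} {F : Filter ι}
    {f g : ι → SubMeasure} {l m : SubMeasure} (hf : Tendsto f F (𝓝 l)) (hg : Tendsto g F (𝓝 m)) :
    Tendsto (fun i => comb a b hab (f i) (g i)) F (𝓝 (comb a b hab l m)) := by
  rw [isInducing_fin.tendsto_nhds_iff] at hf hg ⊢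
  exact (hf.const_smul a).add (hg.const_smul b)

/-- `π(dx) = g(x) dx` with `0 ≤ g ≤ 1`. -/
def IsAC (π : SubMeasure) : Prop :=
  ∃ g : unitInterval → ℝ, Measurable g ∧ (∀ x, g x ∈ Icc (0 : ℝ) 1) ∧
    π.meas = volume.withDensity (fun x => ENNReal.ofReal (g x))

/-- The density of `π` with respect to the Lebesgue measure on `[0,1]`. -/
def density (π : SubMeasure) (x : unitInterval) : ℝ := (π.meas.rnDeriv volume x).toReal

end SubMeasure

/-- Paths in `D([0,T], M)`. -/
abbrev MPath (T : ℝ) : Type := SkorohodPath T SubMeasure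

namespace MPath

variable {T : ℝ}

/-- The convex combination `(a π + b ν)(t) = a π(t) + b ν(t)` of paths. -/
def comb (a b : ℝ≥0) (hab : a + b = 1) (π ν : MPath T) : MPath T where
  toFun t := SubMeasure.comb a b hab (π t) (ν t)
  right_continuous t :=
    SubMeasure.tendsto_comb a b hab (π.right_continuous t) (ν.right_continuous t)
  left_limit t := by
    obtain ⟨l, hl⟩ := π.left_limit t
    obtain ⟨m, hm⟩ := ν.left_limit t
    exact ⟨SubMeasure.comb a b hab l m, SubMeasure.tendsto_comb a b hab hl hm⟩

end MPath

/-! ### The energy -/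

/-- Smooth functions `G : [0,T] × (0,1) → ℝ` with compact support (values outside
`[0,T] × (0,1)` are irrelevant). -/
structure EnergyTest (T : ℝ) where
  toFun : ℝ → ℝ → ℝ
  smooth : ContDiffOn ℝ ∞ (fun p : ℝ × ℝ => toFun p.1 p.2) (Icc 0 T ×ˢ Ioo 0 1)
  compact_support : ∃ K : Set (ℝ × ℝ), IsCompact K ∧ K ⊆ Icc 0 T ×ˢ Ioo 0 1 ∧
    ∀ p ∈ Icc 0 T ×ˢ Ioo (0 : ℝ) 1, p ∉ K → toFun p.1 p.2 = 0

variable {T : ℝ}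

/-- The Lebesgue measure on `[0,T]`. -/
def leb (T : ℝ) : Measure (Icc (0 : ℝ) T) := (volume : Measure ℝ).comap (↑)

/-- `∫₀ᵀ ∫₀¹ u ∇G dx dt - ½ ∫₀ᵀ ∫₀¹ G² dx dt`, where `π(t,dx) = u(t,x) dx`. -/
def energyFunctional (G : EnergyTest T) (π : MPath T) : ℝ :=
  (∫ t, (∫ x, (π t).density x * deriv (G.toFun t) x) ∂leb T)
    - (1 / 2) * ∫ t : Icc (0 : ℝ) T, (∫ x : unitInterval, (G.toFun t x) ^ 2) ∂leb T

/-- The energy of a path with values in the absolutely continuous measures. -/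
def energy (π : MPath T) : EReal := ⨆ G : EnergyTest T, (energyFunctional G π : EReal)

/-- The paths `π(t,dx) = u(t,x) dx`, `0 ≤ u ≤ 1`, with finite energy. (The set of measures with
density in `[0,1]` is weakly closed, so left limits need not be mentioned.) -/
def HasFiniteEnergy (π : MPath T) : Prop := (∀ t, (π t).IsAC) ∧ energy π < ⊤

/-! ### The rate functional -/

/-- Functions `H : [0,T] × [0,1] → ℝ` of class `C^{1,2}`, together with the derivatives
`∂ₜH`, `∇H`, `ΔH`, all continuous on `[0,T] × [0,1]` (values outside are irrelevant). -/
structure C12 (T : ℝ) where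
  toFun : ℝ → ℝ → ℝ
  dt : ℝ → ℝ → ℝ
  dx : ℝ → ℝ → ℝ
  dxx : ℝ → ℝ → ℝ
  hasDeriv_dt : ∀ t ∈ Icc 0 T, ∀ x ∈ Icc (0 : ℝ) 1,
    HasDerivWithinAt (fun s => toFun s x) (dt t x) (Icc 0 T) t
  hasDeriv_dx : ∀ t ∈ Icc 0 T, ∀ x ∈ Icc (0 : ℝ) 1,
    HasDerivWithinAt (toFun t) (dx t x) (Icc 0 1) x
  hasDeriv_dxx : ∀ t ∈ Icc 0 T, ∀ x ∈ Icc (0 : ℝ) 1,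
    HasDerivWithinAt (dx t) (dxx t x) (Icc 0 1) x
  cont : ContinuousOn (fun p : ℝ × ℝ => toFun p.1 p.2) (Icc 0 T ×ˢ Icc 0 1)
  cont_dt : ContinuousOn (fun p : ℝ × ℝ => dt p.1 p.2) (Icc 0 T ×ˢ Icc 0 1)
  cont_dx : ContinuousOn (fun p : ℝ × ℝ => dx p.1 p.2) (Icc 0 T ×ˢ Icc 0 1)
  cont_dxx : ContinuousOn (fun p : ℝ × ℝ => dxx p.1 p.2) (Icc 0 T ×ˢ Icc 0 1)

/-- `(1/D) {(1-a) ϱ (e^M - 1) + a (1-ϱ) (e^{-M} - 1)}`. -/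
def bdry (ϱ D a M : ℝ) : ℝ :=
  (1 / D) * ((1 - a) * ϱ * (Real.exp M - 1) + a * (1 - ϱ) * (Real.exp (-M) - 1))

/-- The mobility. -/
def mobility (a : ℝ) : ℝ := a * (1 - a)

open Classical in
/-- The value at `x` of the continuous version of `u : [0,1] → ℝ` (which is unique), and `0` if
there is none. Along a path of finite energy almost every `u_t` has a continuous version. -/
def contValue (u : unitInterval → ℝ) (x : unitInterval) : ℝ :=
  if h : ∃ w : C(unitInterval, ℝ), u =ᵐ[volume] w then h.choose x else 0

/-- The time `0` in `[0,T]`. -/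
def timeZero (hT : 0 < T) : Icc (0 : ℝ) T := ⟨0, left_mem_Icc.2 hT.le⟩

/-- The time `T` in `[0,T]`. -/
def timeEnd (hT : 0 < T) : Icc (0 : ℝ) T := ⟨T, right_mem_Icc.2 hT.le⟩

/-- The functional `J_{T,H}` on paths of finite energy, with `u_t = (π t).density`. -/
def JReal (α A β B : ℝ) (hT : 0 < T) (H : C12 T) (π : MPath T) : ℝ :=
  (∫ x : unitInterval, (π (timeEnd hT)).density x * H.toFun T x)
    - (∫ x : unitInterval, (π (timeZero hT)).density x * H.toFun 0 x)
    - (∫ t, (∫ x : unitInterval, (π t).density x * H.dt t x) ∂leb T)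
    - (∫ t, (∫ x : unitInterval, (π t).density x * H.dxx t x) ∂leb T)
    + (∫ t, contValue (π t).density 1 * H.dx t 1 ∂leb T)
    - (∫ t, contValue (π t).density 0 * H.dx t 0 ∂leb T)
    - (∫ t, (∫ x : unitInterval, mobility ((π t).density x) * (H.dx t x) ^ 2) ∂leb T)
    - (∫ t,
        (bdry α A (contValue (π t).density 0) (H.toFun t 0)
          + bdry β B (contValue (π t).density 1) (H.toFun t 1)) ∂leb T)

open Classical in
/-- `J_{T,H}` on `D([0,T], M)`, equal to `+∞` off the paths of finite energy. -/
def J (α A β B : ℝ) (hT : 0 < T) (H : C12 T) (π : MPath T) : EReal :=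
  if HasFiniteEnergy π then (JReal α A β B hT H π : EReal) else ⊤

/-- `I_{[0,T]}(π) = sup_H J_{T,H}(π)`. -/
def rate (α A β B : ℝ) (hT : 0 < T) (π : MPath T) : EReal := ⨆ H : C12 T, J α A β B hT H π

open Classical in
/-- `I_{[0,T]}(π | γ)`. -/
def rateFrom (α A β B : ℝ) (hT : 0 < T) (γ : unitInterval → unitInterval) (π : MPath T) :
    EReal :=
  if (π (timeZero hT)).density =ᵐ[volume] (fun x => (γ x : ℝ)) then rate α A β B hT π else ⊤

end RobinExclusion

end

/-! Everything is read off the cosine coefficients `c n t = ∫ cos (nπx) π(t, dx)` of a path.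
Testing the rate functional with smooth ramps in time multiplied by `cos (nπx)` bounds the
increments of each `c n` uniformly on the level sets; testing it with Steklov averages of the path
itself bounds `∫ ∑ (nπ c n t)² dt`, that is, the energy of the path. By the first bound a level set
is an equicontinuous family of continuous paths, so by Arzelà–Ascoli it is enough to show that it
is closed under pointwise convergence. By the second bound the cosine series of almost every `u_t`
converges uniformly with a controlled rate, so the boundary values pass to the limit; the remaining
nonlinear term `-∫ ⟨σ(u), (∂ₓH)²⟩` is convex, hence lower semicontinuous. -/

noncomputable section

namespace RobinExclusion

/-! ### Cosine polynomials and the weak topology -/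

/-- The function `x ↦ cos (nπx)` on `[0,1]`. -/
def cosMap (n : ℕ) : C(unitInterval, ℝ) := ⟨fun x => Real.cos (n * Real.pi * x), by fun_prop⟩

@[simp] lemma cosMap_apply (n : ℕ) (x : unitInterval) :
    cosMap n x = Real.cos (n * Real.pi * x) := rfl

lemma cosMap_mul_cosMap {m n : ℕ} (h : n ≤ m) :
    cosMap m * cosMap n = (1 / 2 : ℝ) • (cosMap (m + n) + cosMap (m - n)) := by
  ext x
  simp only [ContinuousMap.mul_apply, ContinuousMap.smul_apply, ContinuousMap.add_apply,
    cosMap_apply, smul_eq_mul]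
  push_cast [h]
  rw [add_mul, add_mul, sub_mul, sub_mul, Real.cos_add, Real.cos_sub]
  ring

lemma cosMap_mul_mem_span (m n : ℕ) :
    cosMap m * cosMap n ∈ Submodule.span ℝ (range cosMap) := by
  wlog h : n ≤ m generalizing m n
  · exact mul_comm (cosMap m) (cosMap n) ▸ this n m (not_le.1 h).le
  · rw [cosMap_mul_cosMap h]
    exact Submodule.smul_mem _ _ (Submodule.add_mem _ (Submodule.subset_span ⟨_, rfl⟩)
      (Submodule.subset_span ⟨_, rfl⟩))

/-- The algebra of cosine polynomials. -/
def cosAlgebra : Subalgebra ℝ C(unitInterval, ℝ) :=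
  (Submodule.span ℝ (range cosMap)).toSubalgebra
    (Submodule.subset_span ⟨0, by ext x; simp⟩) fun f g hf hg => by
      have hfg := Submodule.mul_mem_mul hf hg
      rw [Submodule.span_mul_span] at hfg
      refine Submodule.span_le.2 ?_ hfg
      rintro _ ⟨_, ⟨m, rfl⟩, _, ⟨n, rfl⟩, rfl⟩
      exact cosMap_mul_mem_span m n

lemma cosAlgebra_topologicalClosure : cosAlgebra.topologicalClosure = ⊤ := by
  apply ContinuousMap.subalgebra_topologicalClosure_eq_top_of_separatesPoints
  intro x y hxy
  refine ⟨cosMap 1, ⟨cosMap 1, Submodule.subset_span ⟨1, rfl⟩, rfl⟩, fun hcos => hxy ?_⟩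
  simp only [cosMap_apply, Nat.cast_one, one_mul] at hcos
  have mem_Icc (z : unitInterval) : Real.pi * z ∈ Icc 0 Real.pi :=
    ⟨mul_nonneg Real.pi_pos.le z.2.1, mul_le_of_le_one_right Real.pi_pos.le z.2.2⟩
  exact Subtype.ext
    (mul_left_cancel₀ Real.pi_ne_zero (Real.injOn_cos (mem_Icc x) (mem_Icc y) hcos))

lemma dense_span_cosMap : Dense (Submodule.span ℝ (range cosMap) : Set C(unitInterval, ℝ)) := by
  have h := cosAlgebra.topologicalClosure_coe
  rw [cosAlgebra_topologicalClosure] at h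
  exact fun f => h ▸ mem_univ f

namespace SubMeasure

instance (p : SubMeasure) : IsFiniteMeasure p.meas := by unfold meas; infer_instance

lemma meas_univ_le (p : SubMeasure) : p.meas univ ≤ 1 := by
  have h := p.mass_le
  rwa [← ENNReal.coe_le_coe, FiniteMeasure.ennreal_mass] at h

lemma integrable_continuousMap (p : SubMeasure) (f : C(unitInterval, ℝ)) :
    Integrable (fun x => f x) p.meas :=
  f.continuous.integrable_of_hasCompactSupport (HasCompactSupport.of_compactSpace _)

lemma abs_pairing_le (p : SubMeasure) (f : C(unitInterval, ℝ)) : |p.pairing f| ≤ ‖f‖ :=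
  (norm_integral_le_of_norm_le_const (ae_of_all _ f.norm_coe_le_norm)).trans <|
    mul_le_of_le_one_right (norm_nonneg f) <|
      ENNReal.toReal_le_of_le_ofReal zero_le_one (by simpa using p.meas_univ_le)

lemma pairing_add (p : SubMeasure) (f g : C(unitInterval, ℝ)) :
    p.pairing (f + g) = p.pairing f + p.pairing g :=
  integral_add (p.integrable_continuousMap f) (p.integrable_continuousMap g)

lemma pairing_sub (p : SubMeasure) (f g : C(unitInterval, ℝ)) :
    p.pairing (f - g) = p.pairing f - p.pairing g :=
  integral_sub (p.integrable_continuousMap f) (p.integrable_continuousMap g)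

lemma pairing_smul (p : SubMeasure) (a : ℝ) (f : C(unitInterval, ℝ)) :
    p.pairing (a • f) = a * p.pairing f := integral_const_mul a _

lemma uniformity_eq_iInf_pairing : uniformity SubMeasure =
    ⨅ f, comap (fun p : SubMeasure × SubMeasure => (p.1.pairing f, p.2.pairing f))
      (uniformity ℝ) := by
  change comap (fun p : SubMeasure × SubMeasure => (p.1.pairing, p.2.pairing))
    (uniformity (C(unitInterval, ℝ) → ℝ)) = _
  simp_rw [Pi.uniformity, comap_iInf, comap_comap, Function.comp_def]

lemma uniformContinuous_pairing (f : C(unitInterval, ℝ)) :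
    UniformContinuous fun p : SubMeasure => p.pairing f := by
  rw [UniformContinuous, tendsto_iff_comap, uniformity_eq_iInf_pairing]
  exact iInf_le _ f

/-- The cosine coefficient `∫ cos (nπx) p(dx)`. -/
def coef (n : ℕ) (p : SubMeasure) : ℝ := p.pairing (cosMap n)

lemma abs_coef_le (n : ℕ) (p : SubMeasure) : |p.coef n| ≤ 1 :=
  (p.abs_pairing_le _).trans <|
    (ContinuousMap.norm_le _ zero_le_one).2 fun _ => Real.abs_cos_le_one _

lemma continuous_coef (n : ℕ) : Continuous (coef n) :=
  (uniformContinuous_pairing (cosMap n)).continuous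

lemma uniformContinuous_pairing_of_coef {ι : Type*} [UniformSpace ι] {y : ι → SubMeasure}
    (hy : ∀ n, UniformContinuous fun i => (y i).coef n) (f : C(unitInterval, ℝ)) :
    UniformContinuous fun i => (y i).pairing f := by
  have of_mem_span {g} (hg : g ∈ Submodule.span ℝ (range cosMap)) :
      UniformContinuous fun i => (y i).pairing g := by
    induction hg using Submodule.span_induction with
    | mem g hg => obtain ⟨n, rfl⟩ := hg; exact hy n
    | zero => simpa [pairing] using uniformContinuous_const
    | add g h _ _ hg hh => simpa only [pairing_add] using hg.add hh
    | smul a g _ hg => simp_rw [pairing_smul]; exact hg.const_smul a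
  refine uniformContinuous_of_uniform_approx_of_uniformContinuous fun V hV => ?_
  obtain ⟨ε, hε, hεV⟩ := Metric.mem_uniformity_dist.1 hV
  obtain ⟨g, hg, hfg⟩ := Metric.mem_closure_iff.1 (dense_span_cosMap f) ε hε
  refine ⟨_, of_mem_span hg, fun i => hεV ?_⟩
  rw [Real.dist_eq, ← pairing_sub]
  exact ((y i).abs_pairing_le _).trans_lt (dist_eq_norm f g ▸ hfg)

lemma isUniformInducing_coef : IsUniformInducing fun (p : SubMeasure) n => p.coef n := by
  refine ⟨le_antisymm ?_ ?_⟩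
  · rw [uniformity_eq_iInf_pairing]
    let u : UniformSpace SubMeasure := .comap (fun p n => p.coef n) inferInstance
    exact le_iInf fun f => tendsto_iff_comap.1 <|
      @uniformContinuous_pairing_of_coef SubMeasure u id
        (uniformContinuous_pi.1 uniformContinuous_comap) f
  · exact tendsto_iff_comap.1 <|
      uniformContinuous_pi.2 fun n => uniformContinuous_pairing (cosMap n)

instance : (uniformity SubMeasure).IsCountablyGenerated :=
  isUniformInducing_coef.comap_uniformity ▸ inferInstance

instance : CompactSpace SubMeasure := by
  refine ⟨isInducing_fin.isCompact_iff.2 ?_⟩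
  convert isCompact_setOfPred_finiteMeasure_le_of_compactSpace unitInterval 1
  ext μ
  exact ⟨fun ⟨p, _, hp⟩ => hp ▸ p.mass_le, fun hμ => ⟨⟨μ, hμ⟩, trivial, rfl⟩⟩

instance : T2Space SubMeasure :=
  T2Space.of_injective_continuous (fun ⟨_, _⟩ ⟨_, _⟩ h => by congr) isInducing_fin.continuous

end SubMeasure

/-! ### Equicontinuous sets in the Skorohod space -/

namespace SkorohodPath

variable {T : ℝ} {X : Type*} [UniformSpace X]

/-- Continuous paths, as elements of `D([0,T], X)`. -/
def ofContinuous (f : C(Icc (0 : ℝ) T, X)) : SkorohodPath T X where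
  toFun := f
  right_continuous _ := f.continuous.continuousWithinAt
  left_limit t := ⟨f t, (f.continuous.tendsto t).mono_left nhdsWithin_le_nhds⟩

lemma continuous_ofContinuous : Continuous (ofContinuous (T := T) (X := X)) := by
  refine continuous_def.2 fun U hU => isOpen_iff_mem_nhds.2 fun f hf => ?_
  obtain ⟨ε, hε, V, hV, hVU⟩ := hU _ hf
  filter_upwards [ContinuousMap.tendsto_iff_tendstoUniformly.1 tendsto_id V hV] with g hg
  exact hVU _ ⟨OrderIso.refl _, fun t => by simpa using hε, hg⟩

variable {S : Set (SkorohodPath T X)}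

/-- A small time change moves the paths of an equicontinuous set only a little, so Skorohod
convergence within the set is uniform. -/
lemma mem_of_uniformEquicontinuous_of_forall_close
    (hS : UniformEquicontinuous fun (π : S) t => π.1 t)
    (hclosed : IsClosed (ofContinuous ⁻¹' S)) {x : SkorohodPath T X}
    (hx : ∀ ε > 0, ∀ V ∈ uniformity X, ∃ y ∈ S, SkorohodClose ε V x y) : x ∈ S := by
  have uniformly_close : ∀ V ∈ uniformity X, ∃ y ∈ S, ∀ t, (x t, y t) ∈ V := by
    intro V hV
    obtain ⟨W, hW, hWV⟩ := comp_mem_uniformity_sets hV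
    obtain ⟨δ, hδ, hmod⟩ := Metric.mem_uniformity_dist.1 (hS W hW)
    obtain ⟨y, hy, l, hl, hxy⟩ := hx δ hδ W hW
    exact ⟨y, hy, fun t => hWV ⟨y (l t), hxy t, hmod (a := l t) (b := t) (hl t) ⟨y, hy⟩⟩⟩
  have continuous_of_mem {y} (hy : y ∈ S) : Continuous y :=
    (hS.uniformContinuous ⟨y, hy⟩).continuous
  have hcont : Continuous x := continuous_of_uniform_approx_of_continuous fun V hV =>
    let ⟨y, hy, hxy⟩ := uniformly_close V hV
    ⟨y, continuous_of_mem hy, hxy⟩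
  refine hclosed.closure_subset (a := ⟨x, hcont⟩) ?_
  refine (mem_closure_iff_nhds_basis
    (nhds_basis_uniformity' ContinuousMap.hasBasis_compactConvergenceUniformity_of_compact)).2
    fun V hV => ?_
  obtain ⟨y, hy, hxy⟩ := uniformly_close V hV
  exact ⟨⟨y, continuous_of_mem hy⟩, hy, hxy⟩

lemma isClosed_of_uniformEquicontinuous (hS : UniformEquicontinuous fun (π : S) t => π.1 t)
    (hclosed : IsClosed (ofContinuous ⁻¹' S)) : IsClosed S := by
  refine isOpen_compl_iff.1 fun x hx => ?_
  by_contra! hcon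
  exact hx <| mem_of_uniformEquicontinuous_of_forall_close hS hclosed fun ε hε V hV =>
    (hcon ε hε V hV).imp fun y hy => ⟨not_not.1 hy.2, hy.1⟩

lemma isCompact_of_uniformEquicontinuous [CompactSpace X] [T2Space X]
    (hS : UniformEquicontinuous fun (π : S) t => π.1 t)
    (hclosed : IsClosed (ofContinuous ⁻¹' S)) : IsCompact S := by
  have hcompact : IsCompact (ofContinuous ⁻¹' S) := by
    rw [← hclosed.closure_eq]
    refine ArzelaAscoli.isCompact_closure_of_isClosedEmbedding (𝔖 := {K | IsCompact K})
      (F := fun f : C(Icc (0 : ℝ) T, X) => f) (fun K hK => hK)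
      ⟨ContinuousMap.isUniformEmbedding_toUniformOnFunIsCompact.isEmbedding, ?_⟩
      (fun K _ => ?_) fun _ _ t _ => ⟨univ, isCompact_univ, fun _ _ => mem_univ _⟩
    · exact ContinuousMap.range_toUniformOnFunIsCompact (α := Icc (0 : ℝ) T) (β := X) ▸
        UniformOnFun.isClosed_setOfPred_continuous CompactlyCoherentSpace.isCoherentWith
    · exact ((hS.comp fun f : ofContinuous ⁻¹' S => ⟨_, f.2⟩).equicontinuous).equicontinuousOn K
  refine (hcompact.image continuous_ofContinuous).of_isClosed_subset
    (isClosed_of_uniformEquicontinuous hS hclosed) fun π hπ => ?_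
  exact ⟨⟨π, (hS.uniformContinuous ⟨π, hπ⟩).continuous⟩, hπ, rfl⟩

end SkorohodPath

/-! ### Measures with a density in `[0,1]` -/

lemma measure_le_of_forall_lintegral_le {X : Type*} [TopologicalSpace X] [MeasurableSpace X]
    [BorelSpace X] [HasOuterApproxClosed X] {μ ν : Measure X} [IsFiniteMeasure μ]
    [μ.WeaklyRegular] [IsFiniteMeasure ν]
    (h : ∀ f : BoundedContinuousFunction X ℝ≥0, ∫⁻ x, f x ∂μ ≤ ∫⁻ x, f x ∂ν) : μ ≤ ν := by
  have le_of_isClosed {F : Set X} (hF : IsClosed F) : μ F ≤ ν F :=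
    le_of_tendsto_of_tendsto' (HasOuterApproxClosed.tendsto_lintegral_apprSeq hF μ)
      (HasOuterApproxClosed.tendsto_lintegral_apprSeq hF ν) fun n => h (hF.apprSeq n)
  refine Measure.le_iff.2 fun s hs => ?_
  rw [hs.measure_eq_iSup_isClosed_of_ne_top (measure_ne_top _ _)]
  exact iSup₂_le fun K hK => iSup_le fun hc => (le_of_isClosed hc).trans (measure_mono hK)

namespace SubMeasure

lemma measurable_density (p : SubMeasure) : Measurable p.density :=
  (Measure.measurable_rnDeriv _ _).ennreal_toReal

lemma density_nonneg (p : SubMeasure) (x : unitInterval) : 0 ≤ p.density x :=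
  ENNReal.toReal_nonneg

lemma density_mem_of_le_volume {p : SubMeasure} (h : p.meas ≤ volume) :
    ∀ᵐ x, p.density x ∈ Icc (0 : ℝ) 1 := by
  filter_upwards [Measure.rnDeriv_le_one_of_le h] with x hx
  exact ⟨p.density_nonneg x, ENNReal.toReal_le_of_le_ofReal zero_le_one (by simpa using hx)⟩

lemma meas_eq_withDensity {p : SubMeasure} (h : p.meas ≪ volume) :
    p.meas = volume.withDensity fun x => ENNReal.ofReal (p.density x) := by
  conv_lhs => rw [← Measure.withDensity_rnDeriv_eq _ _ h]
  refine withDensity_congr_ae ?_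
  filter_upwards [Measure.rnDeriv_lt_top p.meas volume] with x hx
  rw [density, ENNReal.ofReal_toReal hx.ne]

lemma isAC_iff_le_volume {p : SubMeasure} : p.IsAC ↔ p.meas ≤ volume := by
  constructor
  · rintro ⟨g, -, hg, hp⟩
    calc p.meas ≤ volume.withDensity 1 := hp ▸ withDensity_mono (ae_of_all _ fun x => by
          simpa using ENNReal.ofReal_le_one.2 (hg x).2)
      _ = volume := withDensity_one
  · refine fun h => ⟨fun x => min (p.density x) 1, p.measurable_density.min measurable_const,
      fun x => ⟨le_min (p.density_nonneg x) zero_le_one, min_le_right _ _⟩, ?_⟩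
    rw [meas_eq_withDensity h.absolutelyContinuous]
    refine withDensity_congr_ae ?_
    filter_upwards [density_mem_of_le_volume h] with x hx
    rw [min_eq_left hx.2]

lemma IsAC.density_mem {p : SubMeasure} (h : p.IsAC) : ∀ᵐ x, p.density x ∈ Icc (0 : ℝ) 1 :=
  density_mem_of_le_volume (isAC_iff_le_volume.1 h)

lemma isClosed_setOf_isAC : IsClosed {p : SubMeasure | p.IsAC} := by
  let lebesgue : FiniteMeasure unitInterval := ⟨volume, inferInstance⟩
  have setOf_isAC_eq : {p : SubMeasure | p.IsAC} =
      ⋂ f, {p | p.fin.testAgainstNN f ≤ lebesgue.testAgainstNN f} := by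
    ext p
    simp only [mem_ofPred_eq, mem_iInter, isAC_iff_le_volume, ← ENNReal.coe_le_coe,
      FiniteMeasure.testAgainstNN_coe_eq]
    exact ⟨fun h f => lintegral_mono' h le_rfl, measure_le_of_forall_lintegral_le⟩
  exact setOf_isAC_eq ▸ isClosed_iInter fun f => isClosed_le
    ((FiniteMeasure.continuous_testAgainstNN_eval f).comp isInducing_fin.continuous)
    continuous_const

lemma IsAC.integrable_density_mul {p : SubMeasure} (h : p.IsAC) {f : unitInterval → ℝ}
    (hf : Integrable f) : Integrable fun x => p.density x * f x := by
  refine hf.bdd_mul (c := 1) p.measurable_density.aestronglyMeasurable ?_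
  filter_upwards [h.density_mem] with x hx
  exact (Real.norm_of_nonneg hx.1).trans_le hx.2

lemma IsAC.pairing_eq {p : SubMeasure} (h : p.IsAC) (f : C(unitInterval, ℝ)) :
    p.pairing f = ∫ x, p.density x * f x := by
  rw [pairing, meas_eq_withDensity (isAC_iff_le_volume.1 h).absolutelyContinuous,
    integral_withDensity_eq_integral_toReal_smul
      p.measurable_density.ennreal_ofReal (ae_of_all _ fun _ => ENNReal.ofReal_lt_top)]
  simp_rw [ENNReal.toReal_ofReal (p.density_nonneg _), smul_eq_mul]

lemma IsAC.abs_integral_density_mul_le {p : SubMeasure} (hp : p.IsAC) {f : unitInterval → ℝ}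
    (hf : Integrable f) : |∫ x, p.density x * f x| ≤ ∫ x, |f x| := by
  refine (norm_integral_le_integral_norm _).trans
    (integral_mono_ae (hp.integrable_density_mul hf).norm hf.abs ?_)
  filter_upwards [hp.density_mem] with x hx
  rw [norm_mul, Real.norm_of_nonneg hx.1]
  exact mul_le_of_le_one_left (norm_nonneg _) hx.2

lemma tendsto_integral_density_mul {ι : Type*} {F : Filter ι} {y : ι → SubMeasure}
    {p : SubMeasure} (hy : ∀ i, (y i).IsAC) (hp : p.IsAC) (h : Tendsto y F (𝓝 p))
    {f : unitInterval → ℝ} (hf : Integrable f) :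
    Tendsto (fun i => ∫ x, (y i).density x * f x) F (𝓝 (∫ x, p.density x * f x)) := by
  refine Metric.tendsto_nhds.2 fun ε hε => ?_
  obtain ⟨g, hfg, hg⟩ := hf.exists_boundedContinuous_integral_sub_le (ε := ε / 4) (by linarith)
  have abs_sub_pairing_le {q : SubMeasure} (hq : q.IsAC) :
      |(∫ x, q.density x * f x) - q.pairing g.toContinuousMap| ≤ ε / 4 := by
    have sub_eq : (∫ x, q.density x * f x) - q.pairing g.toContinuousMap =
        ∫ x, q.density x * (f x - g x) := by
      simp_rw [hq.pairing_eq, mul_sub]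
      exact (integral_sub (hq.integrable_density_mul hf) (hq.integrable_density_mul hg)).symm
    exact sub_eq ▸ (hq.abs_integral_density_mul_le (hf.sub hg)).trans hfg
  have hpairing := ((uniformContinuous_pairing g.toContinuousMap).continuous.tendsto p).comp h
  filter_upwards [Metric.tendsto_nhds.1 hpairing (ε / 4) (by linarith)] with i hi
  have hyi := abs_le.1 (abs_sub_pairing_le (hy i))
  have hp' := abs_le.1 (abs_sub_pairing_le hp)
  rw [Real.dist_eq, abs_lt] at hi ⊢
  simp only [Function.comp_apply] at hi
  constructor <;> linarith

end SubMeasure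

/-! ### Measurability along paths -/

variable {T : ℝ}

lemma leb_univ (T : ℝ) : leb T univ = ENNReal.ofReal T := by
  rw [leb, (MeasurableEmbedding.subtype_coe measurableSet_Icc).comap_apply,
    image_univ, Subtype.range_coe, Real.volume_Icc, sub_zero]

instance (T : ℝ) : IsFiniteMeasure (leb T) := ⟨leb_univ T ▸ ENNReal.ofReal_lt_top⟩

lemma leb_real_univ (hT : 0 ≤ T) : (leb T).real univ = T := by
  rw [Measure.real, leb_univ, ENNReal.toReal_ofReal hT]

lemma integral_leb (hT : 0 ≤ T) (f : ℝ → ℝ) :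
    ∫ t : Icc (0 : ℝ) T, f t ∂leb T = ∫ t in 0..T, f t := by
  rw [leb, integral_subtype_comap measurableSet_Icc, integral_Icc_eq_integral_Ioc,
    intervalIntegral.integral_of_le hT]

/-- The next point of the grid of mesh `1 / (n + 1)` after `t`. -/
def gridAbove (n : ℕ) (t : ℝ) : ℝ := (⌊t * (n + 1)⌋ + 1) / (n + 1)

lemma le_gridAbove (n : ℕ) (t : ℝ) : t ≤ gridAbove n t := by
  rw [gridAbove, le_div_iff₀ (by positivity)]
  exact (Int.lt_floor_add_one _).le

lemma gridAbove_le (n : ℕ) (t : ℝ) : gridAbove n t ≤ t + 1 / (n + 1) := by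
  rw [gridAbove, add_div]
  gcongr
  exact (div_le_iff₀ (by positivity)).2 (Int.floor_le _)

lemma tendsto_gridAbove (t : ℝ) : Tendsto (gridAbove · t) atTop (𝓝 t) := by
  have hright : Tendsto (fun n : ℕ => t + 1 / ((n : ℝ) + 1)) atTop (𝓝 t) := by
    simpa using tendsto_const_nhds.add (tendsto_one_div_add_atTop_nhds_zero_nat (𝕜 := ℝ))
  exact tendsto_of_tendsto_of_tendsto_of_le_of_le tendsto_const_nhds hright
    (le_gridAbove · t) (gridAbove_le · t)

lemma measurable_of_continuousWithinAt_Ici {Y : Type*} [TopologicalSpace Y]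
    [TopologicalSpace.PseudoMetrizableSpace Y] [MeasurableSpace Y] [BorelSpace Y]
    {g : Icc (0 : ℝ) T → Y} (hg : ∀ t, ContinuousWithinAt g (Ici t) t) : Measurable g := by
  rcases isEmpty_or_nonempty (Icc (0 : ℝ) T) with _ | hne
  · exact measurable_of_empty g
  have hT : 0 ≤ T := nonempty_Icc.1 (nonempty_coe_sort.1 hne)
  let grid (n : ℕ) (t : Icc (0 : ℝ) T) : Icc (0 : ℝ) T := projIcc 0 T hT (gridAbove n t)
  have measurable_step (n : ℕ) : Measurable fun t => g (grid n t) :=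
    (measurable_of_countable fun k : ℤ => g (projIcc 0 T hT ((k + 1) / (n + 1)))).comp
      (Int.measurable_floor.comp (measurable_subtype_coe.mul_const _))
  refine measurable_of_tendsto_metrizable measurable_step (tendsto_pi_nhds.2 fun t => ?_)
  refine (hg t).tendsto.comp (tendsto_nhdsWithin_iff.2 ⟨?_, Eventually.of_forall fun n => ?_⟩)
  · have hproj := (continuous_projIcc (h := hT)).continuousAt.tendsto.comp (tendsto_gridAbove t)
    rwa [projIcc_val] at hproj
  · calc t = projIcc 0 T hT t := (projIcc_val hT t).symm
      _ ≤ grid n t := monotone_projIcc hT (le_gridAbove n t)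

namespace MPath

lemma measurable_comp {Y : Type*} [TopologicalSpace Y]
    [TopologicalSpace.PseudoMetrizableSpace Y] [MeasurableSpace Y] [BorelSpace Y]
    {φ : SubMeasure → Y} (hφ : Continuous φ) (π : MPath T) : Measurable fun t => φ (π t) :=
  measurable_of_continuousWithinAt_Ici fun t =>
    hφ.continuousAt.comp_continuousWithinAt (π.right_continuous t)

lemma measurable_meas (π : MPath T) : Measurable fun t => (π t).meas := by
  refine Measurable.measure_of_isPiSystem (S := {s | IsClosed s})
    (borel_eq_generateFrom_isClosed (α := unitInterval) ▸ BorelSpace.measurable_eq)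
    isPiSystem_isClosed (fun F (hF : IsClosed F) => ?_) ?_
  · refine measurable_of_tendsto_metrizable (fun n => ?_) (tendsto_pi_nhds.2 fun t =>
      HasOuterApproxClosed.tendsto_lintegral_apprSeq hF (π t).meas)
    simp_rw [SubMeasure.meas, ← FiniteMeasure.testAgainstNN_coe_eq]
    exact (π.measurable_comp ((FiniteMeasure.continuous_testAgainstNN_eval _).comp
      SubMeasure.isInducing_fin.continuous)).coe_nnreal_ennreal
  · simp_rw [SubMeasure.meas, ← FiniteMeasure.ennreal_mass]
    exact (π.measurable_comp (FiniteMeasure.continuous_mass.comp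
      SubMeasure.isInducing_fin.continuous)).coe_nnreal_ennreal

lemma exists_joint_density (π : MPath T) (h : ∀ t, (π t).IsAC) :
    ∃ U : Icc (0 : ℝ) T → unitInterval → ℝ, Measurable (Function.uncurry U) ∧
      (∀ t x, U t x ∈ Icc (0 : ℝ) 1) ∧ ∀ t, (π t).density =ᵐ[volume] U t := by
  let κ : ProbabilityTheory.Kernel (Icc (0 : ℝ) T) unitInterval := ⟨_, π.measurable_meas⟩
  let η : ProbabilityTheory.Kernel (Icc (0 : ℝ) T) unitInterval :=
    ProbabilityTheory.Kernel.const _ volume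
  have : ProbabilityTheory.IsFiniteKernel κ := ⟨1, ENNReal.one_lt_top, fun t => (π t).meas_univ_le⟩
  refine ⟨fun t x => min (κ.rnDeriv η t x).toReal 1,
    (ProbabilityTheory.Kernel.measurable_rnDeriv κ η).ennreal_toReal.min measurable_const,
    fun t x => ⟨le_min ENNReal.toReal_nonneg zero_le_one, min_le_right _ _⟩, fun t => ?_⟩
  have rnDeriv_eq : κ.rnDeriv η t =ᵐ[volume] (π t).meas.rnDeriv volume :=
    ProbabilityTheory.Kernel.rnDeriv_eq_rnDeriv_measure (κ := κ) (η := η) (a := t)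
  filter_upwards [rnDeriv_eq, (h t).density_mem] with x hx hx1
  exact hx ▸ (min_eq_left hx1.2).symm

end MPath

/-! ### Cosine and sine expansions on the unit interval -/

lemma integral_unitInterval (f : ℝ → ℝ) : ∫ x : unitInterval, f x = ∫ x in 0..1, f x := by
  rw [unitInterval.volume_def, integral_subtype_comap measurableSet_Icc,
    integral_Icc_eq_integral_Ioc, intervalIntegral.integral_of_le zero_le_one]

lemma integrable_of_continuous {f : unitInterval → ℝ} (hf : Continuous f) : Integrable f :=
  hf.integrable_of_hasCompactSupport (HasCompactSupport.of_compactSpace _)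

lemma memLp_of_continuous {f : unitInterval → ℝ} (hf : Continuous f) : MemLp f 2 :=
  hf.memLp_of_hasCompactSupport (HasCompactSupport.of_compactSpace _)

lemma integral_cos_int_mul_pi {k : ℤ} (hk : k ≠ 0) :
    ∫ x : unitInterval, Real.cos (k * Real.pi * x) = 0 := by
  have hfreq : (k : ℝ) * Real.pi ≠ 0 := mul_ne_zero (by exact_mod_cast hk) Real.pi_ne_zero
  rw [integral_unitInterval fun x => Real.cos (k * Real.pi * x),
    intervalIntegral.integral_comp_mul_left _ hfreq, integral_cos]
  simp [Real.sin_int_mul_pi]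

lemma integral_cosMap (n : ℕ) : ∫ x, cosMap n x = if n = 0 then 1 else 0 := by
  split_ifs with h
  · simp [h]
  · simpa using integral_cos_int_mul_pi (k := n) (by exact_mod_cast h)

/-- The weight of the `n`-th term of a cosine series, the inverse of `∫ cos² (nπx) dx`. -/
def cosWeight (n : ℕ) : ℝ := if n = 0 then 1 else 2

lemma cosWeight_zero : cosWeight 0 = 1 := if_pos rfl

lemma cosWeight_of_ne {n : ℕ} (hn : n ≠ 0) : cosWeight n = 2 := if_neg hn

lemma cosWeight_pos (n : ℕ) : 0 < cosWeight n := by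
  unfold cosWeight; split_ifs <;> norm_num

lemma cosWeight_le (n : ℕ) : cosWeight n ≤ 2 := by
  unfold cosWeight; split_ifs <;> norm_num

lemma integral_cosMap_mul_cosMap (m n : ℕ) :
    ∫ x, cosMap m x * cosMap n x = if m = n then (cosWeight n)⁻¹ else 0 := by
  have product_to_sum (x : unitInterval) : cosMap m x * cosMap n x =
      (1 / 2) * (Real.cos (((m + n : ℕ) : ℤ) * Real.pi * x) +
        Real.cos (((m : ℤ) - n : ℤ) * Real.pi * x)) := by
    simp only [cosMap_apply]
    push_cast
    rw [add_mul, add_mul, sub_mul, sub_mul, Real.cos_add, Real.cos_sub]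
    ring
  simp_rw [product_to_sum]
  rw [integral_const_mul, integral_add (integrable_of_continuous (by fun_prop))
    (integrable_of_continuous (by fun_prop))]
  rcases eq_or_ne m n with rfl | hmn
  · rcases eq_or_ne m 0 with rfl | hm
    · norm_num [cosWeight]
    · rw [integral_cos_int_mul_pi (by omega)]
      simp [cosWeight, hm]
  · rw [integral_cos_int_mul_pi (by omega), integral_cos_int_mul_pi (by omega)]
    simp [hmn]

/-- The function `x ↦ sin (nπx)` on `[0,1]`. -/
def sinMap (n : ℕ) : C(unitInterval, ℝ) := ⟨fun x => Real.sin (n * Real.pi * x), by fun_prop⟩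

@[simp] lemma sinMap_apply (n : ℕ) (x : unitInterval) :
    sinMap n x = Real.sin (n * Real.pi * x) := rfl

lemma integral_sinMap_mul_sinMap (m n : ℕ) :
    ∫ x, sinMap m x * sinMap n x = if m = n ∧ n ≠ 0 then 1 / 2 else 0 := by
  have product_to_sum (x : unitInterval) : sinMap m x * sinMap n x =
      (1 / 2) * (Real.cos (((m : ℤ) - n : ℤ) * Real.pi * x) -
        Real.cos (((m + n : ℕ) : ℤ) * Real.pi * x)) := by
    simp only [sinMap_apply]
    push_cast
    rw [add_mul, add_mul, sub_mul, sub_mul, Real.cos_add, Real.cos_sub]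
    ring
  simp_rw [product_to_sum]
  rw [integral_const_mul, integral_sub (integrable_of_continuous (by fun_prop))
    (integrable_of_continuous (by fun_prop))]
  rcases eq_or_ne m n with rfl | hmn
  · rcases eq_or_ne m 0 with rfl | hm
    · simp
    · rw [integral_cos_int_mul_pi (k := ((m + m : ℕ) : ℤ)) (by omega)]
      simp [hm]
  · rw [integral_cos_int_mul_pi (by omega), integral_cos_int_mul_pi (by omega)]
    simp [hmn]

lemma integral_sin_polynomial_sq_le (s : Finset ℕ) (a : ℕ → ℝ) :
    ∫ x, (∑ n ∈ s, a n * sinMap n x) ^ 2 ≤ 1 / 2 * ∑ n ∈ s, a n ^ 2 := by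
  have sq_eq (x : unitInterval) : (∑ n ∈ s, a n * sinMap n x) ^ 2 =
      ∑ m ∈ s, ∑ n ∈ s, (a m * a n) * (sinMap m x * sinMap n x) := by
    rw [sq, Finset.sum_mul_sum]
    exact Finset.sum_congr rfl fun _ _ => Finset.sum_congr rfl fun _ _ => by ring
  simp_rw [sq_eq]
  rw [integral_finsetSum _ fun m _ => integrable_of_continuous (by fun_prop), Finset.mul_sum]
  refine Finset.sum_le_sum fun m hm => ?_
  rw [integral_finsetSum _ fun n _ => integrable_of_continuous (by fun_prop)]
  simp_rw [integral_const_mul, integral_sinMap_mul_sinMap]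
  rw [Finset.sum_eq_single_of_mem m hm fun n _ hn => by simp [hn.symm]]
  split_ifs
  · linarith
  · nlinarith [sq_nonneg (a m)]

lemma inner_toLp_toLp {u v : unitInterval → ℝ} (hu : MemLp u 2) (hv : MemLp v 2) :
    inner ℝ (hu.toLp u) (hv.toLp v) = ∫ x, u x * v x := by
  rw [L2.inner_def]
  refine integral_congr_ae ?_
  filter_upwards [hu.coeFn_toLp, hv.coeFn_toLp] with x hux hvx
  simp [hux, hvx, mul_comm]

/-- The normalized functions `sin ((n+1)πx)` in `L²`. -/
def sinLp (n : ℕ) : Lp ℝ 2 (volume : Measure unitInterval) :=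
  √2 • (memLp_of_continuous (sinMap (n + 1)).continuous).toLp

lemma orthonormal_sinLp : Orthonormal ℝ sinLp := by
  classical
  refine orthonormal_iff_ite.2 fun m n => ?_
  rw [sinLp, sinLp, real_inner_smul_left, real_inner_smul_right, inner_toLp_toLp,
    integral_sinMap_mul_sinMap, ← mul_assoc, Real.mul_self_sqrt zero_le_two]
  simp

lemma sin_bessel (N : ℕ) {g : unitInterval → ℝ} (hg : MemLp g 2) :
    2 * ∑ n ∈ Finset.range N, (∫ x, g x * sinMap n x) ^ 2 ≤ ∫ x, g x ^ 2 := by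
  have inner_sinLp (n : ℕ) : inner ℝ (sinLp n) (hg.toLp g) = √2 * ∫ x, g x * sinMap (n + 1) x := by
    rw [sinLp, real_inner_smul_left, real_inner_comm, inner_toLp_toLp]
  have hbessel := orthonormal_sinLp.sum_inner_products_le (s := Finset.range N) (hg.toLp g)
  simp_rw [inner_sinLp, ← real_inner_self_eq_norm_sq (hg.toLp g), inner_toLp_toLp,
    Real.norm_eq_abs, sq_abs, mul_pow, Real.sq_sqrt zero_le_two, ← Finset.mul_sum,
    ← sq] at hbessel
  refine le_trans ?_ hbessel
  gcongr 2 * ?_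
  calc ∑ n ∈ Finset.range N, (∫ x, g x * sinMap n x) ^ 2
      ≤ ∑ n ∈ Finset.range (N + 1), (∫ x, g x * sinMap n x) ^ 2 :=
        Finset.sum_le_sum_of_subset_of_nonneg (Finset.range_mono N.le_succ)
          fun _ _ _ => sq_nonneg _
    _ = ∑ n ∈ Finset.range N, (∫ x, g x * sinMap (n + 1) x) ^ 2 := by
        simp [Finset.sum_range_succ' _ N]

/-- The normalized cosines in `L²`. -/
def cosLp (n : ℕ) : Lp ℝ 2 (volume : Measure unitInterval) :=
  √(cosWeight n) • ContinuousMap.toLp 2 volume ℝ (cosMap n)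

lemma inner_cosLp {u : unitInterval → ℝ} (hu : MemLp u 2) (n : ℕ) :
    inner ℝ (cosLp n) (hu.toLp u) = √(cosWeight n) * ∫ x, u x * cosMap n x := by
  rw [cosLp, real_inner_smul_left, real_inner_comm]
  exact congrArg _ (inner_toLp_toLp hu (memLp_of_continuous (cosMap n).continuous))

lemma orthonormal_cosLp : Orthonormal ℝ cosLp := by
  classical
  refine orthonormal_iff_ite.2 fun m n => ?_
  have cosLp_eq : cosLp n =
      √(cosWeight n) • (memLp_of_continuous (cosMap n).continuous).toLp := rfl
  rw [cosLp_eq, real_inner_smul_right, inner_cosLp, integral_cosMap_mul_cosMap]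
  split_ifs with h h' h'
  · rw [h, ← mul_assoc, Real.mul_self_sqrt (cosWeight_pos _).le,
      mul_inv_cancel₀ (cosWeight_pos _).ne']
  · exact absurd h.symm h'
  · exact absurd h'.symm h
  · simp

lemma span_cosLp_dense : ⊤ ≤ (Submodule.span ℝ (range cosLp)).topologicalClosure := by
  let L := ContinuousMap.toLp (E := ℝ) 2 (volume : Measure unitInterval) ℝ
  have hdense : Dense (L '' Submodule.span ℝ (range cosMap)) :=
    (ContinuousMap.toLp_denseRange ℝ volume ℝ (by norm_num)).dense_image
      L.continuous dense_span_cosMap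
  have image_subset : L '' Submodule.span ℝ (range cosMap) ⊆ Submodule.span ℝ (range cosLp) := by
    rw [image_subset_iff]
    refine Submodule.span_le (p := (Submodule.span ℝ (range cosLp)).comap L.toLinearMap).2 ?_
    rintro _ ⟨n, rfl⟩
    have toLp_cosMap : L (cosMap n) = (√(cosWeight n))⁻¹ • cosLp n := by
      rw [cosLp, smul_smul, inv_mul_cancel₀ (Real.sqrt_pos.2 (cosWeight_pos n)).ne', one_smul]
    exact Submodule.mem_comap.2 <|
      toLp_cosMap.symm ▸ Submodule.smul_mem _ _ (Submodule.subset_span ⟨n, rfl⟩)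
  exact fun f _ => hdense.mono image_subset f

/-- The cosine basis of `L²([0,1])`. -/
def cosBasis : HilbertBasis ℕ ℝ (Lp ℝ 2 (volume : Measure unitInterval)) :=
  HilbertBasis.mk orthonormal_cosLp span_cosLp_dense

lemma cosBasis_apply (n : ℕ) : cosBasis n = cosLp n := by
  rw [cosBasis, HilbertBasis.coe_mk]

lemma cos_parseval {u v : unitInterval → ℝ} (hu : MemLp u 2) (hv : MemLp v 2) :
    HasSum (fun n => cosWeight n * (∫ x, u x * cosMap n x) * ∫ x, v x * cosMap n x)
      (∫ x, u x * v x) := by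
  have hsum := cosBasis.hasSum_inner_mul_inner (hu.toLp u) (hv.toLp v)
  rw [inner_toLp_toLp] at hsum
  have term_eq (n : ℕ) :
      inner ℝ (hu.toLp u) (cosBasis n) * inner ℝ (cosBasis n) (hv.toLp v) =
        cosWeight n * (∫ x, u x * cosMap n x) * ∫ x, v x * cosMap n x := by
    rw [cosBasis_apply, real_inner_comm, inner_cosLp hu, inner_cosLp hv]
    linear_combination ((∫ x, u x * cosMap n x) * ∫ x, v x * cosMap n x) *
      Real.mul_self_sqrt (cosWeight_pos n).le
  simpa only [term_eq] using hsum

lemma ae_eq_of_cos_coef_eq {u v : unitInterval → ℝ} (hu : MemLp u 2) (hv : MemLp v 2)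
    (h : ∀ n, ∫ x, u x * cosMap n x = ∫ x, v x * cosMap n x) : u =ᵐ[volume] v := by
  have toLp_eq : hu.toLp u = hv.toLp v := by
    refine cosBasis.repr.injective (lp.ext (funext fun n => ?_))
    simp_rw [HilbertBasis.repr_apply_apply, cosBasis_apply, inner_cosLp, h n]
  exact (MemLp.toLp_eq_toLp_iff hu hv).1 toLp_eq

/-! ### Fejér means -/

lemma sum_cosWeight_mul_cos (N : ℕ) (θ : ℝ) :
    ∑ n ∈ Finset.range (N + 1), cosWeight n * Real.cos (n * θ) =
      1 + 2 * ∑ k ∈ Finset.range N, Real.cos (N * θ - k * θ) := by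
  rw [Finset.sum_range_succ', Finset.mul_sum, ← Finset.sum_range_reflect, add_comm]
  simp only [cosWeight_zero, Nat.cast_zero, zero_mul, Real.cos_zero, mul_one]
  congr 1
  refine Finset.sum_congr rfl fun k hk => ?_
  have hkN : k < N := Finset.mem_range.1 hk
  rw [cosWeight_of_ne (by omega), show N - 1 - k + 1 = N - k by omega, Nat.cast_sub hkN.le,
    sub_mul]

lemma sum_fejer_kernel_eq_sq_add_sq (N : ℕ) (θ : ℝ) :
    ∑ n ∈ Finset.range N, cosWeight n * (N - n) * Real.cos (n * θ) =
      (∑ n ∈ Finset.range N, Real.cos (n * θ)) ^ 2 +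
        (∑ n ∈ Finset.range N, Real.sin (n * θ)) ^ 2 := by
  induction N with
  | zero => simp
  | succ N ih =>
    have sum_succ :
        ∑ n ∈ Finset.range (N + 1), cosWeight n * ((N + 1 : ℕ) - n) * Real.cos (n * θ) =
          ∑ n ∈ Finset.range N, cosWeight n * (N - n) * Real.cos (n * θ) +
            ∑ n ∈ Finset.range (N + 1), cosWeight n * Real.cos (n * θ) := by
      rw [Finset.sum_range_succ, Finset.sum_range_succ _ N, ← add_assoc, ← Finset.sum_add_distrib]
      push_cast
      congr 1
      · exact Finset.sum_congr rfl fun _ _ => by ring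
      · ring
    rw [sum_succ, sum_cosWeight_mul_cos, ih, Finset.sum_range_succ, Finset.sum_range_succ]
    simp_rw [Real.cos_sub]
    rw [Finset.sum_add_distrib, ← Finset.mul_sum, ← Finset.mul_sum]
    linear_combination -Real.sin_sq_add_cos_sq (N * θ)

/-- The coefficients of the Fejér mean of order `N`. -/
def fejerCoef (N n : ℕ) : ℝ := cosWeight n * (1 - n / N)

lemma fejerCoef_nonneg {N n : ℕ} (h : n < N) : 0 ≤ fejerCoef N n := by
  have hN : (0 : ℝ) < N := by exact_mod_cast (Nat.zero_le n).trans_lt h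
  refine mul_nonneg (cosWeight_pos n).le (sub_nonneg.2 ((div_le_one hN).2 ?_))
  exact_mod_cast h.le

lemma fejerCoef_le (N n : ℕ) : fejerCoef N n ≤ 2 :=
  (mul_le_of_le_one_right (cosWeight_pos n).le (sub_le_self 1 (by positivity))).trans
    (cosWeight_le n)

lemma fejer_kernel_nonneg {N : ℕ} (hN : N ≠ 0) (θ : ℝ) :
    0 ≤ ∑ n ∈ Finset.range N, fejerCoef N n * Real.cos (n * θ) := by
  have kernel_eq : ∑ n ∈ Finset.range N, fejerCoef N n * Real.cos (n * θ) = (N : ℝ)⁻¹ *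
      ∑ n ∈ Finset.range N, cosWeight n * (N - n) * Real.cos (n * θ) := by
    rw [Finset.mul_sum]
    refine Finset.sum_congr rfl fun n _ => ?_
    unfold fejerCoef
    field_simp
  rw [kernel_eq, sum_fejer_kernel_eq_sq_add_sq]
  positivity

/-- The Fejér mean of order `N` of the cosine series with coefficients `c`. -/
def fejerSum (N : ℕ) (c : ℕ → ℝ) (x : ℝ) : ℝ :=
  ∑ n ∈ Finset.range N, fejerCoef N n * c n * Real.cos (n * Real.pi * x)

namespace SubMeasure

lemma pairing_sum (p : SubMeasure) {ι : Type*} (s : Finset ι) (f : ι → C(unitInterval, ℝ)) :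
    p.pairing (∑ i ∈ s, f i) = ∑ i ∈ s, p.pairing (f i) := by
  simp only [pairing, ContinuousMap.coe_sum, Finset.sum_apply]
  exact integral_finsetSum _ fun i _ => p.integrable_continuousMap (f i)

lemma pairing_sum_smul_cosMap (p : SubMeasure) (s : Finset ℕ) (a : ℕ → ℝ) :
    p.pairing (∑ n ∈ s, a n • cosMap n) = ∑ n ∈ s, a n * p.coef n := by
  simp_rw [pairing_sum, pairing_smul, coef]

lemma IsAC.pairing_le {p : SubMeasure} (h : p.IsAC) {f : C(unitInterval, ℝ)}
    (hf : ∀ x, 0 ≤ f x) : p.pairing f ≤ ∫ x, f x :=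
  integral_mono_measure (isAC_iff_le_volume.1 h) (ae_of_all _ hf)
    (integrable_of_continuous f.continuous)

lemma IsAC.fejerSum_mem {p : SubMeasure} (hp : p.IsAC) {N : ℕ} (hN : N ≠ 0) (x : ℝ) :
    fejerSum N (fun n => p.coef n) x ∈ Icc (0 : ℝ) 1 := by
  let K : C(unitInterval, ℝ) := ∑ n ∈ Finset.range N,
    (fejerCoef N n * Real.cos (n * Real.pi * x)) • cosMap n
  have K_apply (y : unitInterval) : K y = ∑ n ∈ Finset.range N,
      fejerCoef N n * Real.cos (n * Real.pi * x) * cosMap n y := by simp [K]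
  have pairing_K : p.pairing K = fejerSum N (fun n => p.coef n) x := by
    rw [p.pairing_sum_smul_cosMap, fejerSum]
    exact Finset.sum_congr rfl fun n _ => by ring
  have K_nonneg (y : unitInterval) : 0 ≤ K y := by
    have K_eq : K y = 1 / 2 * (∑ n ∈ Finset.range N, fejerCoef N n *
        Real.cos (n * (Real.pi * x - Real.pi * y)) + ∑ n ∈ Finset.range N, fejerCoef N n *
        Real.cos (n * (Real.pi * x + Real.pi * y))) := by
      rw [K_apply, ← Finset.sum_add_distrib, Finset.mul_sum]
      refine Finset.sum_congr rfl fun n _ => ?_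
      rw [cosMap_apply, mul_sub (n : ℝ), mul_add (n : ℝ), Real.cos_add, Real.cos_sub,
        mul_assoc (n : ℝ), mul_assoc (n : ℝ)]
      ring
    rw [K_eq]
    exact mul_nonneg (by norm_num)
      (add_nonneg (fejer_kernel_nonneg hN _) (fejer_kernel_nonneg hN _))
  have integral_K : ∫ y, K y = 1 := by
    simp_rw [K_apply]
    rw [integral_finsetSum _ fun n _ => integrable_of_continuous (by fun_prop)]
    simp_rw [integral_const_mul, integral_cosMap]
    rw [Finset.sum_eq_single_of_mem 0 (Finset.mem_range.2 (Nat.pos_of_ne_zero hN))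
      fun n _ hn => by simp [hn]]
    simp [fejerCoef, cosWeight]
  exact pairing_K ▸ ⟨integral_nonneg K_nonneg, integral_K ▸ hp.pairing_le K_nonneg⟩

lemma IsAC.sum_fejerCoef_mul_sq_le {p : SubMeasure} (hp : p.IsAC) {N : ℕ} (hN : N ≠ 0) :
    ∑ n ∈ Finset.range N, fejerCoef N n * p.coef n ^ 2 ≤ 1 := by
  let F : C(unitInterval, ℝ) := ∑ n ∈ Finset.range N, (fejerCoef N n * p.coef n) • cosMap n
  have F_apply (x : unitInterval) : F x = fejerSum N (fun n => p.coef n) x := by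
    simp [F, fejerSum]
  calc ∑ n ∈ Finset.range N, fejerCoef N n * p.coef n ^ 2 = p.pairing F := by
        rw [p.pairing_sum_smul_cosMap]
        exact Finset.sum_congr rfl fun n _ => by ring
    _ ≤ ‖F‖ := (le_abs_self _).trans (p.abs_pairing_le F)
    _ ≤ 1 := (ContinuousMap.norm_le _ zero_le_one).2 fun x => by
        rw [F_apply, Real.norm_of_nonneg (hp.fejerSum_mem hN x).1]
        exact (hp.fejerSum_mem hN x).2

end SubMeasure

/-! ### Continuous versions -/

instance : (volume : Measure unitInterval).IsOpenPosMeasure := by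
  refine ⟨fun U hU ⟨x, hx⟩ hzero => ?_⟩
  obtain ⟨V, hV, rfl⟩ := isOpen_induced_iff.1 hU
  have hxc : (x : ℝ) ∈ closure (Ioo (0 : ℝ) 1) := by
    rw [closure_Ioo zero_ne_one]; exact x.2
  have hpos := (hV.inter isOpen_Ioo).measure_pos volume (mem_closure_iff.1 hxc V hV hx)
  refine hpos.ne' (le_antisymm ((measure_mono fun y hy => ?_).trans
    (unitInterval.volume_apply.symm.trans hzero).le) zero_le)
  exact ⟨⟨y, Ioo_subset_Icc_self hy.2⟩, hy.1, rfl⟩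

lemma contValue_eq {u : unitInterval → ℝ} {w : C(unitInterval, ℝ)} (h : u =ᵐ[volume] w)
    (x : unitInterval) : contValue u x = w x := by
  have hex : ∃ w : C(unitInterval, ℝ), u =ᵐ[volume] w := ⟨w, h⟩
  have choose_eq : (hex.choose : unitInterval → ℝ) = w :=
    Measure.eq_of_ae_eq (hex.choose_spec.symm.trans h) hex.choose.continuous w.continuous
  rw [contValue, dif_pos hex, choose_eq]

lemma contValue_mem {u : unitInterval → ℝ} (hu : ∀ᵐ x, u x ∈ Icc (0 : ℝ) 1) (x : unitInterval) :
    contValue u x ∈ Icc (0 : ℝ) 1 := by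
  by_cases hex : ∃ w : C(unitInterval, ℝ), u =ᵐ[volume] w
  · obtain ⟨w, hw⟩ := hex
    have ae_mem : ∀ᵐ y, w y ∈ Icc (0 : ℝ) 1 := by
      filter_upwards [hw, hu] with y hwy huy using hwy ▸ huy
    rw [contValue_eq hw]
    exact (isClosed_Icc.preimage w.continuous).closure_subset (Measure.dense_of_ae ae_mem x)
  · rw [contValue, dif_neg hex]
    exact ⟨le_rfl, zero_le_one⟩

/-! ### Cosine test functions -/

lemma integral_le_integral_of_le {X : Type*} [MeasurableSpace X] {μ : Measure X} {f g : X → ℝ}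
    (hg : Integrable g μ) (hg0 : 0 ≤ g) (h : f ≤ᵐ[μ] g) : ∫ x, f x ∂μ ≤ ∫ x, g x ∂μ := by
  by_cases hf : Integrable f μ
  · exact integral_mono_ae hf hg h
  · exact (integral_undef hf).trans_le (integral_nonneg hg0)

lemma integral_le_mul_measureReal {X : Type*} [MeasurableSpace X] {μ : Measure X}
    [IsFiniteMeasure μ] {E : Set X} (hE : MeasurableSet E) {f : X → ℝ} {c : ℝ} (hc : 0 ≤ c)
    (hf : ∀ x, f x ≤ c) (hfE : ∀ x ∉ E, f x = 0) : ∫ x, f x ∂μ ≤ c * μ.real E := by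
  calc ∫ x, f x ∂μ ≤ ∫ x, E.indicator (fun _ => c) x ∂μ := by
        refine integral_le_integral_of_le ((integrable_const c).indicator hE)
          (fun x => indicator_nonneg (fun _ _ => hc) x) (ae_of_all _ fun x => ?_)
        by_cases hx : x ∈ E
        · exact (hf x).trans_eq (indicator_of_mem hx fun _ => c).symm
        · exact (hfE x hx).trans_le (indicator_nonneg (fun _ _ => hc) x)
    _ = c * μ.real E := by rw [integral_indicator_const c hE, smul_eq_mul, mul_comm]

lemma integrable_leb {f : Icc (0 : ℝ) T → ℝ} (hf : Continuous f) : Integrable f (leb T) :=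
  hf.integrable_of_hasCompactSupport (HasCompactSupport.of_compactSpace _)

lemma mobility_le (a : ℝ) : mobility a ≤ 1 / 4 := by
  unfold mobility
  nlinarith [sq_nonneg (a - 1 / 2)]

lemma bdry_zero (ϱ D a : ℝ) : bdry ϱ D a 0 = 0 := by simp [bdry]

lemma bdry_le {ϱ D a M m : ℝ} (hϱ : ϱ ∈ Icc (0 : ℝ) 1) (hD : 0 < D) (ha : a ∈ Icc (0 : ℝ) 1)
    (hM : |M| ≤ m) : bdry ϱ D a M ≤ 1 / D * Real.exp m := by
  have exp_le : Real.exp M - 1 ≤ Real.exp m :=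
    (sub_le_self _ zero_le_one).trans (Real.exp_le_exp.2 ((le_abs_self M).trans hM))
  have exp_neg_le : Real.exp (-M) - 1 ≤ Real.exp m :=
    (sub_le_self _ zero_le_one).trans (Real.exp_le_exp.2 ((neg_le_abs M).trans hM))
  have rate_in_nonneg : 0 ≤ (1 - a) * ϱ := mul_nonneg (sub_nonneg.2 ha.2) hϱ.1
  have rate_out_nonneg : 0 ≤ a * (1 - ϱ) := mul_nonneg ha.1 (sub_nonneg.2 hϱ.2)
  have rates_le_one : (1 - a) * ϱ + a * (1 - ϱ) ≤ 1 := by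
    linarith [mul_nonneg ha.1 hϱ.1, mul_nonneg (sub_nonneg.2 ha.2) (sub_nonneg.2 hϱ.2)]
  unfold bdry
  gcongr
  calc (1 - a) * ϱ * (Real.exp M - 1) + a * (1 - ϱ) * (Real.exp (-M) - 1)
      ≤ (1 - a) * ϱ * Real.exp m + a * (1 - ϱ) * Real.exp m := by gcongr
    _ = ((1 - a) * ϱ + a * (1 - ϱ)) * Real.exp m := by ring
    _ ≤ Real.exp m := mul_le_of_le_one_left (Real.exp_pos m).le rates_le_one

/-- The test function `∑ aₙ(t) cos (nπx)`, where `a'` is the time derivative of `a`. -/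
def cosTest (s : Finset ℕ) (a a' : ℕ → ℝ → ℝ)
    (ha : ∀ n, ∀ t ∈ Icc 0 T, HasDerivWithinAt (a n) (a' n t) (Icc 0 T) t)
    (ha' : ∀ n, ContinuousOn (a' n) (Icc 0 T)) : C12 T where
  toFun t x := ∑ n ∈ s, a n t * Real.cos (n * Real.pi * x)
  dt t x := ∑ n ∈ s, a' n t * Real.cos (n * Real.pi * x)
  dx t x := ∑ n ∈ s, -(n * Real.pi * a n t) * Real.sin (n * Real.pi * x)
  dxx t x := ∑ n ∈ s, -((n * Real.pi) ^ 2 * a n t) * Real.cos (n * Real.pi * x)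
  hasDeriv_dt t ht x _ := HasDerivWithinAt.fun_sum fun n _ => (ha n t ht).mul_const _
  hasDeriv_dx t _ x _ := HasDerivWithinAt.fun_sum fun n _ => HasDerivAt.hasDerivWithinAt <|
    ((((hasDerivAt_id x).const_mul (n * Real.pi)).cos).const_mul (a n t)).congr_deriv
      (by simp only [id]; ring)
  hasDeriv_dxx t _ x _ := HasDerivWithinAt.fun_sum fun n _ => HasDerivAt.hasDerivWithinAt <|
    ((((hasDerivAt_id x).const_mul (n * Real.pi)).sin).const_mul
      (-(n * Real.pi * a n t))).congr_deriv (by simp only [id]; ring)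
  cont := continuousOn_finsetSum _ fun n _ => ContinuousOn.mul
    (ContinuousOn.comp (fun t ht => (ha n t ht).continuousWithinAt) continuousOn_fst
      fun _ hp => hp.1) (by fun_prop)
  cont_dt := continuousOn_finsetSum _ fun n _ => ContinuousOn.mul
    ((ha' n).comp continuousOn_fst fun _ hp => hp.1) (by fun_prop)
  cont_dx := continuousOn_finsetSum _ fun n _ => ContinuousOn.mul
    (ContinuousOn.neg (continuousOn_const.mul (ContinuousOn.comp
      (fun t ht => (ha n t ht).continuousWithinAt) continuousOn_fst fun _ hp => hp.1)))
    (by fun_prop)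
  cont_dxx := continuousOn_finsetSum _ fun n _ => ContinuousOn.mul
    (ContinuousOn.neg (continuousOn_const.mul (ContinuousOn.comp
      (fun t ht => (ha n t ht).continuousWithinAt) continuousOn_fst fun _ hp => hp.1)))
    (by fun_prop)

lemma SubMeasure.IsAC.integral_density_mul_cos_sum {p : SubMeasure} (hp : p.IsAC) (s : Finset ℕ)
    (b : ℕ → ℝ) : ∫ x : unitInterval, p.density x * ∑ n ∈ s, b n * Real.cos (n * Real.pi * x) =
      ∑ n ∈ s, b n * p.coef n := by
  rw [← p.pairing_sum_smul_cosMap, hp.pairing_eq]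
  simp

lemma MPath.integrable_mul_coef (π : MPath T) (n : ℕ) {f : Icc (0 : ℝ) T → ℝ}
    (hf : Continuous f) : Integrable (fun t => f t * (π t).coef n) (leb T) :=
  (integrable_leb hf).mul_bdd (c := 1)
    (π.measurable_comp (SubMeasure.continuous_coef n)).aestronglyMeasurable
    (ae_of_all _ fun t => (π t).abs_coef_le n)

lemma integral_mobility_mul_sin_sum_sq_le (u : unitInterval → ℝ) (s : Finset ℕ) (a : ℕ → ℝ) :
    ∫ x, mobility (u x) * (∑ n ∈ s, a n * sinMap n x) ^ 2 ≤ 1 / 8 * ∑ n ∈ s, a n ^ 2 :=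
  calc ∫ x, mobility (u x) * (∑ n ∈ s, a n * sinMap n x) ^ 2
      ≤ ∫ x, 1 / 4 * (∑ n ∈ s, a n * sinMap n x) ^ 2 :=
        integral_le_integral_of_le (integrable_of_continuous (by fun_prop))
          (fun x => by positivity)
          (ae_of_all _ fun x => mul_le_mul_of_nonneg_right (mobility_le _) (sq_nonneg _))
    _ ≤ 1 / 4 * (1 / 2 * ∑ n ∈ s, a n ^ 2) := by
        rw [integral_const_mul]
        gcongr
        exact integral_sin_polynomial_sq_le s a
    _ = 1 / 8 * ∑ n ∈ s, a n ^ 2 := by ring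

section CosTest

variable (α A β B : ℝ) (hT : 0 < T) {π : MPath T} (hπ : ∀ t, (π t).IsAC) {s : Finset ℕ}
  {a a' : ℕ → ℝ → ℝ} (ha : ∀ n, ∀ t ∈ Icc 0 T, HasDerivWithinAt (a n) (a' n t) (Icc 0 T) t)
  (ha' : ∀ n, ContinuousOn (a' n) (Icc 0 T))

include hπ in
lemma JReal_cosTest :
    JReal α A β B hT (cosTest s a a' ha ha') π =
      ∑ n ∈ s, a n T * (π (timeEnd hT)).coef n - ∑ n ∈ s, a n 0 * (π (timeZero hT)).coef n
      - (∫ t, ∑ n ∈ s, a' n t * (π t).coef n ∂leb T)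
      + (∫ t, ∑ n ∈ s, (n * Real.pi) ^ 2 * a n t * (π t).coef n ∂leb T)
      - (∫ t, (∫ x : unitInterval, mobility ((π t).density x) *
          ((cosTest s a a' ha ha').dx t x) ^ 2) ∂leb T)
      - ∫ t : Icc (0 : ℝ) T,
        (bdry α A (contValue (π t).density 0) ((cosTest s a a' ha ha').toFun t 0) +
          bdry β B (contValue (π t).density 1) ((cosTest s a a' ha ha').toFun t 1)) ∂leb T := by
  have dx_zero (t : ℝ) : (cosTest s a a' ha ha').dx t 0 = 0 := by simp [cosTest]
  have dx_one (t : ℝ) : (cosTest s a a' ha ha').dx t 1 = 0 := by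
    simp [cosTest, Real.sin_nat_mul_pi]
  have pairing_dxx (t : Icc (0 : ℝ) T) :
      ∫ x, (π t).density x * (cosTest s a a' ha ha').dxx t x =
        -∑ n ∈ s, (n * Real.pi) ^ 2 * a n t * (π t).coef n := by
    simp only [cosTest, (hπ t).integral_density_mul_cos_sum]
    simp only [neg_mul, Finset.sum_neg_distrib]
  unfold JReal
  simp_rw [pairing_dxx, dx_zero, dx_one]
  simp only [cosTest, (hπ _).integral_density_mul_cos_sum, mul_zero, integral_zero, add_zero,
    sub_zero, integral_neg, sub_neg_eq_add]

include hπ in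
lemma le_JReal_cosTest :
    ∑ n ∈ s, a n T * (π (timeEnd hT)).coef n - ∑ n ∈ s, a n 0 * (π (timeZero hT)).coef n
      - (∫ t, ∑ n ∈ s, a' n t * (π t).coef n ∂leb T)
      + (∫ t, ∑ n ∈ s, (n * Real.pi) ^ 2 * (a n t * (π t).coef n - 1 / 8 * a n t ^ 2) ∂leb T)
      - (∫ t : Icc (0 : ℝ) T,
        (bdry α A (contValue (π t).density 0) ((cosTest s a a' ha ha').toFun t 0) +
          bdry β B (contValue (π t).density 1) ((cosTest s a a' ha ha').toFun t 1)) ∂leb T)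
      ≤ JReal α A β B hT (cosTest s a a' ha ha') π := by
  have continuous_a (n : ℕ) : Continuous fun t : Icc (0 : ℝ) T => a n t :=
    continuousOn_iff_continuous_domRestrict.1 fun t ht => (ha n t ht).continuousWithinAt
  have integrable_sq : Integrable (fun t : Icc (0 : ℝ) T =>
      1 / 8 * ∑ n ∈ s, (-(n * Real.pi * a n t)) ^ 2) (leb T) :=
    integrable_leb <| continuous_const.mul <| continuous_finsetSum _ fun n _ =>
      ((continuous_const.mul (continuous_a n)).neg).pow 2
  have integrable_drift : Integrable (fun t : Icc (0 : ℝ) T =>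
      ∑ n ∈ s, (n * Real.pi) ^ 2 * a n t * (π t).coef n) (leb T) :=
    integrable_finsetSum _ fun n _ =>
      π.integrable_mul_coef n (continuous_const.mul (continuous_a n))
  have mobility_term_le : ∫ t, (∫ x : unitInterval, mobility ((π t).density x) *
      ((cosTest s a a' ha ha').dx t x) ^ 2) ∂leb T ≤
      ∫ t : Icc (0 : ℝ) T, 1 / 8 * ∑ n ∈ s, (-(n * Real.pi * a n t)) ^ 2 ∂leb T :=
    integral_le_integral_of_le integrable_sq (fun t => by positivity)
      (ae_of_all _ fun t => integral_mobility_mul_sin_sum_sq_le _ s _)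
  have drift_sub : ∫ t, ∑ n ∈ s, (n * Real.pi) ^ 2 *
      (a n t * (π t).coef n - 1 / 8 * a n t ^ 2) ∂leb T =
      (∫ t, ∑ n ∈ s, (n * Real.pi) ^ 2 * a n t * (π t).coef n ∂leb T) -
        ∫ t : Icc (0 : ℝ) T, 1 / 8 * ∑ n ∈ s, (-(n * Real.pi * a n t)) ^ 2 ∂leb T := by
    rw [← integral_sub integrable_drift integrable_sq]
    refine integral_congr_ae (ae_of_all _ fun t => ?_)
    simp only [Finset.mul_sum, ← Finset.sum_sub_distrib]
    exact Finset.sum_congr rfl fun n _ => by ring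
  rw [JReal_cosTest α A β B hT hπ ha ha', drift_sub]
  linarith

end CosTest

/-- The zero test function. -/
def zeroTest (T : ℝ) : C12 T :=
  cosTest ∅ 0 0 (fun _ _ _ => hasDerivWithinAt_const ..) fun _ => continuousOn_const

section Rate

variable {α A β B : ℝ} {hT : 0 < T} {π : MPath T} {q : ℝ}

lemma rate_le_coe_iff :
    rate α A β B hT π ≤ q ↔ HasFiniteEnergy π ∧ ∀ H, JReal α A β B hT H π ≤ q := by
  rw [rate, iSup_le_iff]
  by_cases h : HasFiniteEnergy π
  · simp [J, h]
  · simp only [J, h, if_false, false_and, iff_false, not_forall, top_le_iff]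
    exact ⟨zeroTest T, EReal.coe_ne_top q⟩

end Rate

/-! ### Equicontinuity of the level sets -/

/-- A smooth ramp from `0` at `s` to `1` at `s + ε`. -/
def ramp (ε s r : ℝ) : ℝ := Real.smoothTransition ((r - s) / ε)

/-- The derivative of `ramp`. -/
def rampDeriv (ε s r : ℝ) : ℝ := deriv Real.smoothTransition ((r - s) / ε) / ε

lemma hasDerivAt_ramp (ε s r : ℝ) : HasDerivAt (ramp ε s) (rampDeriv ε s r) r := by
  have hasDerivAt_transition : HasDerivAt Real.smoothTransition
      (deriv Real.smoothTransition ((r - s) / ε)) ((r - s) / ε) :=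
    (Real.smoothTransition.contDiff.differentiable one_ne_zero _).hasDerivAt
  exact (hasDerivAt_transition.comp r
    (((hasDerivAt_id r).sub_const s).div_const ε)).congr_deriv (by rw [rampDeriv]; ring)

lemma continuous_rampDeriv (ε s : ℝ) : Continuous (rampDeriv ε s) := by
  have : Continuous (deriv Real.smoothTransition) :=
    Real.smoothTransition.contDiff.continuous_deriv le_rfl
  unfold rampDeriv
  fun_prop

lemma ramp_mem (ε s r : ℝ) : ramp ε s r ∈ Icc (0 : ℝ) 1 :=
  ⟨Real.smoothTransition.nonneg _, Real.smoothTransition.le_one _⟩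

section Ramp

variable {ε s r : ℝ} (hε : 0 < ε)
include hε

lemma ramp_eq_zero (h : r ≤ s) : ramp ε s r = 0 :=
  Real.smoothTransition.zero_of_nonpos (div_nonpos_of_nonpos_of_nonneg (sub_nonpos.2 h) hε.le)

lemma ramp_eq_one (h : s + ε ≤ r) : ramp ε s r = 1 :=
  Real.smoothTransition.one_of_one_le ((one_le_div hε).2 (by linarith))

lemma rampDeriv_nonneg : 0 ≤ rampDeriv ε s r :=
  div_nonneg Real.smoothTransition.monotone.deriv_nonneg hε.le

lemma rampDeriv_eq_zero_of_lt (h : r < s) : rampDeriv ε s r = 0 := by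
  have ramp_eventually : ramp ε s =ᶠ[𝓝 r] fun _ => 0 := by
    filter_upwards [Iio_mem_nhds h] with x hx using ramp_eq_zero hε hx.le
  exact (hasDerivAt_ramp ε s r).unique
    ((hasDerivAt_const r (0 : ℝ)).congr_of_eventuallyEq ramp_eventually)

lemma rampDeriv_eq_zero_of_gt (h : s + ε < r) : rampDeriv ε s r = 0 := by
  have ramp_eventually : ramp ε s =ᶠ[𝓝 r] fun _ => 1 := by
    filter_upwards [Ioi_mem_nhds h] with x hx using ramp_eq_one hε hx.le
  exact (hasDerivAt_ramp ε s r).unique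
    ((hasDerivAt_const r (1 : ℝ)).congr_of_eventuallyEq ramp_eventually)

end Ramp

lemma integral_rampDeriv (hT : 0 ≤ T) (ε s : ℝ) :
    ∫ t : Icc (0 : ℝ) T, rampDeriv ε s t ∂leb T = ramp ε s T - ramp ε s 0 := by
  rw [integral_leb hT (rampDeriv ε s)]
  exact intervalIntegral.integral_eq_sub_of_hasDerivAt (fun r _ => hasDerivAt_ramp ε s r)
    ((continuous_rampDeriv ε s).intervalIntegrable _ _)

lemma integrable_rampDeriv (ε s : ℝ) :
    Integrable (fun t : Icc (0 : ℝ) T => rampDeriv ε s t) (leb T) :=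
  integrable_leb ((continuous_rampDeriv ε s).comp continuous_subtype_val)

lemma abs_integral_rampDeriv_mul_le (hT : 0 ≤ T) {ε s η : ℝ} (hε : 0 < ε) (hη : 0 ≤ η)
    {f : Icc (0 : ℝ) T → ℝ} (hf : ∀ t : Icc (0 : ℝ) T, s ≤ t → (t : ℝ) ≤ s + ε → |f t| ≤ η) :
    |∫ t : Icc (0 : ℝ) T, rampDeriv ε s t * f t ∂leb T| ≤ η :=
  calc |∫ t : Icc (0 : ℝ) T, rampDeriv ε s t * f t ∂leb T|
      ≤ ∫ t : Icc (0 : ℝ) T, rampDeriv ε s t * η ∂leb T := by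
        rw [← Real.norm_eq_abs]
        refine norm_integral_le_of_norm_le ((integrable_rampDeriv ε s).mul_const η)
          (ae_of_all _ fun t => ?_)
        rw [norm_mul, Real.norm_of_nonneg (rampDeriv_nonneg hε)]
        rcases lt_or_ge (t : ℝ) s with hts | hts
        · simp [rampDeriv_eq_zero_of_lt hε hts]
        rcases lt_or_ge (s + ε) t with hst | hst
        · simp [rampDeriv_eq_zero_of_gt hε hst]
        exact mul_le_mul_of_nonneg_left (hf t hts hst) (rampDeriv_nonneg hε)
    _ = (ramp ε s T - ramp ε s 0) * η := by rw [integral_mul_const, integral_rampDeriv hT]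
    _ ≤ η := mul_le_of_le_one_left hη (by linarith [(ramp_mem ε s T).2, (ramp_mem ε s 0).1])

lemma tendsto_integral_rampDeriv_mul (hT : 0 ≤ T) {f : Icc (0 : ℝ) T → ℝ} {s : Icc (0 : ℝ) T}
    (hf : Tendsto f (𝓝[≥] s) (𝓝 0)) :
    Tendsto (fun ε => ∫ t : Icc (0 : ℝ) T, rampDeriv ε s t * f t ∂leb T) (𝓝[>] 0) (𝓝 0) := by
  rw [Metric.tendsto_nhds]
  intro η hη
  obtain ⟨δ, hδ, hδf⟩ := Metric.tendsto_nhdsWithin_nhds.1 hf (η / 2) (half_pos hη)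
  filter_upwards [Ioo_mem_nhdsGT hδ] with ε hε
  rw [Real.dist_0_eq_abs]
  refine (abs_integral_rampDeriv_mul_le hT hε.1 (half_pos hη).le
    fun t hst hts => ?_).trans_lt (half_lt_self hη)
  have dist_lt : dist t s < δ := by
    rw [Subtype.dist_eq, Real.dist_eq, abs_of_nonneg (sub_nonneg.2 hst)]
    linarith [hε.2]
  simpa using (hδf (x := t) (show s ≤ t from hst) dist_lt).le

lemma tendsto_ramp_increment (hT : 0 < T) (π : MPath T) (n : ℕ) (s : Icc (0 : ℝ) T) :
    Tendsto (fun ε : ℝ => ramp ε s T * (π (timeEnd hT)).coef n -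
      ramp ε s 0 * (π (timeZero hT)).coef n -
      ∫ t : Icc (0 : ℝ) T, rampDeriv ε s t * (π t).coef n ∂leb T) (𝓝[>] 0)
      (𝓝 ((π (timeEnd hT)).coef n - (π s).coef n)) := by
  set g : Icc (0 : ℝ) T → ℝ := fun t => (π t).coef n
  have increment_eq {ε : ℝ} (hε : 0 < ε) : ramp ε s T * (g (timeEnd hT) - g s) -
      ∫ t : Icc (0 : ℝ) T, rampDeriv ε s t * (g t - g s) ∂leb T =
      ramp ε s T * g (timeEnd hT) - ramp ε s 0 * g (timeZero hT) -
        ∫ t : Icc (0 : ℝ) T, rampDeriv ε s t * g t ∂leb T := by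
    have integrable_mul : Integrable (fun t : Icc (0 : ℝ) T => rampDeriv ε s t * g t) (leb T) :=
      π.integrable_mul_coef n ((continuous_rampDeriv ε s).comp continuous_subtype_val)
    simp_rw [mul_sub]
    rw [integral_sub integrable_mul ((integrable_rampDeriv ε s).mul_const _), integral_mul_const,
      integral_rampDeriv hT.le, ramp_eq_zero hε s.2.1]
    ring
  have tendsto_main : Tendsto (fun ε => ramp ε s T * (g (timeEnd hT) - g s)) (𝓝[>] 0)
      (𝓝 (g (timeEnd hT) - g s)) := by
    refine Tendsto.congr' ?_ tendsto_const_nhds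
    rcases s.2.2.eq_or_lt with hsT | hsT
    · simp [show timeEnd hT = s from Subtype.ext hsT.symm]
    · filter_upwards [Ioo_mem_nhdsGT (sub_pos.2 hsT)] with ε hε
      rw [ramp_eq_one hε.1 (by linarith [hε.2]), one_mul]
  have right_continuous : Tendsto (fun t => g t - g s) (𝓝[≥] s) (𝓝 0) :=
    tendsto_sub_nhds_zero_iff.2 ((SubMeasure.continuous_coef n).continuousAt
      |>.comp_continuousWithinAt (π.right_continuous s))
  refine Tendsto.congr' (by filter_upwards [self_mem_nhdsWithin] with ε hε using increment_eq hε) ?_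
  simpa using tendsto_main.sub (tendsto_integral_rampDeriv_mul hT.le right_continuous)

lemma leb_real_setOf_mem_Icc_le {a b : ℝ} (hab : a ≤ b) :
    (leb T).real {t | (t : ℝ) ∈ Icc a b} ≤ b - a := by
  refine ENNReal.toReal_le_of_le_ofReal (sub_nonneg.2 hab) ?_
  rw [leb, (MeasurableEmbedding.subtype_coe measurableSet_Icc).comap_apply, ← Real.volume_Icc]
  exact measure_mono (image_subset_iff.2 fun t ht => ht)

/-- The constant in the modulus of continuity of the `n`-th cosine coefficient along a path of
finite rate. -/
def modConst (A B : ℝ) (n : ℕ) (Λ : ℝ) : ℝ :=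
  (n * Real.pi) ^ 2 * (Λ + 1 / 8 * Λ ^ 2) + (1 / A + 1 / B) * Real.exp Λ

section LevelSet

variable {α A β B : ℝ} (hα : α ∈ Icc (0 : ℝ) 1) (hβ : β ∈ Icc (0 : ℝ) 1) (hA : 0 < A)
  (hB : 0 < B)
include hα hβ hA hB

lemma integral_bdry_le {H : C12 T} {π : MPath T} (hπ : ∀ t, (π t).IsAC) {m : ℝ}
    {E : Set (Icc (0 : ℝ) T)} (hE : MeasurableSet E) (hH : ∀ t x, |H.toFun t x| ≤ m)
    (hHE : ∀ t ∉ E, ∀ x, H.toFun t x = 0) :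
    ∫ t : Icc (0 : ℝ) T, (bdry α A (contValue (π t).density 0) (H.toFun t 0) +
      bdry β B (contValue (π t).density 1) (H.toFun t 1)) ∂leb T ≤
      (1 / A + 1 / B) * Real.exp m * (leb T).real E := by
  refine integral_le_mul_measureReal hE (by positivity) (fun t => ?_) fun t ht => ?_
  · rw [add_mul]
    exact add_le_add (bdry_le hα hA (contValue_mem (hπ t).density_mem 0) (hH t 0))
      (bdry_le hβ hB (contValue_mem (hπ t).density_mem 1) (hH t 1))
  · simp [hHE t ht, bdry_zero]

lemma coef_test_le {hT : 0 < T} {π : MPath T} {q : ℝ} (hq : rate α A β B hT π ≤ q) (n : ℕ)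
    {a a' : ℝ → ℝ} (ha : ∀ t, HasDerivAt a (a' t) t) (ha' : Continuous a') {Λ : ℝ}
    (haΛ : ∀ t, |a t| ≤ Λ) {E : Set (Icc (0 : ℝ) T)} (hE : MeasurableSet E)
    (haE : ∀ t : Icc (0 : ℝ) T, t ∉ E → a t = 0) :
    a T * (π (timeEnd hT)).coef n - a 0 * (π (timeZero hT)).coef n -
      ∫ t : Icc (0 : ℝ) T, a' t * (π t).coef n ∂leb T ≤ q + modConst A B n Λ * (leb T).real E := by
  obtain ⟨⟨hπ, -⟩, hJ⟩ := rate_le_coe_iff.1 hq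
  have hΛ : 0 ≤ Λ := (abs_nonneg _).trans (haΛ 0)
  have test_le := (le_JReal_cosTest α A β B hT hπ (s := {n}) (fun _ t _ => (ha t).hasDerivWithinAt)
    fun _ => ha'.continuousOn).trans (hJ _)
  simp only [Finset.sum_singleton] at test_le
  have bdry_term_le := integral_bdry_le hα hβ hA hB (H := cosTest {n} (fun _ => a)
    (fun _ => a') (fun _ t _ => (ha t).hasDerivWithinAt) fun _ => ha'.continuousOn) hπ hE
    (m := Λ) (fun t x => ?_) fun t ht x => by simp [cosTest, haE t ht]
  · have drift_term_le : -∫ t : Icc (0 : ℝ) T, (n * Real.pi) ^ 2 *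
        (a t * (π t).coef n - 1 / 8 * a t ^ 2) ∂leb T ≤
        (n * Real.pi) ^ 2 * (Λ + 1 / 8 * Λ ^ 2) * (leb T).real E := by
      rw [← integral_neg]
      refine integral_le_mul_measureReal hE (by positivity) (fun t => ?_) fun t ht => by
        simp [haE t ht]
      rw [← mul_neg, neg_sub', sub_neg_eq_add]
      have abs_mul_le : |a t * (π t).coef n| ≤ Λ := by
        rw [abs_mul]
        exact (mul_le_of_le_one_right (abs_nonneg _) ((π t).abs_coef_le n)).trans (haΛ t)
      have sq_le : a t ^ 2 ≤ Λ ^ 2 := sq_le_sq' (abs_le.1 (haΛ t)).1 (abs_le.1 (haΛ t)).2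
      gcongr
      exact (neg_le_abs _).trans abs_mul_le
    rw [modConst, add_mul]
    linarith
  · simp only [cosTest, Finset.sum_singleton, abs_mul]
    exact (mul_le_of_le_one_right (abs_nonneg _) (Real.abs_cos_le_one _)).trans (haΛ t)

-- The test function `l (ramp ε s - ramp ε t) cos (nπx)` approximates `l 1_{[s, t]} cos (nπx)`.
lemma mul_ramp_increment_sub_le {hT : 0 < T} {π : MPath T} {q : ℝ}
    (hq : rate α A β B hT π ≤ q) (n : ℕ) (l : ℝ) {s t : Icc (0 : ℝ) T} (hst : (s : ℝ) ≤ t) {ε : ℝ}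
    (hε : 0 < ε) :
    l * ((ramp ε s T * (π (timeEnd hT)).coef n - ramp ε s 0 * (π (timeZero hT)).coef n -
      ∫ r : Icc (0 : ℝ) T, rampDeriv ε s r * (π r).coef n ∂leb T) -
      (ramp ε t T * (π (timeEnd hT)).coef n - ramp ε t 0 * (π (timeZero hT)).coef n -
      ∫ r : Icc (0 : ℝ) T, rampDeriv ε t r * (π r).coef n ∂leb T)) ≤
    q + modConst A B n |l| * (t + ε - s) := by
  have modConst_nonneg : 0 ≤ modConst A B n |l| := by unfold modConst; positivity
  have integrable_mul (v : ℝ) :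
      Integrable (fun r : Icc (0 : ℝ) T => rampDeriv ε v r * (π r).coef n) (leb T) :=
    π.integrable_mul_coef n ((continuous_rampDeriv ε v).comp continuous_subtype_val)
  have test_le := coef_test_le hα hβ hA hB hq n
    (fun r => ((hasDerivAt_ramp ε s r).sub (hasDerivAt_ramp ε t r)).const_mul l)
    (continuous_const.mul ((continuous_rampDeriv ε s).sub (continuous_rampDeriv ε t)))
    (Λ := |l|) (E := {r | (r : ℝ) ∈ Icc (s : ℝ) (t + ε)}) (fun r => ?_)
    (measurable_subtype_coe measurableSet_Icc) fun r hr => ?_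
  · have integral_eq : ∫ r : Icc (0 : ℝ) T,
        l * (rampDeriv ε s r - rampDeriv ε t r) * (π r).coef n ∂leb T =
        l * ((∫ r : Icc (0 : ℝ) T, rampDeriv ε s r * (π r).coef n ∂leb T) -
          ∫ r : Icc (0 : ℝ) T, rampDeriv ε t r * (π r).coef n ∂leb T) := by
      rw [← integral_sub (integrable_mul s) (integrable_mul t), ← integral_const_mul]
      simp only [mul_assoc, sub_mul]
    have measure_le := mul_le_mul_of_nonneg_left
      (leb_real_setOf_mem_Icc_le (T := T) (show (s : ℝ) ≤ t + ε by linarith)) modConst_nonneg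
    rw [integral_eq] at test_le
    simp only [Pi.sub_apply] at test_le
    linarith
  · rw [Pi.sub_apply, abs_mul]
    refine mul_le_of_le_one_right (abs_nonneg l) (abs_le.2 ⟨?_, ?_⟩) <;>
      linarith [(ramp_mem ε s r).1, (ramp_mem ε s r).2, (ramp_mem ε t r).2, (ramp_mem ε t r).1]
  · rcases lt_or_ge (r : ℝ) s with hrs | hrs
    · simp [ramp_eq_zero hε hrs.le, ramp_eq_zero hε (hrs.le.trans hst)]
    · have hrt : t + ε < (r : ℝ) := lt_of_not_ge fun hrt => hr ⟨hrs, hrt⟩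
      simp [ramp_eq_one hε hrt.le, ramp_eq_one hε (show (s : ℝ) + ε ≤ r by linarith)]

lemma mul_coef_sub_le {hT : 0 < T} {π : MPath T} {q : ℝ} (hq : rate α A β B hT π ≤ q) (n : ℕ)
    (l : ℝ) {s t : Icc (0 : ℝ) T} (hst : s ≤ t) :
    l * ((π t).coef n - (π s).coef n) ≤ q + modConst A B n |l| * (t - s) := by
  have tendsto_bound : Tendsto (fun ε : ℝ => q + modConst A B n |l| * (t + ε - s)) (𝓝[>] 0)
      (𝓝 (q + modConst A B n |l| * (t + 0 - s))) :=
    (Continuous.tendsto (by fun_prop) 0).mono_left nhdsWithin_le_nhds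
  have limit_le := le_of_tendsto_of_tendsto
    (((tendsto_ramp_increment hT π n s).sub (tendsto_ramp_increment hT π n t)).const_mul l)
    tendsto_bound (by
      filter_upwards [self_mem_nhdsWithin] with ε hε using
        mul_ramp_increment_sub_le hα hβ hA hB hq n l hst hε)
  rwa [sub_sub_sub_cancel_left, add_zero] at limit_le

lemma exists_forall_abs_coef_sub_lt (hT : 0 < T) (q : ℝ) (n : ℕ) {η : ℝ} (hη : 0 < η) :
    ∃ δ > 0, ∀ π : MPath T, rate α A β B hT π ≤ q → ∀ s t : Icc (0 : ℝ) T, dist s t < δ →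
      |(π s).coef n - (π t).coef n| < η := by
  set Λ : ℝ := 2 * (|q| + 1) / η
  have hΛ : 0 < Λ := by positivity
  have Λ_mul : Λ * η = 2 * (|q| + 1) := div_mul_cancel₀ _ hη.ne'
  have modConst_pos : 0 < modConst A B n Λ := by unfold modConst; positivity
  refine ⟨1 / modConst A B n Λ, by positivity, fun π hq => ?_⟩
  have lt_of_le {s t : Icc (0 : ℝ) T} (hst : s ≤ t) (hd : (t : ℝ) - s < 1 / modConst A B n Λ) :
      |(π s).coef n - (π t).coef n| < η := by
    rw [lt_div_iff₀ modConst_pos] at hd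
    have up := mul_coef_sub_le hα hβ hA hB hq n Λ hst
    have down := mul_coef_sub_le hα hβ hA hB hq n (-Λ) hst
    rw [abs_neg] at down
    rw [abs_of_pos hΛ] at up down
    rw [abs_lt]
    constructor <;> refine lt_of_mul_lt_mul_left ?_ hΛ.le <;> linarith [le_abs_self q, abs_nonneg q]
  intro s t hd
  rw [Subtype.dist_eq, Real.dist_eq] at hd
  rcases le_total s t with hst | hst
  · exact lt_of_le hst ((neg_sub _ _).symm.trans_lt ((neg_le_abs _).trans_lt hd))
  · rw [abs_sub_comm]
    exact lt_of_le hst ((le_abs_self _).trans_lt hd)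

lemma continuous_coef_comp {hT : 0 < T} {π : MPath T} {q : ℝ} (hq : rate α A β B hT π ≤ q)
    (n : ℕ) : Continuous fun t => (π t).coef n := by
  refine Metric.continuous_iff.2 fun t η hη => ?_
  obtain ⟨δ, hδ, abs_sub_lt⟩ := exists_forall_abs_coef_sub_lt hα hβ hA hB hT q n hη
  exact ⟨δ, hδ, fun s hs => abs_sub_lt π hq s t hs⟩

end LevelSet

/-! ### The energy estimate -/

/-- The Steklov average `ε⁻¹ ∫_t^{t+ε} f`. -/
def steklov (ε : ℝ) (f : ℝ → ℝ) (t : ℝ) : ℝ :=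
  ((∫ r in (0)..(t + ε), f r) - ∫ r in (0)..t, f r) / ε

section Steklov

variable {ε : ℝ} {f : ℝ → ℝ}

lemma hasDerivAt_primitive (hf : Continuous f) (t : ℝ) :
    HasDerivAt (fun t => ∫ r in (0)..t, f r) (f t) t :=
  (hf.integral_hasStrictDerivAt 0 t).hasDerivAt

lemma hasDerivAt_steklov (ε : ℝ) (hf : Continuous f) (t : ℝ) :
    HasDerivAt (steklov ε f) ((f (t + ε) - f t) / ε) t :=
  (((hasDerivAt_primitive hf (t + ε)).comp_add_const t ε).sub
    (hasDerivAt_primitive hf t)).div_const ε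

lemma continuous_steklov (ε : ℝ) (hf : Continuous f) : Continuous (steklov ε f) :=
  continuous_iff_continuousAt.2 fun t => (hasDerivAt_steklov ε hf t).continuousAt

lemma exists_steklov_eq (hε : 0 < ε) (hf : Continuous f) (t : ℝ) :
    ∃ r ∈ Ioo t (t + ε), steklov ε f t = f r := by
  obtain ⟨r, hr, slope_eq⟩ := exists_hasDerivAt_eq_slope (fun t => ∫ r in (0)..t, f r) f
    (lt_add_of_pos_right t hε)
    (fun x _ => (hasDerivAt_primitive hf x).continuousAt.continuousWithinAt)
    fun x _ => hasDerivAt_primitive hf x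
  exact ⟨r, hr, by rw [slope_eq, steklov, add_sub_cancel_left]⟩

lemma sum_steklov_mul (ε : ℝ) (s : Finset ℕ) {f : ℕ → ℝ → ℝ} (hf : ∀ n, Continuous (f n))
    (b : ℕ → ℝ) (t : ℝ) :
    ∑ n ∈ s, b n * steklov ε (f n) t = steklov ε (fun r => ∑ n ∈ s, b n * f n r) t := by
  have integrable (u : ℝ) (n : ℕ) (_ : n ∈ s) :
      IntervalIntegrable (fun r => b n * f n r) volume 0 u :=
    (continuous_const.mul (hf n)).intervalIntegrable _ _
  unfold steklov
  rw [intervalIntegral.integral_finsetSum (integrable _),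
    intervalIntegral.integral_finsetSum (integrable _), ← Finset.sum_sub_distrib, Finset.sum_div]
  simp_rw [intervalIntegral.integral_const_mul, ← mul_sub, mul_div_assoc]

lemma tendsto_steklov (hf : Continuous f) (t : ℝ) :
    Tendsto (fun ε => steklov ε f t) (𝓝[>] 0) (𝓝 (f t)) := by
  refine Metric.tendsto_nhds.2 fun η hη => ?_
  obtain ⟨δ, hδ, dist_lt⟩ := Metric.continuous_iff.1 hf t η hη
  filter_upwards [Ioo_mem_nhdsGT hδ] with ε hε
  obtain ⟨r, hr, average_eq⟩ := exists_steklov_eq hε.1 hf t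
  rw [average_eq]
  refine dist_lt r ?_
  rw [Real.dist_eq, abs_of_pos (sub_pos.2 hr.1)]
  linarith [hr.2, hε.2]

lemma integral_shift_sq_sub_sq_le (hf : Continuous f) (hfT : ∀ t, T ≤ t → f t = f T)
    (hε : 0 < ε) : ∫ t in (0)..T, (f (t + ε) ^ 2 - f t ^ 2) ≤ ε * f T ^ 2 := by
  have integrable_sq (a b : ℝ) : IntervalIntegrable (fun t => f t ^ 2) volume a b :=
    (hf.pow 2).intervalIntegrable _ _
  have integral_tail : ∫ t in T..(T + ε), f t ^ 2 = ε * f T ^ 2 := by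
    rw [intervalIntegral.integral_congr (g := fun _ => f T ^ 2) fun t ht => ?_]
    · simp
    · rw [uIcc_of_le (by linarith)] at ht
      simp only [hfT t ht.1]
  have integral_head_nonneg : 0 ≤ ∫ t in (0)..ε, f t ^ 2 :=
    intervalIntegral.integral_nonneg hε.le fun t _ => sq_nonneg _
  rw [intervalIntegral.integral_sub (Continuous.intervalIntegrable (by fun_prop) _ _)
      (integrable_sq _ _),
    intervalIntegral.integral_comp_add_right (fun t => f t ^ 2) ε, zero_add]
  linarith [intervalIntegral.integral_add_adjacent_intervals (integrable_sq ε T)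
      (integrable_sq T (T + ε)),
    intervalIntegral.integral_add_adjacent_intervals (integrable_sq 0 ε) (integrable_sq ε T)]

lemma integral_increment_mul_le (hT : 0 ≤ T) (hf : Continuous f) (hfT : ∀ t, T ≤ t → f t = f T)
    (hε : 0 < ε) : ∫ t in (0)..T, (f (t + ε) - f t) / ε * f t ≤ 1 / 2 * f T ^ 2 :=
  calc ∫ t in (0)..T, (f (t + ε) - f t) / ε * f t
      ≤ ∫ t in (0)..T, 1 / (2 * ε) * (f (t + ε) ^ 2 - f t ^ 2) := by
        refine intervalIntegral.integral_mono_on hT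
          (Continuous.intervalIntegrable (by fun_prop) _ _)
          (Continuous.intervalIntegrable (by fun_prop) _ _) fun t _ => sub_nonneg.1 ?_
        have sub_eq : 1 / (2 * ε) * (f (t + ε) ^ 2 - f t ^ 2) - (f (t + ε) - f t) / ε * f t =
            1 / (2 * ε) * (f (t + ε) - f t) ^ 2 := by field_simp; ring
        rw [sub_eq]
        positivity
    _ ≤ 1 / (2 * ε) * (ε * f T ^ 2) := by
        rw [intervalIntegral.integral_const_mul]
        gcongr
        exact integral_shift_sq_sub_sq_le hf hfT hε
    _ = 1 / 2 * f T ^ 2 := by field_simp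

end Steklov

namespace MPath

/-- The `n`-th cosine coefficient of a path, extended by its values at `0` and `T`. -/
def coefExt (hT : 0 < T) (π : MPath T) (n : ℕ) : ℝ → ℝ := IccExtend hT.le fun t => (π t).coef n

/-- The `n`-th cosine coefficient of the test function of the energy estimate: the Fejér sum of
the path, averaged over a time `ε`. -/
def fejerAverage (hT : 0 < T) (π : MPath T) (N : ℕ) (ε : ℝ) (n : ℕ) (t : ℝ) : ℝ :=
  fejerCoef N n * steklov ε (π.coefExt hT n) t

variable {hT : 0 < T} {π : MPath T}

lemma coefExt_coe (n : ℕ) (t : Icc (0 : ℝ) T) : π.coefExt hT n t = (π t).coef n :=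
  IccExtend_val ..

lemma coefExt_eq_of_le (n : ℕ) {t : ℝ} (ht : T ≤ t) : π.coefExt hT n t = π.coefExt hT n T := by
  simp only [coefExt, IccExtend_of_right_le hT.le _ ht, IccExtend_of_right_le hT.le _ le_rfl]

lemma abs_coefExt_le (n : ℕ) (t : ℝ) : |π.coefExt hT n t| ≤ 1 := (π _).abs_coef_le n

section FejerAverage

variable {N : ℕ} {ε : ℝ} (hc : ∀ n, Continuous fun t => (π t).coef n)
include hc

lemma continuous_coefExt (n : ℕ) : Continuous (π.coefExt hT n) := (hc n).Icc_extend'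

lemma hasDerivAt_fejerAverage (n : ℕ) (t : ℝ) : HasDerivAt (π.fejerAverage hT N ε n)
    (fejerCoef N n * ((π.coefExt hT n (t + ε) - π.coefExt hT n t) / ε)) t :=
  (hasDerivAt_steklov ε (continuous_coefExt hc n) t).const_mul _

variable (hπ : ∀ t, (π t).IsAC) (hN : N ≠ 0) (hε : 0 < ε)
include hε

lemma abs_fejerAverage_le (n : ℕ) (t : ℝ) : |π.fejerAverage hT N ε n t| ≤ |fejerCoef N n| := by
  obtain ⟨r, -, average_eq⟩ := exists_steklov_eq hε (continuous_coefExt (hT := hT) hc n) t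
  rw [fejerAverage, average_eq, abs_mul]
  exact mul_le_of_le_one_right (abs_nonneg _) (abs_coefExt_le n r)

lemma sum_fejerAverage_end_mul_coef_nonneg :
    0 ≤ ∑ n ∈ Finset.range N, π.fejerAverage hT N ε n T * (π (timeEnd hT)).coef n := by
  refine Finset.sum_nonneg fun n hn => ?_
  obtain ⟨r, hr, average_eq⟩ := exists_steklov_eq hε (continuous_coefExt (hT := hT) hc n) T
  rw [fejerAverage, average_eq, coefExt_eq_of_le n hr.1.le,
    ← coefExt_coe (hT := hT) n (timeEnd hT), mul_assoc]
  exact mul_nonneg (fejerCoef_nonneg (Finset.mem_range.1 hn)) (mul_self_nonneg _)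

include hπ hN

lemma sum_fejerAverage_mul_cos_mem (t x : ℝ) :
    ∑ n ∈ Finset.range N, π.fejerAverage hT N ε n t * Real.cos (n * Real.pi * x) ∈
      Icc (0 : ℝ) 1 := by
  have continuous_fejerSum : Continuous fun r => fejerSum N (π.coefExt hT · r) x :=
    continuous_finsetSum _ fun n _ =>
      (continuous_const.mul (continuous_coefExt hc n)).mul continuous_const
  obtain ⟨r, -, average_eq⟩ := exists_steklov_eq hε continuous_fejerSum t
  have sum_eq := sum_steklov_mul ε (Finset.range N) (continuous_coefExt (hT := hT) hc)
    (fun n => fejerCoef N n * Real.cos (n * Real.pi * x)) t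
  simp only [mul_right_comm _ (Real.cos _)] at sum_eq
  exact (sum_eq.trans average_eq).symm ▸ (hπ (projIcc 0 T hT.le r)).fejerSum_mem hN x

lemma sum_fejerAverage_zero_mul_coef_le :
    ∑ n ∈ Finset.range N, π.fejerAverage hT N ε n 0 * (π (timeZero hT)).coef n ≤ 1 := by
  rw [← SubMeasure.pairing_sum_smul_cosMap]
  refine (le_abs_self _).trans ((SubMeasure.abs_pairing_le _ _).trans
    ((ContinuousMap.norm_le _ zero_le_one).2 fun x => ?_))
  have test_mem := sum_fejerAverage_mul_cos_mem (hT := hT) hc hπ hN hε 0 x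
  simpa [abs_of_nonneg test_mem.1] using test_mem.2

lemma integral_fejerAverage_deriv_mul_coef_le :
    ∫ t : Icc (0 : ℝ) T, ∑ n ∈ Finset.range N,
      fejerCoef N n * ((π.coefExt hT n (t + ε) - π.coefExt hT n t) / ε) * (π t).coef n ∂leb T ≤
      1 / 2 := by
  have continuous_c := continuous_coefExt (hT := hT) hc
  simp_rw [← coefExt_coe (hT := hT), mul_assoc]
  rw [integral_leb hT.le fun t => ∑ n ∈ Finset.range N,
      fejerCoef N n * ((π.coefExt hT n (t + ε) - π.coefExt hT n t) / ε * π.coefExt hT n t),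
    intervalIntegral.integral_finsetSum fun n _ => Continuous.intervalIntegrable
      (by have := continuous_c n; fun_prop) _ _]
  calc _ ≤ ∑ n ∈ Finset.range N, fejerCoef N n * (1 / 2 * (π (timeEnd hT)).coef n ^ 2) := by
        refine Finset.sum_le_sum fun n hn => ?_
        rw [intervalIntegral.integral_const_mul, ← coefExt_coe (hT := hT) n (timeEnd hT)]
        exact mul_le_mul_of_nonneg_left (integral_increment_mul_le hT.le (continuous_c n)
          (fun t ht => coefExt_eq_of_le n ht) hε) (fejerCoef_nonneg (Finset.mem_range.1 hn))
    _ = 1 / 2 * ∑ n ∈ Finset.range N, fejerCoef N n * (π (timeEnd hT)).coef n ^ 2 := by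
        rw [Finset.mul_sum]
        exact Finset.sum_congr rfl fun n _ => by ring
    _ ≤ 1 / 2 := by linarith [(hπ (timeEnd hT)).sum_fejerCoef_mul_sq_le hN]

omit hπ hN hε in
lemma tendsto_integral_fejerAverage :
    Tendsto (fun ε => ∫ t : Icc (0 : ℝ) T, ∑ n ∈ Finset.range N, (n * Real.pi) ^ 2 *
        (π.fejerAverage hT N ε n t * (π t).coef n - 1 / 8 * π.fejerAverage hT N ε n t ^ 2) ∂leb T)
      (𝓝[>] 0)
      (𝓝 (∫ t, ∑ n ∈ Finset.range N, (n * Real.pi) ^ 2 * (fejerCoef N n * (π t).coef n *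
        (π t).coef n - 1 / 8 * (fejerCoef N n * (π t).coef n) ^ 2) ∂leb T)) := by
  have continuous_c := continuous_coefExt (hT := hT) hc
  have continuous_average (ε : ℝ) (n : ℕ) :
      Continuous fun t : Icc (0 : ℝ) T => π.fejerAverage hT N ε n t :=
    continuous_const.mul ((continuous_steklov ε (continuous_c n)).comp continuous_subtype_val)
  refine tendsto_integral_filter_of_dominated_convergence
    (fun _ => ∑ n ∈ Finset.range N, (n * Real.pi) ^ 2 *
      (|fejerCoef N n| * 1 + 1 / 8 * |fejerCoef N n| ^ 2))
    (Eventually.of_forall fun ε => ?_) ?_ (integrable_const _) (ae_of_all _ fun t => ?_)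
  · have := continuous_average ε
    exact Continuous.aestronglyMeasurable (by fun_prop)
  · filter_upwards [self_mem_nhdsWithin] with ε hε
    refine ae_of_all _ fun t => (norm_sum_le _ _).trans (Finset.sum_le_sum fun n _ => ?_)
    rw [norm_mul, Real.norm_of_nonneg (sq_nonneg _)]
    refine mul_le_mul_of_nonneg_left ((norm_sub_le _ _).trans ?_) (sq_nonneg _)
    rw [Real.norm_eq_abs, Real.norm_eq_abs, abs_mul, abs_mul, abs_pow,
      abs_of_nonneg (show (0 : ℝ) ≤ 1 / 8 by norm_num)]
    have abs_average_le := abs_fejerAverage_le (hT := hT) (N := N) hc hε n t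
    have abs_coef_le := (π t).abs_coef_le n
    gcongr
  · refine tendsto_finsetSum _ fun n _ => Tendsto.const_mul _ ?_
    have average_tendsto : Tendsto (fun ε => π.fejerAverage hT N ε n t) (𝓝[>] 0)
        (𝓝 (fejerCoef N n * (π t).coef n)) := by
      rw [← coefExt_coe (hT := hT) n t]
      exact (tendsto_steklov (continuous_c n) t).const_mul _
    exact (average_tendsto.mul_const _).sub ((average_tendsto.pow 2).const_mul _)

end FejerAverage

end MPath

lemma le_fejerCoef_mul_sub (N n : ℕ) (hn : n < N) (c : ℝ) :
    (n * Real.pi) ^ 2 * (3 / 4 * fejerCoef N n * c ^ 2) ≤ (n * Real.pi) ^ 2 *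
      (fejerCoef N n * c * c - 1 / 8 * (fejerCoef N n * c) ^ 2) := by
  refine mul_le_mul_of_nonneg_left (sub_nonneg.1 ?_) (sq_nonneg _)
  have sub_eq : fejerCoef N n * c * c - 1 / 8 * (fejerCoef N n * c) ^ 2 -
      3 / 4 * fejerCoef N n * c ^ 2 = 1 / 8 * (fejerCoef N n * (2 - fejerCoef N n) * c ^ 2) := by
    ring
  have fejerCoef_mul_nonneg : 0 ≤ fejerCoef N n * (2 - fejerCoef N n) :=
    mul_nonneg (fejerCoef_nonneg hn) (sub_nonneg.2 (fejerCoef_le N n))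
  rw [sub_eq]
  positivity

lemma one_le_fejerCoef_two_mul {M n : ℕ} (hn0 : n ≠ 0) (hn : n < M) :
    1 ≤ fejerCoef (2 * M) n := by
  have div_le : (n : ℝ) / (2 * M : ℕ) ≤ 1 / 2 := by
    have hM : 0 < 2 * M := by omega
    rw [div_le_div_iff₀ (by exact_mod_cast hM) two_pos]
    exact_mod_cast show n * 2 ≤ 1 * (2 * M) by omega
  rw [fejerCoef, cosWeight_of_ne hn0]
  linarith

lemma sum_sq_coef_le (M : ℕ) (c : ℕ → ℝ) :
    3 / 4 * ∑ n ∈ Finset.range M, (n * Real.pi * c n) ^ 2 ≤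
      ∑ n ∈ Finset.range (2 * (M + 1)), (n * Real.pi) ^ 2 *
        (fejerCoef (2 * (M + 1)) n * c n * c n -
          1 / 8 * (fejerCoef (2 * (M + 1)) n * c n) ^ 2) := by
  set f := fejerCoef (2 * (M + 1))
  calc 3 / 4 * ∑ n ∈ Finset.range M, (n * Real.pi * c n) ^ 2
      ≤ ∑ n ∈ Finset.range M, (n * Real.pi) ^ 2 * (3 / 4 * f n * c n ^ 2) := by
        rw [Finset.mul_sum]
        refine Finset.sum_le_sum fun n hn => ?_
        rcases eq_or_ne n 0 with rfl | hn0
        · simp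
        · have one_le : 1 ≤ f n := one_le_fejerCoef_two_mul hn0
            ((Finset.mem_range.1 hn).trans M.lt_succ_self)
          linarith [mul_le_mul_of_nonneg_right one_le (sq_nonneg (n * Real.pi * c n))]
    _ ≤ ∑ n ∈ Finset.range (2 * (M + 1)), (n * Real.pi) ^ 2 * (3 / 4 * f n * c n ^ 2) :=
        Finset.sum_le_sum_of_subset_of_nonneg (Finset.range_subset_range.2 (by omega))
          fun n hn _ => by
            have := fejerCoef_nonneg (Finset.mem_range.1 hn)
            positivity
    _ ≤ _ := Finset.sum_le_sum fun n hn => le_fejerCoef_mul_sub _ n (Finset.mem_range.1 hn) _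

/-- The bound on the energy at level `q` of the rate functional. -/
def energyConst (A B T q : ℝ) : ℝ := 4 / 3 * (q + 3 / 2 + (1 / A + 1 / B) * Real.exp 1 * T)

/-- The bound `∫₀ᵀ ∫₀¹ (∂ₓu)² dx dt ≤ 2C`, in terms of cosine coefficients. -/
def FourierEnergyLe (π : MPath T) (C : ℝ) : Prop :=
  ∀ M, ∫ t, ∑ n ∈ Finset.range M, (n * Real.pi * (π t).coef n) ^ 2 ∂leb T ≤ C

section FourierEnergy

variable {α A β B : ℝ} (hα : α ∈ Icc (0 : ℝ) 1) (hβ : β ∈ Icc (0 : ℝ) 1) (hA : 0 < A)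
  (hB : 0 < B) {hT : 0 < T} {π : MPath T} {q : ℝ}
include hα hβ hA hB

-- Fejér sums of the path take values in `[0, 1]`, which keeps the boundary terms bounded.
lemma integral_fejerAverage_le (hq : rate α A β B hT π ≤ q) {N : ℕ} (hN : N ≠ 0) {ε : ℝ}
    (hε : 0 < ε) :
    ∫ t : Icc (0 : ℝ) T, ∑ n ∈ Finset.range N, (n * Real.pi) ^ 2 * (π.fejerAverage hT N ε n t *
      (π t).coef n - 1 / 8 * π.fejerAverage hT N ε n t ^ 2) ∂leb T ≤
      q + 3 / 2 + (1 / A + 1 / B) * Real.exp 1 * T := by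
  obtain ⟨⟨hπ, -⟩, hJ⟩ := rate_le_coe_iff.1 hq
  have hc := continuous_coef_comp hα hβ hA hB hq
  have hderiv (n : ℕ) (t : ℝ) := (π.hasDerivAt_fejerAverage (hT := hT) (N := N) (ε := ε) hc n t)
  have continuous_deriv (n : ℕ) : Continuous fun t =>
      fejerCoef N n * ((π.coefExt hT n (t + ε) - π.coefExt hT n t) / ε) := by
    have := MPath.continuous_coefExt (hT := hT) hc n
    fun_prop
  have test_le := (le_JReal_cosTest α A β B hT hπ (s := Finset.range N)
    (fun n t _ => (hderiv n t).hasDerivWithinAt) fun n => (continuous_deriv n).continuousOn).trans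
    (hJ _)
  have bdry_term_le := integral_bdry_le hα hβ hA hB (H := cosTest (Finset.range N) _ _
      (fun n t _ => (hderiv n t).hasDerivWithinAt) fun n => (continuous_deriv n).continuousOn)
    hπ MeasurableSet.univ (m := 1)
    (fun t x => by
      have test_mem := MPath.sum_fejerAverage_mul_cos_mem (hT := hT) hc hπ hN hε t x
      exact abs_le.2 ⟨neg_one_lt_zero.le.trans test_mem.1, test_mem.2⟩)
    fun t ht => absurd (mem_univ t) ht
  rw [leb_real_univ hT.le] at bdry_term_le
  linarith [MPath.sum_fejerAverage_end_mul_coef_nonneg (hT := hT) (N := N) hc hε,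
    MPath.sum_fejerAverage_zero_mul_coef_le (hT := hT) hc hπ hN hε,
    MPath.integral_fejerAverage_deriv_mul_coef_le (hT := hT) hc hπ hN hε]

lemma fourierEnergyLe_of_rate_le (hq : rate α A β B hT π ≤ q) :
    FourierEnergyLe π (energyConst A B T q) := by
  intro M
  have hc := continuous_coef_comp hα hβ hA hB hq
  have limit_le := le_of_tendsto
    (MPath.tendsto_integral_fejerAverage (hT := hT) (N := 2 * (M + 1)) hc)
    (by filter_upwards [self_mem_nhdsWithin] with ε hε using
      integral_fejerAverage_le hα hβ hA hB hq (by omega) hε)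
  have integral_le := (integral_mono (integrable_leb (by fun_prop)) (integrable_leb (by fun_prop))
    fun t => sum_sq_coef_le M fun n => (π t).coef n).trans limit_le
  rw [integral_const_mul] at integral_le
  unfold energyConst
  linarith

end FourierEnergy

section EnergyDensity

variable {π : MPath T} {C : ℝ}

lemma integrable_sq_coef (π : MPath T) (n : ℕ) :
    Integrable (fun t => (n * Real.pi * (π t).coef n) ^ 2) (leb T) := by
  refine Integrable.of_bound (((π.measurable_comp (SubMeasure.continuous_coef n)).const_mul
    _).pow_const 2).aestronglyMeasurable ((n * Real.pi) ^ 2) (ae_of_all _ fun t => ?_)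
  rw [Real.norm_of_nonneg (sq_nonneg _), mul_pow]
  exact mul_le_of_le_one_right (sq_nonneg _) ((sq_le_one_iff_abs_le_one _).2 ((π t).abs_coef_le n))

lemma lintegral_tsum_sq_coef_le (h : FourierEnergyLe π C) :
    ∫⁻ t, ∑' n : ℕ, ENNReal.ofReal ((n * Real.pi * (π t).coef n) ^ 2) ∂leb T ≤
      ENNReal.ofReal C := by
  have measurable_term (n : ℕ) : Measurable fun t => ENNReal.ofReal ((n * Real.pi *
      (π t).coef n) ^ 2) :=
    (((π.measurable_comp (SubMeasure.continuous_coef n)).const_mul _).pow_const 2).ennreal_ofReal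
  rw [lintegral_tsum fun n => (measurable_term n).aemeasurable]
  refine ENNReal.tsum_le_of_sum_range_le fun M => ?_
  rw [← lintegral_finsetSum _ fun n _ => measurable_term n]
  simp_rw [← ENNReal.ofReal_sum_of_nonneg fun _ _ => sq_nonneg _]
  rw [← ofReal_integral_eq_lintegral_ofReal
    (integrable_finsetSum _ fun n _ => integrable_sq_coef π n)
    (ae_of_all _ fun t => Finset.sum_nonneg fun n _ => sq_nonneg _)]
  exact ENNReal.ofReal_le_ofReal (h M)

lemma FourierEnergyLe.exists_hasSum (h : FourierEnergyLe π C) :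
    ∃ e : Icc (0 : ℝ) T → ℝ, Integrable e (leb T) ∧ (∀ t, 0 ≤ e t) ∧ ∫ t, e t ∂leb T ≤ C ∧
      ∀ᵐ t ∂leb T, HasSum (fun n : ℕ => (n * Real.pi * (π t).coef n) ^ 2) (e t) := by
  have hC : 0 ≤ C := by simpa using h 0
  set E : Icc (0 : ℝ) T → ℝ≥0∞ :=
    fun t => ∑' n : ℕ, ENNReal.ofReal ((n * Real.pi * (π t).coef n) ^ 2)
  have measurable_E : Measurable E := Measurable.tsum fun n =>
    (((π.measurable_comp (SubMeasure.continuous_coef n)).const_mul _).pow_const 2).ennreal_ofReal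
  have lintegral_E_le : ∫⁻ t, E t ∂leb T ≤ ENNReal.ofReal C := lintegral_tsum_sq_coef_le h
  have lintegral_E_ne_top : ∫⁻ t, E t ∂leb T ≠ ⊤ :=
    (lintegral_E_le.trans_lt ENNReal.ofReal_lt_top).ne
  have ae_E_lt_top := ae_lt_top measurable_E lintegral_E_ne_top
  refine ⟨fun t => (E t).toReal,
    integrable_toReal_of_lintegral_ne_top measurable_E.aemeasurable lintegral_E_ne_top,
    fun t => ENNReal.toReal_nonneg, ?_, ?_⟩
  · rw [integral_toReal measurable_E.aemeasurable ae_E_lt_top]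
    exact ENNReal.toReal_le_of_le_ofReal hC lintegral_E_le
  · filter_upwards [ae_E_lt_top] with t ht
    have term_hasSum := ENNReal.hasSum_toReal ht.ne
    rw [← ENNReal.tsum_toReal_eq fun _ => ENNReal.ofReal_ne_top] at term_hasSum
    simpa only [ENNReal.toReal_ofReal (sq_nonneg _)] using term_hasSum

end EnergyDensity

/-! ### Finite energy from the Fourier series -/

lemma ae_mem_Ioo : ∀ᵐ x : unitInterval, (x : ℝ) ∈ Ioo (0 : ℝ) 1 := by
  have ae_ne (y : unitInterval) : ∀ᵐ x : unitInterval, x ≠ y :=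
    measure_eq_zero_iff_ae_notMem.1 (measure_singleton y)
  filter_upwards [ae_ne 0, ae_ne 1] with x h0 h1
  exact ⟨unitInterval.pos_iff_ne_zero.2 h0, unitInterval.lt_one_iff_ne_one.2 h1⟩

namespace EnergyTest

/-- The extension by zero of an energy test function to all `x`, which makes it smooth in space on
the whole line. -/
def ext (G : EnergyTest T) (t x : ℝ) : ℝ := (Ioo (0 : ℝ) 1).indicator (G.toFun t) x

lemma ext_of_mem (G : EnergyTest T) (t : ℝ) {x : ℝ} (hx : x ∈ Ioo (0 : ℝ) 1) :
    G.ext t x = G.toFun t x := indicator_of_mem hx _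

lemma ext_of_notMem (G : EnergyTest T) (t : ℝ) {x : ℝ} (hx : x ∉ Ioo (0 : ℝ) 1) :
    G.ext t x = 0 := indicator_of_notMem hx _

lemma contDiffOn_ext (G : EnergyTest T) :
    ContDiffOn ℝ ∞ (fun p : ℝ × ℝ => G.ext p.1 p.2) (Icc 0 T ×ˢ univ) := by
  obtain ⟨K, hK, hKs, hGK⟩ := G.compact_support
  rintro ⟨t, x⟩ ⟨ht, -⟩
  by_cases hx : x ∈ Ioo (0 : ℝ) 1
  · have near : univ ×ˢ Ioo (0 : ℝ) 1 ∈ 𝓝 (t, x) := prod_mem_nhds univ_mem (isOpen_Ioo.mem_nhds hx)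
    refine ((G.smooth (t, x) ⟨ht, hx⟩).congr (fun p hp => G.ext_of_mem p.1 hp.2)
      (G.ext_of_mem t hx)).mono_of_mem_nhdsWithin ?_
    filter_upwards [self_mem_nhdsWithin, mem_nhdsWithin_of_mem_nhds near] with p hp hp'
      using ⟨hp.1, hp'.2⟩
  · have near : Kᶜ ∈ 𝓝 (t, x) := hK.isClosed.isOpen_compl.mem_nhds fun h => hx (hKs h).2
    refine (contDiffWithinAt_const (c := (0 : ℝ))).congr_of_eventuallyEq ?_ (G.ext_of_notMem t hx)
    filter_upwards [self_mem_nhdsWithin, mem_nhdsWithin_of_mem_nhds near] with p hp hpK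
    by_cases hpx : p.2 ∈ Ioo (0 : ℝ) 1
    · rw [G.ext_of_mem _ hpx, hGK p ⟨hp.1, hpx⟩ hpK]
    · exact G.ext_of_notMem _ hpx

lemma contDiff_ext (G : EnergyTest T) {t : ℝ} (ht : t ∈ Icc 0 T) : ContDiff ℝ ∞ (G.ext t) :=
  contDiffOn_univ.1 <| G.contDiffOn_ext.comp (f := fun x : ℝ => (t, x))
    (contDiff_prodMk_right t).contDiffOn fun _ _ => ⟨ht, mem_univ _⟩

lemma continuous_ext (G : EnergyTest T) :
    Continuous fun z : Icc (0 : ℝ) T × unitInterval => G.ext z.1 z.2 :=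
  G.contDiffOn_ext.continuousOn.comp_continuous
    (f := fun z : Icc (0 : ℝ) T × unitInterval => ((z.1 : ℝ), (z.2 : ℝ))) (by fun_prop)
    fun z => ⟨z.1.2, mem_univ _⟩

lemma continuous_integral_ext_sq (G : EnergyTest T) :
    Continuous fun t : Icc (0 : ℝ) T => ∫ x : unitInterval, G.ext t x ^ 2 := by
  have continuous_sq : Continuous (Function.uncurry fun (t : Icc (0 : ℝ) T) (x : unitInterval) =>
      G.ext t x ^ 2) := G.continuous_ext.pow 2
  simpa only [setIntegral_univ] using continuous_parametric_integral_of_continuous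
    (μ := (volume : Measure unitInterval)) continuous_sq isCompact_univ

lemma deriv_ext_of_mem (G : EnergyTest T) (t : ℝ) {x : ℝ} (hx : x ∈ Ioo (0 : ℝ) 1) :
    deriv (G.ext t) x = deriv (G.toFun t) x := by
  refine Filter.EventuallyEq.deriv_eq ?_
  filter_upwards [isOpen_Ioo.mem_nhds hx] with y hy using G.ext_of_mem t hy

lemma continuous_deriv_ext (G : EnergyTest T) {t : ℝ} (ht : t ∈ Icc 0 T) :
    Continuous (deriv (G.ext t)) :=
  (G.contDiff_ext ht).continuous_deriv (by exact_mod_cast le_top)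

lemma integral_deriv_ext_mul_cosMap (G : EnergyTest T) {t : ℝ} (ht : t ∈ Icc 0 T) (n : ℕ) :
    ∫ x : unitInterval, deriv (G.ext t) x * cosMap n x =
      n * Real.pi * ∫ x : unitInterval, G.ext t x * sinMap n x := by
  have hasDerivAt_cos (x : ℝ) : HasDerivAt (fun y => Real.cos (n * Real.pi * y))
      (-(n * Real.pi * Real.sin (n * Real.pi * x))) x := by
    simpa [mul_comm] using ((hasDerivAt_id x).const_mul (n * Real.pi)).cos
  have hasDerivAt_ext (x : ℝ) : HasDerivAt (G.ext t) (deriv (G.ext t) x) x :=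
    ((G.contDiff_ext ht).differentiable (by simp) x).hasDerivAt
  have by_parts := intervalIntegral.integral_mul_deriv_eq_deriv_mul (a := 0) (b := 1)
    (fun x _ => hasDerivAt_cos x) (fun x _ => hasDerivAt_ext x)
    (Continuous.intervalIntegrable (by fun_prop) _ _)
    ((G.continuous_deriv_ext ht).intervalIntegrable _ _)
  rw [G.ext_of_notMem t (x := 0) (by simp), G.ext_of_notMem t (x := 1) (by simp)] at by_parts
  calc ∫ x : unitInterval, deriv (G.ext t) x * cosMap n x
      = ∫ x in (0)..1, Real.cos (n * Real.pi * x) * deriv (G.ext t) x := by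
        simp_rw [cosMap_apply, mul_comm (deriv (G.ext t) _)]
        exact integral_unitInterval fun x => Real.cos (n * Real.pi * x) * deriv (G.ext t) x
    _ = ∫ x in (0)..1, n * Real.pi * (G.ext t x * Real.sin (n * Real.pi * x)) := by
        rw [by_parts, mul_zero, mul_zero, sub_zero, zero_sub, ← intervalIntegral.integral_neg]
        exact intervalIntegral.integral_congr fun x _ => by ring
    _ = n * Real.pi * ∫ x : unitInterval, G.ext t x * sinMap n x := by
        simp_rw [sinMap_apply]
        rw [intervalIntegral.integral_const_mul,
          integral_unitInterval fun x => G.ext t x * Real.sin (n * Real.pi * x)]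

end EnergyTest

lemma SubMeasure.IsAC.memLp_density {p : SubMeasure} (hp : p.IsAC) : MemLp p.density 2 := by
  refine MemLp.of_bound p.measurable_density.aestronglyMeasurable 1 ?_
  filter_upwards [hp.density_mem] with x hx
  rw [Real.norm_of_nonneg hx.1]
  exact hx.2

lemma integral_density_mul_deriv_le {p : SubMeasure} (hp : p.IsAC) {e : ℝ}
    (he : HasSum (fun n : ℕ => (n * Real.pi * p.coef n) ^ 2) e) (G : EnergyTest T) {t : ℝ}
    (ht : t ∈ Icc 0 T) : ∫ x : unitInterval, p.density x * deriv (G.toFun t) x ≤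
      e + 1 / 2 * ∫ x : unitInterval, G.ext t x ^ 2 := by
  have deriv_eq : ∫ x : unitInterval, p.density x * deriv (G.toFun t) x =
      ∫ x : unitInterval, p.density x * deriv (G.ext t) x := by
    refine integral_congr_ae ?_
    filter_upwards [ae_mem_Ioo] with x hx
    rw [G.deriv_ext_of_mem t hx]
  have parseval := cos_parseval hp.memLp_density
    (memLp_of_continuous ((G.continuous_deriv_ext ht).comp continuous_subtype_val))
  have bessel (N : ℕ) := sin_bessel N
    (memLp_of_continuous ((G.contDiff_ext ht).continuous.comp continuous_subtype_val))
  set s : ℕ → ℝ := fun n => ∫ x : unitInterval, G.ext t x * sinMap n x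
  have term_le (n : ℕ) : cosWeight n * p.coef n * (n * Real.pi * s n) ≤
      (n * Real.pi * p.coef n) ^ 2 + s n ^ 2 := by
    rcases eq_or_ne n 0 with rfl | hn
    · simpa using sq_nonneg (s 0)
    · rw [cosWeight_of_ne hn]
      linarith [two_mul_le_add_sq (n * Real.pi * p.coef n) (s n)]
  rw [deriv_eq]
  refine le_of_tendsto' parseval.tendsto_sum_nat fun N => ?_
  calc _ = ∑ n ∈ Finset.range N, cosWeight n * p.coef n * (n * Real.pi * s n) :=
        Finset.sum_congr rfl fun n _ => by
          rw [SubMeasure.coef, hp.pairing_eq]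
          exact congrArg _ (G.integral_deriv_ext_mul_cosMap ht n)
    _ ≤ ∑ n ∈ Finset.range N, (n * Real.pi * p.coef n) ^ 2 + ∑ n ∈ Finset.range N, s n ^ 2 := by
        rw [← Finset.sum_add_distrib]
        exact Finset.sum_le_sum fun n _ => term_le n
    _ ≤ e + 1 / 2 * ∫ x : unitInterval, G.ext t x ^ 2 := by
        have := sum_le_hasSum (Finset.range N) (fun n _ => sq_nonneg _) he
        have : 2 * ∑ n ∈ Finset.range N, s n ^ 2 ≤ ∫ x : unitInterval, G.ext t x ^ 2 := bessel N
        linarith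

lemma FourierEnergyLe.hasFiniteEnergy {π : MPath T} {C : ℝ} (hπ : ∀ t, (π t).IsAC)
    (h : FourierEnergyLe π C) : HasFiniteEnergy π := by
  obtain ⟨e, he_int, he_nonneg, he_le, he⟩ := h.exists_hasSum
  suffices energyFunctional_le : ∀ G : EnergyTest T, energyFunctional G π ≤ C from
    ⟨hπ, (iSup_le fun G => EReal.coe_le_coe_iff.2 (energyFunctional_le G)).trans_lt
      (EReal.coe_lt_top C)⟩
  intro G
  have ext_eq (t : Icc (0 : ℝ) T) :
      ∫ x : unitInterval, G.toFun t x ^ 2 = ∫ x : unitInterval, G.ext t x ^ 2 := by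
    refine integral_congr_ae ?_
    filter_upwards [ae_mem_Ioo] with x hx
    rw [G.ext_of_mem t hx]
  have sq_int := (integrable_leb G.continuous_integral_ext_sq).const_mul (1 / 2)
  have linear_le : (∫ t, (∫ x, (π t).density x * deriv (G.toFun t) x) ∂leb T) ≤
      ∫ t : Icc (0 : ℝ) T, (e t + 1 / 2 * ∫ x : unitInterval, G.ext t x ^ 2) ∂leb T := by
    refine integral_le_integral_of_le (he_int.add sq_int)
      (fun t => add_nonneg (he_nonneg t)
      (mul_nonneg one_half_pos.le (integral_nonneg fun x => sq_nonneg _))) ?_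
    filter_upwards [he] with t ht using integral_density_mul_deriv_le (hπ t) ht G t.2
  rw [integral_add he_int sq_int, integral_const_mul] at linear_le
  simp_rw [energyFunctional, ext_eq]
  linarith

/-! ### Boundary values -/

lemma two_mul_abs_le {n : ℕ} (hn : n ≠ 0) {κ : ℝ} (hκ : 0 < κ) (c : ℝ) :
    2 * |c| ≤ κ * (n * Real.pi * c) ^ 2 + κ⁻¹ * (1 / (n : ℝ) ^ 2) := by
  have hn' : (n : ℝ) ≠ 0 := Nat.cast_ne_zero.2 hn
  have sq_pos : 0 ≤ κ * (n * Real.pi * |c| - κ⁻¹ / n) ^ 2 := by positivity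
  have expand : κ * (n * Real.pi * |c| - κ⁻¹ / n) ^ 2 =
      κ * (n * Real.pi * c) ^ 2 - Real.pi * (2 * |c|) + κ⁻¹ * (1 / (n : ℝ) ^ 2) := by
    rw [← sq_abs (n * Real.pi * c), abs_mul,
      abs_of_nonneg (by positivity : 0 ≤ n * Real.pi)]
    field_simp
    ring
  have : 2 * |c| ≤ Real.pi * (2 * |c|) :=
    le_mul_of_one_le_left (by positivity) (by linarith [Real.pi_gt_three])
  linarith

lemma exists_hasSum_cosMap {b : ℕ → ℝ} (hb : Summable fun n => |b n|) :
    ∃ w : C(unitInterval, ℝ), (∀ x, HasSum (fun n => b n * cosMap n x) (w x)) ∧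
      ∀ m, HasSum (fun n => b n * ∫ x, cosMap n x * cosMap m x) (∫ x, w x * cosMap m x) := by
  have term_le (n : ℕ) (x : unitInterval) : ‖b n * cosMap n x‖ ≤ |b n| := by
    rw [norm_mul]
    exact mul_le_of_le_one_right (norm_nonneg _) (Real.abs_cos_le_one _)
  let w : C(unitInterval, ℝ) := ⟨fun x => ∑' n, b n * cosMap n x,
    continuous_tsum (fun n => continuous_const.mul (cosMap n).continuous) hb term_le⟩
  have hw (x) : HasSum (fun n => b n * cosMap n x) (w x) :=
    (Summable.of_norm_bounded hb fun n => term_le n x).hasSum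
  refine ⟨w, hw, fun m => ?_⟩
  simp_rw [← integral_const_mul, ← mul_assoc]
  refine hasSum_integral_of_dominated_convergence (fun n _ => |b n|)
    (fun n => (Continuous.aestronglyMeasurable (by fun_prop)))
    (fun n => ae_of_all _ fun x => ?_) (ae_of_all _ fun _ => hb) (integrable_const _)
    (ae_of_all _ fun x => (hw x).mul_right _)
  rw [norm_mul]
  exact (mul_le_of_le_one_right (norm_nonneg _) (Real.abs_cos_le_one _)).trans (term_le n x)

section ContValue

variable {p : SubMeasure} {e : ℝ}

lemma summable_coef (he : HasSum (fun n : ℕ => (n * Real.pi * p.coef n) ^ 2) e) :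
    Summable fun n => |cosWeight n * p.coef n| := by
  have bound_summable : Summable fun n : ℕ => (n * Real.pi * p.coef n) ^ 2 + 1 / (n : ℝ) ^ 2 :=
    he.summable.add (Real.summable_one_div_nat_pow.2 one_lt_two)
  refine bound_summable.of_norm_bounded_eventually_nat ?_
  filter_upwards [eventually_ne_atTop 0] with n hn
  rw [Real.norm_eq_abs, abs_abs, cosWeight_of_ne hn, abs_mul, abs_two]
  simpa only [one_mul, inv_one] using two_mul_abs_le hn one_pos (p.coef n)

lemma hasSum_contValue (hp : p.IsAC) (he : HasSum (fun n : ℕ => (n * Real.pi * p.coef n) ^ 2) e)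
    (x : unitInterval) :
    HasSum (fun n => cosWeight n * p.coef n * cosMap n x) (contValue p.density x) := by
  obtain ⟨w, hw, hcoef⟩ := exists_hasSum_cosMap (summable_coef he)
  suffices density_eq : p.density =ᵐ[volume] w by
    rw [contValue_eq density_eq]
    exact hw x
  refine ae_eq_of_cos_coef_eq hp.memLp_density (memLp_of_continuous w.continuous) fun m => ?_
  have term_eq (n : ℕ) : (cosWeight n * p.coef n * ∫ x, cosMap n x * cosMap m x) =
      if n = m then p.coef m else 0 := by
    rw [integral_cosMap_mul_cosMap]
    split_ifs with h
    · rw [← h, mul_right_comm, mul_inv_cancel₀ (cosWeight_pos n).ne', one_mul]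
    · rw [mul_zero]
  rw [← hp.pairing_eq]
  refine (hasSum_ite_eq m (p.coef m)).unique ?_
  simpa only [term_eq] using hcoef m

/-- The tail `∑_{n ≥ N} n⁻²`. -/
def sqTail (N : ℕ) : ℝ := ∑' k : ℕ, 1 / ((k + N : ℕ) : ℝ) ^ 2

lemma tendsto_sqTail : Tendsto sqTail atTop (𝓝 0) :=
  tendsto_sum_nat_add fun n : ℕ => 1 / (n : ℝ) ^ 2

/-- The value at `x` of the partial sum with `N` terms of the cosine series of `p`. -/
def SubMeasure.cosSum (N : ℕ) (x : unitInterval) (p : SubMeasure) : ℝ :=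
  ∑ n ∈ Finset.range N, cosWeight n * p.coef n * cosMap n x

lemma abs_contValue_sub_cosSum_le (hp : p.IsAC)
    (he : HasSum (fun n : ℕ => (n * Real.pi * p.coef n) ^ 2) e) (x : unitInterval) {N : ℕ}
    (hN : N ≠ 0) {κ : ℝ} (hκ : 0 < κ) :
    |contValue p.density x - p.cosSum N x| ≤ κ * e + κ⁻¹ * sqTail N := by
  have tail_hasSum := (hasSum_nat_add_iff' N).2 (hasSum_contValue hp he x)
  have energy_tail := (hasSum_nat_add_iff' N).2 he
  have sq_tail : HasSum (fun k : ℕ => 1 / ((k + N : ℕ) : ℝ) ^ 2) (sqTail N) :=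
    ((summable_nat_add_iff N (f := fun n : ℕ => 1 / (n : ℝ) ^ 2)).2
      (Real.summable_one_div_nat_pow.2 one_lt_two)).hasSum
  have term_le (k : ℕ) : ‖cosWeight (k + N) * p.coef (k + N) * cosMap (k + N) x‖ ≤
      κ * (((k + N : ℕ) : ℝ) * Real.pi * p.coef (k + N)) ^ 2 +
        κ⁻¹ * (1 / ((k + N : ℕ) : ℝ) ^ 2) := by
    refine le_trans ?_ (two_mul_abs_le (by omega) hκ (p.coef (k + N)))
    rw [cosWeight_of_ne (by omega), norm_mul, norm_mul, Real.norm_two]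
    exact mul_le_of_le_one_right (by positivity) (Real.abs_cos_le_one _)
  refine (tail_hasSum.norm_le_of_bounded ((energy_tail.mul_left κ).add (sq_tail.mul_left κ⁻¹))
    term_le).trans ?_
  gcongr
  exact sub_le_self _ (Finset.sum_nonneg fun n _ => sq_nonneg _)

end ContValue

/-! ### Passing to the limit in time integrals -/

lemma measurable_integral_of_ae_eq {Ω X : Type*} [MeasurableSpace Ω] [MeasurableSpace X]
    {μ : Measure X} [SFinite μ] {Ψ V : Ω → X → ℝ} (hV : Measurable (Function.uncurry V))
    (h : ∀ t, Ψ t =ᵐ[μ] V t) : Measurable fun t => ∫ x, Ψ t x ∂μ := by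
  simp_rw [fun t => integral_congr_ae (h t)]
  exact (hV.stronglyMeasurable.integral_prod_right (f := V)).measurable

namespace SubMeasure

lemma measurable_mobility (p : SubMeasure) : Measurable fun x => mobility (p.density x) :=
  p.measurable_density.mul (p.measurable_density.const_sub 1)

variable {p : SubMeasure} {f : unitInterval → ℝ} {C : ℝ}

lemma IsAC.abs_integral_density_mul_le_of_forall_le (hp : p.IsAC) (hf : Measurable f)
    (hC : ∀ x, |f x| ≤ C) : |∫ x, p.density x * f x| ≤ C := by
  have hfi : Integrable f := .of_bound hf.aestronglyMeasurable C (ae_of_all _ hC)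
  calc |∫ x, p.density x * f x| ≤ ∫ x, |f x| := hp.abs_integral_density_mul_le hfi
    _ ≤ ∫ _ : unitInterval, C := integral_mono hfi.abs (integrable_const C) hC
    _ = C := by simp

lemma IsAC.abs_mobility_le (hp : p.IsAC) : ∀ᵐ x, |mobility (p.density x)| ≤ 1 := by
  filter_upwards [hp.density_mem] with x hx
  have mobility_nonneg : 0 ≤ mobility (p.density x) := mul_nonneg hx.1 (sub_nonneg.2 hx.2)
  rw [abs_of_nonneg mobility_nonneg]
  exact (mobility_le _).trans (by norm_num)

lemma IsAC.integrable_mobility_mul (hp : p.IsAC) (hf : Integrable f) :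
    Integrable fun x => mobility (p.density x) * f x :=
  hf.bdd_mul (c := 1) p.measurable_mobility.aestronglyMeasurable hp.abs_mobility_le

lemma IsAC.abs_integral_mobility_mul_le (hp : p.IsAC) (hC : ∀ x, |f x| ≤ C) :
    |∫ x, mobility (p.density x) * f x| ≤ C := by
  have norm_le : ‖∫ x, mobility (p.density x) * f x‖ ≤ ∫ _ : unitInterval, C := by
    refine norm_integral_le_of_norm_le (integrable_const C) ?_
    filter_upwards [hp.abs_mobility_le] with x hx
    rw [norm_mul]
    exact (mul_le_of_le_one_left (norm_nonneg _) hx).trans (hC x)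
  simpa using norm_le

lemma IsAC.integral_mobility_mul_le_tangent (hp : p.IsAC) {u : unitInterval → ℝ}
    (hf : Integrable f) (hg : Integrable fun x => (1 - 2 * u x) * f x)
    (hs : Integrable fun x => u x ^ 2 * f x) (hf0 : ∀ x, 0 ≤ f x) :
    ∫ x, mobility (p.density x) * f x ≤
      (∫ x, p.density x * ((1 - 2 * u x) * f x)) + ∫ x, u x ^ 2 * f x := by
  rw [← integral_add (hp.integrable_density_mul hg) hs]
  refine integral_mono (hp.integrable_mobility_mul hf)
    ((hp.integrable_density_mul hg).add hs) fun x => ?_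
  simp only [mobility]
  linarith [mul_nonneg (sq_nonneg (p.density x - u x)) (hf0 x)]

lemma IsAC.integral_mobility_mul_eq_tangent (hp : p.IsAC) {u : unitInterval → ℝ}
    (hu : p.density =ᵐ[volume] u) (hg : Integrable fun x => (1 - 2 * u x) * f x)
    (hs : Integrable fun x => u x ^ 2 * f x) :
    ∫ x, mobility (p.density x) * f x =
      (∫ x, p.density x * ((1 - 2 * u x) * f x)) + ∫ x, u x ^ 2 * f x := by
  rw [← integral_add (hp.integrable_density_mul hg) hs]
  refine integral_congr_ae ?_
  filter_upwards [hu] with x hx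
  rw [hx, mobility]
  ring

end SubMeasure

section Weights

variable {π : MPath T} {y : ℕ → MPath T} {f : Icc (0 : ℝ) T → unitInterval → ℝ} {C : ℝ}

lemma integrable_of_uncurry (hf : Measurable (Function.uncurry f)) (hC : ∀ t x, |f t x| ≤ C)
    (t : Icc (0 : ℝ) T) : Integrable (f t) :=
  .of_bound hf.of_uncurry_left.aestronglyMeasurable C (ae_of_all _ (hC t))

lemma exists_bound_of_continuous (hf : Continuous (Function.uncurry f)) :
    ∃ C, ∀ t x, |f t x| ≤ C := by
  obtain ⟨C, hC⟩ := isCompact_univ.exists_bound_of_continuousOn hf.continuousOn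
  exact ⟨C, fun t x => hC (t, x) trivial⟩

lemma measurable_integral_density_mul (hπ : ∀ t, (π t).IsAC)
    (hf : Measurable (Function.uncurry f)) :
    Measurable fun t => ∫ x, (π t).density x * f t x := by
  obtain ⟨U, hU, -, density_eq⟩ := π.exists_joint_density hπ
  refine measurable_integral_of_ae_eq (V := fun t x => U t x * f t x) (hU.mul hf) fun t => ?_
  filter_upwards [density_eq t] with x hx
  rw [hx]

lemma integrable_integral_density_mul (hπ : ∀ t, (π t).IsAC)
    (hf : Measurable (Function.uncurry f)) (hC : ∀ t x, |f t x| ≤ C) :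
    Integrable (fun t => ∫ x, (π t).density x * f t x) (leb T) :=
  .of_bound (measurable_integral_density_mul hπ hf).aestronglyMeasurable C <| ae_of_all _ fun t =>
    (hπ t).abs_integral_density_mul_le_of_forall_le hf.of_uncurry_left (hC t)

lemma tendsto_integral_integral_density_mul (hy : ∀ k t, (y k t).IsAC) (hπ : ∀ t, (π t).IsAC)
    (h : ∀ t, Tendsto (fun k => y k t) atTop (𝓝 (π t)))
    (hf : Measurable (Function.uncurry f)) (hC : ∀ t x, |f t x| ≤ C) :
    Tendsto (fun k => ∫ t, (∫ x, (y k t).density x * f t x) ∂leb T) atTop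
      (𝓝 (∫ t, (∫ x, (π t).density x * f t x) ∂leb T)) := by
  refine tendsto_integral_of_dominated_convergence (fun _ => C)
    (fun k => (measurable_integral_density_mul (hy k) hf).aestronglyMeasurable)
    (integrable_const C) (fun k => ae_of_all _ fun t => ?_) (ae_of_all _ fun t => ?_)
  · exact (hy k t).abs_integral_density_mul_le_of_forall_le hf.of_uncurry_left (hC t)
  · exact SubMeasure.tendsto_integral_density_mul (fun k => hy k t) (hπ t) (h t)
      (integrable_of_uncurry hf hC t)

lemma integrable_integral_mobility_mul (hπ : ∀ t, (π t).IsAC)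
    (hf : Measurable (Function.uncurry f)) (hC : ∀ t x, |f t x| ≤ C) :
    Integrable (fun t => ∫ x, mobility ((π t).density x) * f t x) (leb T) := by
  obtain ⟨U, hU, -, density_eq⟩ := π.exists_joint_density hπ
  refine .of_bound (measurable_integral_of_ae_eq (V := fun t x => U t x * (1 - U t x) * f t x)
    ((hU.mul (hU.const_sub 1)).mul hf) fun t => ?_).aestronglyMeasurable C
    (ae_of_all _ fun t => (hπ t).abs_integral_mobility_mul_le (hC t))
  filter_upwards [density_eq t] with x hx
  rw [hx, mobility]

lemma integrable_integral_of_uncurry (hf : Measurable (Function.uncurry f))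
    (hC : ∀ t x, |f t x| ≤ C) : Integrable (fun t => ∫ x, f t x) (leb T) :=
  (Integrable.of_bound hf.aestronglyMeasurable C
    (ae_of_all _ fun z => hC z.1 z.2) : Integrable _ ((leb T).prod volume)).integral_prod_left

/-- By concavity of `σ`, its tangent at the density of `π` is an affine majorant. -/
lemma exists_affine_majorant_mobility (hπ : ∀ t, (π t).IsAC)
    (hf : Measurable (Function.uncurry f)) (hC : ∀ t x, |f t x| ≤ C) (hf0 : ∀ t x, 0 ≤ f t x) :
    ∃ g : Icc (0 : ℝ) T → unitInterval → ℝ, ∃ K : ℝ,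
      Measurable (Function.uncurry g) ∧ (∀ t x, |g t x| ≤ C) ∧
      (∀ ν : MPath T, (∀ t, (ν t).IsAC) →
        ∫ t, (∫ x, mobility ((ν t).density x) * f t x) ∂leb T ≤
          (∫ t, (∫ x, (ν t).density x * g t x) ∂leb T) + K) ∧
      ∫ t, (∫ x, mobility ((π t).density x) * f t x) ∂leb T =
        (∫ t, (∫ x, (π t).density x * g t x) ∂leb T) + K := by
  obtain ⟨U, hU, U_mem, density_eq⟩ := π.exists_joint_density hπ
  have abs_mul_le {a : ℝ} (ha : |a| ≤ 1) (t x) : |a * f t x| ≤ C := by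
    rw [abs_mul]
    exact (mul_le_of_le_one_left (abs_nonneg _) ha).trans (hC t x)
  have hg : Measurable (Function.uncurry fun t x => (1 - 2 * U t x) * f t x) :=
    ((hU.const_mul 2).const_sub 1).mul hf
  have hs : Measurable (Function.uncurry fun t x => U t x ^ 2 * f t x) := (hU.pow_const 2).mul hf
  have hgC (t x) : |(1 - 2 * U t x) * f t x| ≤ C :=
    abs_mul_le (abs_le.2 (by constructor <;> linarith [(U_mem t x).1, (U_mem t x).2])) t x
  have hsC (t x) : |U t x ^ 2 * f t x| ≤ C := by
    refine abs_mul_le ?_ t x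
    rw [abs_of_nonneg (sq_nonneg _)]
    exact pow_le_one₀ (U_mem t x).1 (U_mem t x).2
  have integrable_s := integrable_integral_of_uncurry hs hsC
  refine ⟨_, ∫ t, (∫ x, U t x ^ 2 * f t x) ∂leb T, hg, hgC, fun ν hν => ?_, ?_⟩
  · have integrable_g := integrable_integral_density_mul hν hg hgC
    rw [← integral_add integrable_g integrable_s]
    exact integral_mono (integrable_integral_mobility_mul hν hf hC)
      (integrable_g.add integrable_s) fun t =>
        (hν t).integral_mobility_mul_le_tangent (integrable_of_uncurry hf hC t)
          (integrable_of_uncurry hg hgC t) (integrable_of_uncurry hs hsC t) (hf0 t)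
  · rw [← integral_add (integrable_integral_density_mul hπ hg hgC) integrable_s]
    congr 1 with t
    exact (hπ t).integral_mobility_mul_eq_tangent (density_eq t)
      (integrable_of_uncurry hg hgC t) (integrable_of_uncurry hs hsC t)

lemma le_integral_mobility_of_tendsto (hy : ∀ k t, (y k t).IsAC) (hπ : ∀ t, (π t).IsAC)
    (h : ∀ t, Tendsto (fun k => y k t) atTop (𝓝 (π t)))
    (hf : Measurable (Function.uncurry f)) (hC : ∀ t x, |f t x| ≤ C) (hf0 : ∀ t x, 0 ≤ f t x)
    {a : ℕ → ℝ} {b : ℝ} (ha : Tendsto a atTop (𝓝 b))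
    (hle : ∀ k, a k ≤ ∫ t, (∫ x, mobility ((y k t).density x) * f t x) ∂leb T) :
    b ≤ ∫ t, (∫ x, mobility ((π t).density x) * f t x) ∂leb T := by
  obtain ⟨g, K, hg, hgC, le_majorant, eq_majorant⟩ := exists_affine_majorant_mobility hπ hf hC hf0
  rw [eq_majorant]
  exact le_of_tendsto_of_tendsto' ha
    ((tendsto_integral_integral_density_mul hy hπ h hg hgC).add_const K)
    fun k => (hle k).trans (le_majorant _ (hy k))

end Weights

section ContinuousFunctional

variable {Ψ : Icc (0 : ℝ) T × SubMeasure → ℝ}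

lemma MPath.measurable_comp_prod (hΨ : Continuous Ψ) (π : MPath T) :
    Measurable fun t => Ψ (t, π t) :=
  measurable_of_continuousWithinAt_Ici fun t =>
    hΨ.continuousAt.comp_continuousWithinAt
      (continuousWithinAt_id.prodMk (π.right_continuous t))

lemma exists_forall_norm_le (hΨ : Continuous Ψ) : ∃ C, ∀ z, ‖Ψ z‖ ≤ C := by
  obtain ⟨C, hC⟩ := isCompact_univ.exists_bound_of_continuousOn hΨ.continuousOn
  exact ⟨C, fun z => hC z trivial⟩

lemma MPath.integrable_comp (hΨ : Continuous Ψ) (π : MPath T) :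
    Integrable (fun t => Ψ (t, π t)) (leb T) := by
  obtain ⟨C, hC⟩ := exists_forall_norm_le hΨ
  exact .of_bound (π.measurable_comp_prod hΨ).aestronglyMeasurable C (ae_of_all _ fun t => hC _)

lemma tendsto_integral_comp (hΨ : Continuous Ψ) {y : ℕ → MPath T} {π : MPath T}
    (h : ∀ t, Tendsto (fun k => y k t) atTop (𝓝 (π t))) :
    Tendsto (fun k => ∫ t, Ψ (t, y k t) ∂leb T) atTop (𝓝 (∫ t, Ψ (t, π t) ∂leb T)) := by
  obtain ⟨C, hC⟩ := exists_forall_norm_le hΨ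
  exact tendsto_integral_of_dominated_convergence (fun _ => C)
    (fun k => ((y k).measurable_comp_prod hΨ).aestronglyMeasurable) (integrable_const C)
    (fun k => ae_of_all _ fun t => hC _)
    (ae_of_all _ fun t => (hΨ.tendsto _).comp (tendsto_const_nhds.prodMk_nhds (h t)))

end ContinuousFunctional

section BoundaryValues

variable {y : ℕ → MPath T} {π : MPath T} {C : ℝ}

lemma FourierEnergyLe.of_tendsto (hy : ∀ k, FourierEnergyLe (y k) C)
    (h : ∀ t, Tendsto (fun k => y k t) atTop (𝓝 (π t))) : FourierEnergyLe π C := fun M =>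
  le_of_tendsto' (tendsto_integral_comp (Ψ := fun z => ∑ n ∈ Finset.range M,
    (n * Real.pi * z.2.coef n) ^ 2) (continuous_finsetSum _ fun n _ =>
      (continuous_const.mul ((SubMeasure.continuous_coef n).comp continuous_snd)).pow 2) h)
    fun k => hy k M

lemma SubMeasure.continuous_cosSum (N : ℕ) (x : unitInterval) :
    Continuous (SubMeasure.cosSum N x) :=
  continuous_finsetSum _ fun n _ =>
    (continuous_const.mul (SubMeasure.continuous_coef n)).mul continuous_const

variable {x : unitInterval} {φ : Icc (0 : ℝ) T → ℝ}

lemma continuous_cosSum_mul (N : ℕ) (x : unitInterval) (hφ : Continuous φ) :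
    Continuous fun z : Icc (0 : ℝ) T × SubMeasure => z.2.cosSum N x * φ z.1 :=
  ((SubMeasure.continuous_cosSum N x).comp continuous_snd).mul (hφ.comp continuous_fst)

lemma aestronglyMeasurable_contValue (hπ : ∀ t, (π t).IsAC) (h : FourierEnergyLe π C) :
    AEStronglyMeasurable (fun t => contValue (π t).density x) (leb T) := by
  obtain ⟨e, -, -, -, hasSum_e⟩ := h.exists_hasSum
  refine aestronglyMeasurable_of_tendsto_ae atTop
    (f := fun N t => (π t).cosSum N x) (fun N =>
      (π.measurable_comp (SubMeasure.continuous_cosSum N x)).aestronglyMeasurable) ?_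
  filter_upwards [hasSum_e] with t ht using (hasSum_contValue (hπ t) ht x).tendsto_sum_nat

lemma integrable_contValue_mul (hπ : ∀ t, (π t).IsAC) (h : FourierEnergyLe π C)
    (hφ : Continuous φ) : Integrable (fun t => contValue (π t).density x * φ t) (leb T) := by
  refine (integrable_leb hφ).bdd_mul (c := 1) (aestronglyMeasurable_contValue hπ h)
    (ae_of_all _ fun t => ?_)
  have value_mem := contValue_mem (hπ t).density_mem x
  rw [Real.norm_of_nonneg value_mem.1]
  exact value_mem.2

lemma abs_integral_contValue_sub_cosSum_le (hπ : ∀ t, (π t).IsAC) (h : FourierEnergyLe π C)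
    (hφ : Continuous φ) {L : ℝ} (hL : ∀ t, |φ t| ≤ L) (hL0 : 0 ≤ L) {N : ℕ} (hN : N ≠ 0) {κ : ℝ}
    (hκ : 0 < κ) :
    |∫ t, contValue (π t).density x * φ t ∂leb T - ∫ t, (π t).cosSum N x * φ t ∂leb T| ≤
      (κ * C + κ⁻¹ * sqTail N * (leb T).real univ) * L := by
  obtain ⟨e, integrable_e, -, integral_e_le, hasSum_e⟩ := h.exists_hasSum
  rw [← integral_sub (integrable_contValue_mul hπ h hφ)
    (π.integrable_comp (continuous_cosSum_mul N x hφ)), ← Real.norm_eq_abs]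
  have integrable_bound : Integrable (fun t => κ * e t + κ⁻¹ * sqTail N) (leb T) :=
    (integrable_e.const_mul κ).add (integrable_const _)
  calc ‖∫ t, (contValue (π t).density x * φ t - (π t).cosSum N x * φ t) ∂leb T‖
      ≤ ∫ t, (κ * e t + κ⁻¹ * sqTail N) * L ∂leb T := by
        refine norm_integral_le_of_norm_le (integrable_bound.mul_const L) ?_
        filter_upwards [hasSum_e] with t ht
        have sub_le := abs_contValue_sub_cosSum_le (hπ t) ht x hN hκ
        rw [← sub_mul, norm_mul]
        exact mul_le_mul sub_le (hL t) (norm_nonneg _) ((abs_nonneg _).trans sub_le)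
    _ = (κ * ∫ t, e t ∂leb T + κ⁻¹ * sqTail N * (leb T).real univ) * L := by
        rw [integral_mul_const, integral_add (integrable_e.const_mul κ) (integrable_const _),
          integral_const_mul, integral_const, smul_eq_mul, mul_comm ((leb T).real univ)]
    _ ≤ (κ * C + κ⁻¹ * sqTail N * (leb T).real univ) * L := by gcongr

lemma tendstoUniformlyOn_integral_cosSum_mul (x : unitInterval) (hφ : Continuous φ) (C : ℝ) :
    TendstoUniformlyOn (fun N (ν : MPath T) => ∫ t, (ν t).cosSum N x * φ t ∂leb T)
      (fun ν => ∫ t, contValue (ν t).density x * φ t ∂leb T) atTop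
      {ν | (∀ t, (ν t).IsAC) ∧ FourierEnergyLe ν C} := by
  obtain ⟨L, hL⟩ := isCompact_univ.exists_bound_of_continuousOn hφ.continuousOn
  rw [Metric.tendstoUniformlyOn_iff]
  intro ε hε
  obtain ⟨κ, hκ, κ_mul_lt⟩ := exists_pos_mul_lt hε (C * max L 0)
  have bound_tendsto : Tendsto (fun N =>
      (κ * C + κ⁻¹ * sqTail N * (leb T).real univ) * max L 0) atTop
      (𝓝 ((κ * C + κ⁻¹ * 0 * (leb T).real univ) * max L 0)) :=
    (((tendsto_sqTail.const_mul κ⁻¹).mul_const _).const_add _).mul_const _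
  have limit_lt : (κ * C + κ⁻¹ * 0 * (leb T).real univ) * max L 0 < ε := by
    linarith
  filter_upwards [bound_tendsto.eventually_lt_const limit_lt, eventually_ne_atTop 0] with N hN hN0
  exact fun ν hν => (abs_integral_contValue_sub_cosSum_le hν.1 hν.2 hφ
    (fun t => (hL t trivial).trans (le_max_left _ _)) (le_max_right _ _) hN0 hκ).trans_lt hN

lemma tendsto_integral_contValue_mul (hy : ∀ k t, (y k t).IsAC) (hπ : ∀ t, (π t).IsAC)
    (hyC : ∀ k, FourierEnergyLe (y k) C) (h : ∀ t, Tendsto (fun k => y k t) atTop (𝓝 (π t)))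
    (x : unitInterval) (hφ : Continuous φ) :
    Tendsto (fun k => ∫ t, contValue (y k t).density x * φ t ∂leb T) atTop
      (𝓝 (∫ t, contValue (π t).density x * φ t ∂leb T)) := by
  have uniform := tendstoUniformlyOn_integral_cosSum_mul x hφ C
  have uniform_seq : TendstoUniformly (fun N k => ∫ t, (y k t).cosSum N x * φ t ∂leb T)
      (fun k => ∫ t, contValue (y k t).density x * φ t ∂leb T) atTop := fun V hV =>
    (uniform V hV).mono fun N hN k => hN (y k) ⟨hy k, hyC k⟩
  exact uniform_seq.tendsto_of_eventually_tendsto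
    (Eventually.of_forall fun N => tendsto_integral_comp (continuous_cosSum_mul N x hφ) h)
    (uniform.tendsto_at ⟨hπ, .of_tendsto hyC h⟩)

end BoundaryValues

/-! ### Closedness and compactness of the level sets -/

lemma continuous_uncurry_of_continuousOn {f : ℝ → ℝ → ℝ}
    (hf : ContinuousOn (fun p : ℝ × ℝ => f p.1 p.2) (Icc 0 T ×ˢ Icc 0 1)) :
    Continuous (Function.uncurry fun (t : Icc (0 : ℝ) T) (x : unitInterval) => f t x) :=
  hf.comp_continuous (f := fun z : Icc (0 : ℝ) T × unitInterval => ((z.1 : ℝ), (z.2 : ℝ)))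
    (by fun_prop) fun z => ⟨z.1.2, z.2.2⟩

/-- The slope of the affine function `a ↦ bdry ϱ D a M`. -/
def bdrySlope (ϱ D M : ℝ) : ℝ :=
  1 / D * ((1 - ϱ) * (Real.exp (-M) - 1) - ϱ * (Real.exp M - 1))

lemma bdry_eq_add_mul_bdrySlope (ϱ D a M : ℝ) :
    bdry ϱ D a M = bdry ϱ D 0 M + a * bdrySlope ϱ D M := by
  unfold bdry bdrySlope
  ring

lemma continuous_bdry (ϱ D a : ℝ) : Continuous (bdry ϱ D a) := by
  unfold bdry
  fun_prop

lemma continuous_bdrySlope (ϱ D : ℝ) : Continuous (bdrySlope ϱ D) := by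
  unfold bdrySlope
  fun_prop

section Affine

variable (α A β B : ℝ) (hT : 0 < T) (H : C12 T)

/-- The part of `J_{T,H}` that is affine in the path: every term but `-∫ ⟨σ(u_t), (∂ₓH_t)²⟩ dt`.
The boundary terms are split by means of `bdry_eq_add_mul_bdrySlope`. -/
def affinePart (π : MPath T) : ℝ :=
  (∫ x : unitInterval, (π (timeEnd hT)).density x * H.toFun T x)
    - (∫ x : unitInterval, (π (timeZero hT)).density x * H.toFun 0 x)
    - (∫ t, (∫ x : unitInterval, (π t).density x * H.dt t x) ∂leb T)
    - (∫ t, (∫ x : unitInterval, (π t).density x * H.dxx t x) ∂leb T)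
    + (∫ t, contValue (π t).density 1 * H.dx t 1 ∂leb T)
    - (∫ t, contValue (π t).density 0 * H.dx t 0 ∂leb T)
    - (∫ t, contValue (π t).density 0 * bdrySlope α A (H.toFun t 0) ∂leb T)
    - (∫ t, contValue (π t).density 1 * bdrySlope β B (H.toFun t 1) ∂leb T)
    - ∫ t : Icc (0 : ℝ) T, (bdry α A 0 (H.toFun t 0) + bdry β B 0 (H.toFun t 1)) ∂leb T

variable {C : ℝ} {H}

lemma C12.continuous_toFun_apply (x : unitInterval) :
    Continuous fun t : Icc (0 : ℝ) T => H.toFun t x :=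
  (continuous_uncurry_of_continuousOn H.cont).uncurry_right x

lemma C12.continuous_dx_apply (x : unitInterval) :
    Continuous fun t : Icc (0 : ℝ) T => H.dx t x :=
  (continuous_uncurry_of_continuousOn H.cont_dx).uncurry_right x

lemma integral_bdry_eq {π : MPath T} (hπ : ∀ t, (π t).IsAC) (hC : FourierEnergyLe π C) :
    (∫ t : Icc (0 : ℝ) T, (bdry α A (contValue (π t).density 0) (H.toFun t 0)
          + bdry β B (contValue (π t).density 1) (H.toFun t 1)) ∂leb T) =
      (∫ t, contValue (π t).density 0 * bdrySlope α A (H.toFun t 0) ∂leb T)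
        + (∫ t, contValue (π t).density 1 * bdrySlope β B (H.toFun t 1) ∂leb T)
        + ∫ t : Icc (0 : ℝ) T, (bdry α A 0 (H.toFun t 0) + bdry β B 0 (H.toFun t 1)) ∂leb T := by
  have slope_left := integrable_contValue_mul (x := 0) hπ hC
    ((continuous_bdrySlope α A).comp (C12.continuous_toFun_apply (H := H) 0))
  have slope_right := integrable_contValue_mul (x := 1) hπ hC
    ((continuous_bdrySlope β B).comp (C12.continuous_toFun_apply (H := H) 1))
  have const := integrable_leb
    (((continuous_bdry α A 0).comp (C12.continuous_toFun_apply (H := H) 0)).add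
      ((continuous_bdry β B 0).comp (C12.continuous_toFun_apply (H := H) 1)))
  refine Eq.trans ?_ ((integral_add (slope_left.add slope_right) const).trans
    (congrArg (· + _) (integral_add slope_left slope_right)))
  refine integral_congr_ae (ae_of_all _ fun t => ?_)
  simp only [bdry_eq_add_mul_bdrySlope α A (contValue _ _),
    bdry_eq_add_mul_bdrySlope β B (contValue _ _), Pi.add_apply, Function.comp_apply,
    Icc.coe_zero, Icc.coe_one]
  ring

lemma JReal_eq_affinePart_sub {π : MPath T} (hπ : ∀ t, (π t).IsAC) (hC : FourierEnergyLe π C) :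
    JReal α A β B hT H π = affinePart α A β B hT H π
      - ∫ t, (∫ x : unitInterval, mobility ((π t).density x) * (H.dx t x) ^ 2) ∂leb T := by
  rw [JReal, affinePart, integral_bdry_eq α A β B hπ hC]
  ring

lemma tendsto_affinePart {y : ℕ → MPath T} {π : MPath T} (hy : ∀ k t, (y k t).IsAC)
    (hπ : ∀ t, (π t).IsAC) (hyC : ∀ k, FourierEnergyLe (y k) C)
    (h : ∀ t, Tendsto (fun k => y k t) atTop (𝓝 (π t))) :
    Tendsto (fun k => affinePart α A β B hT H (y k)) atTop (𝓝 (affinePart α A β B hT H π)) := by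
  have single_time (s : Icc (0 : ℝ) T) :
      Tendsto (fun k => ∫ x : unitInterval, (y k s).density x * H.toFun s x) atTop
        (𝓝 (∫ x : unitInterval, (π s).density x * H.toFun s x)) :=
    SubMeasure.tendsto_integral_density_mul (fun k => hy k s) (hπ s) (h s)
      (integrable_of_continuous
        ((continuous_uncurry_of_continuousOn H.cont).uncurry_left s))
  have bulk {F : Icc (0 : ℝ) T → unitInterval → ℝ} (hF : Continuous (Function.uncurry F)) :=
    tendsto_integral_integral_density_mul hy hπ h hF.measurable
      (exists_bound_of_continuous hF).choose_spec
  have boundary (x : unitInterval) {φ : Icc (0 : ℝ) T → ℝ} (hφ : Continuous φ) :=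
    tendsto_integral_contValue_mul hy hπ hyC h x hφ
  exact (((((((single_time (timeEnd hT)).sub (single_time (timeZero hT))).sub
    (bulk (continuous_uncurry_of_continuousOn H.cont_dt))).sub
    (bulk (continuous_uncurry_of_continuousOn H.cont_dxx))).add
    (boundary 1 (C12.continuous_dx_apply 1))).sub
    (boundary 0 (C12.continuous_dx_apply 0))).sub
    (boundary 0 ((continuous_bdrySlope α A).comp (C12.continuous_toFun_apply 0)))).sub
    (boundary 1 ((continuous_bdrySlope β B).comp (C12.continuous_toFun_apply 1))) |>.sub_const _

end Affine

section LevelSets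

variable {α A β B : ℝ} (hα : α ∈ Icc (0 : ℝ) 1) (hβ : β ∈ Icc (0 : ℝ) 1) (hA : 0 < A) (hB : 0 < B)
  {γ : unitInterval → unitInterval} {q : ℝ}

lemma rateFrom_le_coe_iff {hT : 0 < T} {π : MPath T} :
    rateFrom α A β B hT γ π ≤ q ↔
      (π (timeZero hT)).density =ᵐ[volume] (fun x => (γ x : ℝ)) ∧ rate α A β B hT π ≤ q := by
  unfold rateFrom
  split_ifs with h <;> simp [h]

lemma isAC_of_rateFrom_le {hT : 0 < T} {π : MPath T} (h : rateFrom α A β B hT γ π ≤ q) :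
    ∀ t, (π t).IsAC :=
  (rate_le_coe_iff.1 (rateFrom_le_coe_iff.1 h).2).1.1

include hα hβ hA hB

lemma rate_le_of_tendsto {hT : 0 < T} {y : ℕ → MPath T} {π : MPath T}
    (hy : ∀ k, rate α A β B hT (y k) ≤ q) (h : ∀ t, Tendsto (fun k => y k t) atTop (𝓝 (π t))) :
    rate α A β B hT π ≤ q := by
  have hyAC (k) : ∀ t, (y k t).IsAC := (rate_le_coe_iff.1 (hy k)).1.1
  have hπAC (t) : (π t).IsAC :=
    SubMeasure.isClosed_setOf_isAC.mem_of_tendsto (h t) (.of_forall fun k => hyAC k t)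
  have hyE (k) : FourierEnergyLe (y k) (energyConst A B T q) :=
    fourierEnergyLe_of_rate_le hα hβ hA hB (hy k)
  have hπE := FourierEnergyLe.of_tendsto hyE h
  refine rate_le_coe_iff.2 ⟨hπE.hasFiniteEnergy hπAC, fun H => ?_⟩
  have hdx : Continuous (Function.uncurry fun (t : Icc (0 : ℝ) T) (x : unitInterval) =>
      (H.dx t x) ^ 2) := (continuous_uncurry_of_continuousOn H.cont_dx).pow 2
  have affine_le (k) : affinePart α A β B hT H (y k) - q ≤
      ∫ t, (∫ x : unitInterval, mobility ((y k t).density x) * (H.dx t x) ^ 2) ∂leb T := by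
    have := (rate_le_coe_iff.1 (hy k)).2 H
    rw [JReal_eq_affinePart_sub α A β B hT (hyAC k) (hyE k)] at this
    linarith
  have affine_le_lim := le_integral_mobility_of_tendsto hyAC hπAC h hdx.measurable
    (exists_bound_of_continuous hdx).choose_spec (fun t x => sq_nonneg _)
    ((tendsto_affinePart α A β B hT hyAC hπAC hyE h).sub_const q) affine_le
  rw [JReal_eq_affinePart_sub α A β B hT hπAC hπE]
  linarith

lemma rateFrom_le_of_tendsto {hT : 0 < T} {y : ℕ → MPath T} {π : MPath T}
    (hy : ∀ k, rateFrom α A β B hT γ (y k) ≤ q)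
    (h : ∀ t, Tendsto (fun k => y k t) atTop (𝓝 (π t))) :
    rateFrom α A β B hT γ π ≤ q := by
  have hπ := rate_le_of_tendsto hα hβ hA hB (fun k => (rateFrom_le_coe_iff.1 (hy k)).2) h
  have hy0 (k) : (y k (timeZero hT)).IsAC := isAC_of_rateFrom_le (hy k) _
  have hπ0 : (π (timeZero hT)).IsAC := (rate_le_coe_iff.1 hπ).1.1 _
  have density_eq (k) :
      (y k (timeZero hT)).density =ᵐ[volume] (y 0 (timeZero hT)).density :=
    (rateFrom_le_coe_iff.1 (hy k)).1.trans (rateFrom_le_coe_iff.1 (hy 0)).1.symm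
  have coef_eq (n k) : (y k (timeZero hT)).coef n = (y 0 (timeZero hT)).coef n := by
    rw [SubMeasure.coef, SubMeasure.coef, (hy0 k).pairing_eq, (hy0 0).pairing_eq]
    exact integral_congr_ae ((density_eq k).mul (ae_eq_refl _))
  have coef_lim (n) : (π (timeZero hT)).coef n = (y 0 (timeZero hT)).coef n :=
    tendsto_nhds_unique (((SubMeasure.continuous_coef n).tendsto _).comp (h (timeZero hT)))
      (tendsto_const_nhds.congr fun k => (coef_eq n k).symm)
  refine rateFrom_le_coe_iff.2
    ⟨EventuallyEq.trans ?_ (rateFrom_le_coe_iff.1 (hy 0)).1, hπ⟩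
  refine ae_eq_of_cos_coef_eq hπ0.memLp_density (hy0 0).memLp_density fun n => ?_
  rw [← hπ0.pairing_eq, ← (hy0 0).pairing_eq]
  exact coef_lim n

variable (γ q)

lemma uniformEquicontinuous_level (hT : 0 < T) :
    UniformEquicontinuous
      fun (π : {π : MPath T | rateFrom α A β B hT γ π ≤ q}) t => π.1 t := by
  rw [SubMeasure.isUniformInducing_coef.uniformEquicontinuous_iff, Pi.uniformSpace_eq,
    uniformEquicontinuous_iInf_rng]
  rintro n U ⟨V, hV, hVU⟩
  obtain ⟨η, hη, hηV⟩ := Metric.mem_uniformity_dist.1 hV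
  obtain ⟨δ, hδ, hmod⟩ := exists_forall_abs_coef_sub_lt hα hβ hA hB hT q n hη
  filter_upwards [Metric.dist_mem_uniformity hδ] with s hs π
  exact hVU (hηV (hmod π.1 (rateFrom_le_coe_iff.1 π.2).2 s.1 s.2 hs))

lemma isClosed_ofContinuous_preimage_level (hT : 0 < T) :
    IsClosed (SkorohodPath.ofContinuous ⁻¹' {π : MPath T | rateFrom α A β B hT γ π ≤ q}) :=
  IsSeqClosed.isClosed fun _ f hy hf => rateFrom_le_of_tendsto hα hβ hA hB hy fun t =>
    ((continuous_eval_const t).tendsto f).comp hf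

lemma isClosed_level (hT : 0 < T) : IsClosed {π : MPath T | rateFrom α A β B hT γ π ≤ q} :=
  SkorohodPath.isClosed_of_uniformEquicontinuous (uniformEquicontinuous_level hα hβ hA hB γ q hT)
    (isClosed_ofContinuous_preimage_level hα hβ hA hB γ q hT)

lemma isCompact_level (hT : 0 < T) : IsCompact {π : MPath T | rateFrom α A β B hT γ π ≤ q} :=
  SkorohodPath.isCompact_of_uniformEquicontinuous (uniformEquicontinuous_level hα hβ hA hB γ q hT)
    (isClosed_ofContinuous_preimage_level hα hβ hA hB γ q hT)

end LevelSets

/-! ### Convexity -/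

lemma concaveOn_mobility : ConcaveOn ℝ univ mobility :=
  ((concaveOn_id convex_univ).sub even_two.convexOn_pow).congr fun a _ => by
    simp only [mobility, Pi.sub_apply, id]
    ring

namespace SubMeasure

variable {p q : SubMeasure} (a b : ℝ≥0) (hab : a + b = 1)

lemma meas_comb : (comb a b hab p q).meas = a • p.meas + b • q.meas := by
  simp only [comb, meas, FiniteMeasure.toMeasure_add, FiniteMeasure.toMeasure_smul]

lemma coef_comb (n : ℕ) : (comb a b hab p q).coef n = a * p.coef n + b * q.coef n := by
  have integrable (r : SubMeasure) (c : ℝ≥0) : Integrable (cosMap n) (c • r.meas) :=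
    (r.integrable_continuousMap (cosMap n)).smul_measure_nnreal
  rw [coef, pairing, meas_comb, integral_add_measure (integrable p a) (integrable q b),
    integral_smul_nnreal_measure, integral_smul_nnreal_measure]
  rfl

lemma density_comb :
    (comb a b hab p q).density =ᵐ[volume] fun x => a * p.density x + b * q.density x := by
  filter_upwards [Measure.rnDeriv_add' (a • p.meas) (b • q.meas) volume,
    Measure.rnDeriv_smul_left p.meas volume a, Measure.rnDeriv_smul_left q.meas volume b,
    p.meas.rnDeriv_lt_top volume, q.meas.rnDeriv_lt_top volume] with x add_eq p_eq q_eq p_lt q_lt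
  rw [density, meas_comb, add_eq, Pi.add_apply, p_eq, q_eq, Pi.smul_apply, Pi.smul_apply,
    ENNReal.smul_def, ENNReal.smul_def, smul_eq_mul, smul_eq_mul,
    ENNReal.toReal_add (ENNReal.mul_ne_top ENNReal.coe_ne_top p_lt.ne)
      (ENNReal.mul_ne_top ENNReal.coe_ne_top q_lt.ne),
    ENNReal.toReal_mul, ENNReal.toReal_mul]
  rfl

namespace IsAC

variable {f : unitInterval → ℝ} (hp : p.IsAC) (hq : q.IsAC)
include hp hq

lemma comb : (comb a b hab p q).IsAC := by
  rw [isAC_iff_le_volume] at hp hq ⊢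
  calc (SubMeasure.comb a b hab p q).meas = a • p.meas + b • q.meas := meas_comb a b hab
    _ ≤ a • volume + b • volume := by gcongr
    _ = volume := by rw [← add_smul, hab, one_smul]

lemma integral_density_comb_mul (hf : Integrable f) :
    ∫ x, (SubMeasure.comb a b hab p q).density x * f x =
      a * (∫ x, p.density x * f x) + b * ∫ x, q.density x * f x := by
  rw [← integral_const_mul, ← integral_const_mul,
    ← integral_add ((hp.integrable_density_mul hf).const_mul _)
      ((hq.integrable_density_mul hf).const_mul _)]
  refine integral_congr_ae ?_
  filter_upwards [density_comb a b hab (p := p) (q := q)] with x hx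
  rw [hx]
  ring

lemma le_integral_mobility_comb_mul (hf : Integrable f) (hf0 : ∀ x, 0 ≤ f x) :
    a * (∫ x, mobility (p.density x) * f x) + b * (∫ x, mobility (q.density x) * f x) ≤
      ∫ x, mobility ((SubMeasure.comb a b hab p q).density x) * f x := by
  rw [← integral_const_mul, ← integral_const_mul,
    ← integral_add ((hp.integrable_mobility_mul hf).const_mul _)
      ((hq.integrable_mobility_mul hf).const_mul _)]
  refine integral_mono_ae (((hp.integrable_mobility_mul hf).const_mul _).add
    ((hq.integrable_mobility_mul hf).const_mul _))
    ((hp.comb a b hab hq).integrable_mobility_mul hf) ?_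
  filter_upwards [density_comb a b hab (p := p) (q := q)] with x hx
  rw [hx, ← mul_assoc, ← mul_assoc, ← add_mul]
  refine mul_le_mul_of_nonneg_right ?_ (hf0 x)
  exact concaveOn_mobility.2 (mem_univ _) (mem_univ _) a.2 b.2 (by exact_mod_cast hab)

lemma contValue_comb {e e' e'' : ℝ} (he : HasSum (fun n : ℕ => (n * Real.pi * p.coef n) ^ 2) e)
    (he' : HasSum (fun n : ℕ => (n * Real.pi * q.coef n) ^ 2) e')
    (he'' : HasSum (fun n : ℕ => (n * Real.pi * (SubMeasure.comb a b hab p q).coef n) ^ 2) e'')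
    (x : unitInterval) :
    contValue (SubMeasure.comb a b hab p q).density x =
      a * contValue p.density x + b * contValue q.density x := by
  have series_comb := ((hasSum_contValue hp he x).mul_left (a : ℝ)).add
    ((hasSum_contValue hq he' x).mul_left (b : ℝ))
  refine (hasSum_contValue (hp.comb a b hab hq) he'' x).unique (series_comb.congr_fun fun n => ?_)
  rw [coef_comb]
  ring

end IsAC

end SubMeasure

section PathComb

variable {π ν : MPath T} (a b : ℝ≥0) (hab : a + b = 1)

lemma FourierEnergyLe.comb {C C' : ℝ} (h : FourierEnergyLe π C) (h' : FourierEnergyLe ν C') :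
    FourierEnergyLe (MPath.comb a b hab π ν) (a * C + b * C') := by
  intro M
  have integrable (ρ : MPath T) : Integrable (fun t => ∑ n ∈ Finset.range M,
      (n * Real.pi * (ρ t).coef n) ^ 2) (leb T) :=
    integrable_finsetSum _ fun n _ => integrable_sq_coef ρ n
  have convex (t) : ∑ n ∈ Finset.range M,
      (n * Real.pi * (MPath.comb a b hab π ν t).coef n) ^ 2 ≤
      a * (∑ n ∈ Finset.range M, (n * Real.pi * (π t).coef n) ^ 2) +
        b * ∑ n ∈ Finset.range M, (n * Real.pi * (ν t).coef n) ^ 2 := by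
    rw [Finset.mul_sum, Finset.mul_sum, ← Finset.sum_add_distrib]
    refine Finset.sum_le_sum fun n _ => ?_
    have coef_eq : n * Real.pi * (MPath.comb a b hab π ν t).coef n =
        a * (n * Real.pi * (π t).coef n) + b * (n * Real.pi * (ν t).coef n) := by
      refine (congrArg (n * Real.pi * ·) (SubMeasure.coef_comb a b hab n)).trans ?_
      ring
    rw [coef_eq]
    exact even_two.convexOn_pow.2 (mem_univ _) (mem_univ _) a.coe_nonneg b.coe_nonneg
      (by exact_mod_cast hab)
  calc _ ≤ ∫ t, (a * (∑ n ∈ Finset.range M, (n * Real.pi * (π t).coef n) ^ 2) +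
        b * ∑ n ∈ Finset.range M, (n * Real.pi * (ν t).coef n) ^ 2) ∂leb T :=
        integral_mono (integrable _)
          (((integrable π).const_mul _).add ((integrable ν).const_mul _)) convex
    _ = a * (∫ t, (∑ n ∈ Finset.range M, (n * Real.pi * (π t).coef n) ^ 2) ∂leb T) +
        b * ∫ t, (∑ n ∈ Finset.range M, (n * Real.pi * (ν t).coef n) ^ 2) ∂leb T := by
        rw [integral_add ((integrable π).const_mul _) ((integrable ν).const_mul _),
          integral_const_mul, integral_const_mul]
    _ ≤ a * C + b * C' := by
        gcongr
        · exact h M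
        · exact h' M

lemma integral_eq_of_ae_eq_comb {Ω : Type*} [MeasurableSpace Ω] {μ : Measure Ω}
    {f g h : Ω → ℝ} {a b : ℝ} (hf : Integrable f μ) (hg : Integrable g μ)
    (hh : ∀ᵐ x ∂μ, h x = a * f x + b * g x) :
    ∫ x, h x ∂μ = a * (∫ x, f x ∂μ) + b * ∫ x, g x ∂μ := by
  rw [integral_congr_ae hh, integral_add (hf.const_mul a) (hg.const_mul b), integral_const_mul,
    integral_const_mul]

variable {C C' : ℝ} (hπ : ∀ t, (π t).IsAC) (hν : ∀ t, (ν t).IsAC)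
include hπ hν

lemma integral_integral_density_comb_mul {f : Icc (0 : ℝ) T → unitInterval → ℝ}
    (hf : Continuous (Function.uncurry f)) :
    ∫ t, (∫ x, (MPath.comb a b hab π ν t).density x * f t x) ∂leb T =
      a * (∫ t, (∫ x, (π t).density x * f t x) ∂leb T) +
        b * ∫ t, (∫ x, (ν t).density x * f t x) ∂leb T := by
  obtain ⟨K, hK⟩ := exists_bound_of_continuous hf
  exact integral_eq_of_ae_eq_comb (integrable_integral_density_mul hπ hf.measurable hK)
    (integrable_integral_density_mul hν hf.measurable hK) (ae_of_all _ fun t =>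
      (hπ t).integral_density_comb_mul a b hab (hν t)
        (integrable_of_uncurry hf.measurable hK t))

lemma le_integral_integral_mobility_comb_mul {f : Icc (0 : ℝ) T → unitInterval → ℝ}
    (hf : Continuous (Function.uncurry f)) (hf0 : ∀ t x, 0 ≤ f t x) :
    a * (∫ t, (∫ x, mobility ((π t).density x) * f t x) ∂leb T) +
        b * (∫ t, (∫ x, mobility ((ν t).density x) * f t x) ∂leb T) ≤
      ∫ t, (∫ x, mobility ((MPath.comb a b hab π ν t).density x) * f t x) ∂leb T := by
  obtain ⟨K, hK⟩ := exists_bound_of_continuous hf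
  have hπi := (integrable_integral_mobility_mul hπ hf.measurable hK).const_mul (a : ℝ)
  have hνi := (integrable_integral_mobility_mul hν hf.measurable hK).const_mul (b : ℝ)
  rw [← integral_const_mul, ← integral_const_mul, ← integral_add hπi hνi]
  exact integral_mono (hπi.add hνi)
    (integrable_integral_mobility_mul (fun t => (hπ t).comb a b hab (hν t)) hf.measurable hK)
    fun t => (hπ t).le_integral_mobility_comb_mul a b hab (hν t)
      (integrable_of_uncurry hf.measurable hK t) (hf0 t)

variable (hπC : FourierEnergyLe π C) (hνC : FourierEnergyLe ν C')
include hπC hνC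

lemma integral_contValue_comb_mul (x : unitInterval) {φ : Icc (0 : ℝ) T → ℝ}
    (hφ : Continuous φ) :
    ∫ t, contValue (MPath.comb a b hab π ν t).density x * φ t ∂leb T =
      a * (∫ t, contValue (π t).density x * φ t ∂leb T) +
        b * ∫ t, contValue (ν t).density x * φ t ∂leb T := by
  obtain ⟨_, -, -, -, hasSum_π⟩ := hπC.exists_hasSum
  obtain ⟨_, -, -, -, hasSum_ν⟩ := hνC.exists_hasSum
  obtain ⟨_, -, -, -, hasSum_comb⟩ := (hπC.comb a b hab hνC).exists_hasSum
  refine integral_eq_of_ae_eq_comb (integrable_contValue_mul hπ hπC hφ)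
    (integrable_contValue_mul hν hνC hφ) ?_
  filter_upwards [hasSum_π, hasSum_ν, hasSum_comb] with t ht ht' ht''
  have contValue_comb := (hπ t).contValue_comb a b hab (hν t) ht ht' ht'' x
  change contValue (SubMeasure.comb a b hab (π t) (ν t)).density x * φ t = _
  rw [contValue_comb]
  ring

variable (α A β B : ℝ) (hT : 0 < T) (H : C12 T)

lemma affinePart_comb :
    affinePart α A β B hT H (MPath.comb a b hab π ν) =
      a * affinePart α A β B hT H π + b * affinePart α A β B hT H ν := by
  have single_time (s : Icc (0 : ℝ) T) :
      ∫ x : unitInterval, (MPath.comb a b hab π ν s).density x * H.toFun s x =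
        a * (∫ x : unitInterval, (π s).density x * H.toFun s x) +
          b * ∫ x : unitInterval, (ν s).density x * H.toFun s x :=
    (hπ s).integral_density_comb_mul a b hab (hν s)
      (integrable_of_continuous ((continuous_uncurry_of_continuousOn H.cont).uncurry_left s))
  have initial := single_time (timeZero hT)
  have final := single_time (timeEnd hT)
  have bulk_dt := integral_integral_density_comb_mul a b hab hπ hν
    (continuous_uncurry_of_continuousOn H.cont_dt)
  have bulk_dxx := integral_integral_density_comb_mul a b hab hπ hν
    (continuous_uncurry_of_continuousOn H.cont_dxx)
  have boundary (x : unitInterval) {φ : Icc (0 : ℝ) T → ℝ} (hφ : Continuous φ) :=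
    integral_contValue_comb_mul a b hab hπ hν hπC hνC x hφ
  have dx_left := boundary 0 (C12.continuous_dx_apply (H := H) 0)
  have dx_right := boundary 1 (C12.continuous_dx_apply (H := H) 1)
  have slope_left := boundary 0
    ((continuous_bdrySlope α A).comp (C12.continuous_toFun_apply (H := H) 0))
  have slope_right := boundary 1
    ((continuous_bdrySlope β B).comp (C12.continuous_toFun_apply (H := H) 1))
  have coe_add : (a : ℝ) + b = 1 := by exact_mod_cast hab
  simp only [Function.comp_apply, Icc.coe_zero, Icc.coe_one]
    at dx_left dx_right slope_left slope_right
  simp only [timeZero, timeEnd] at initial final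
  simp only [affinePart, timeZero, timeEnd, initial, final, bulk_dt, bulk_dxx, dx_left, dx_right,
    slope_left, slope_right]
  linear_combination (∫ t : Icc (0 : ℝ) T,
    (bdry α A 0 (H.toFun t 0) + bdry β B 0 (H.toFun t 1)) ∂leb T) * coe_add

lemma JReal_comb_le :
    JReal α A β B hT H (MPath.comb a b hab π ν) ≤
      a * JReal α A β B hT H π + b * JReal α A β B hT H ν := by
  rw [JReal_eq_affinePart_sub α A β B hT (fun t => (hπ t).comb a b hab (hν t))
      (hπC.comb a b hab hνC), JReal_eq_affinePart_sub α A β B hT hπ hπC,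
    JReal_eq_affinePart_sub α A β B hT hν hνC, affinePart_comb a b hab hπ hν hπC hνC]
  have hdx : Continuous (Function.uncurry fun (t : Icc (0 : ℝ) T) (x : unitInterval) =>
      (H.dx t x) ^ 2) := (continuous_uncurry_of_continuousOn H.cont_dx).pow 2
  have mobility_le := le_integral_integral_mobility_comb_mul a b hab hπ hν hdx
    fun t x => sq_nonneg _
  linarith

end PathComb

lemma MPath.comb_zero_one (hab : (0 : ℝ≥0) + 1 = 1) (π ν : MPath T) :
    MPath.comb 0 1 hab π ν = ν := by
  cases ν
  simp [MPath.comb, SubMeasure.comb]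

lemma MPath.comb_one_zero (hab : (1 : ℝ≥0) + 0 = 1) (π ν : MPath T) :
    MPath.comb 1 0 hab π ν = π := by
  cases π
  simp [MPath.comb, SubMeasure.comb]

lemma le_coe_mul_add_coe_mul_of_forall_coe {a b : ℝ} (ha : 0 < a) (hb : 0 < b) {x y z : EReal}
    (hx : 0 ≤ x) (hy : 0 ≤ y)
    (h : ∀ r s : ℝ, x ≤ r → y ≤ s → z ≤ ((a * r + b * s : ℝ) : EReal)) :
    z ≤ (a : EReal) * x + (b : EReal) * y := by
  have ne_bot {c : ℝ} (hc : 0 < c) {w : EReal} (hw : 0 ≤ w) : (c : EReal) * w ≠ ⊥ :=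
    (EReal.bot_lt_zero.trans_le (mul_nonneg (EReal.coe_nonneg.2 hc.le) hw)).ne'
  rcases eq_or_ne x ⊤ with rfl | hx_top
  · rw [EReal.coe_mul_top_of_pos ha, EReal.top_add_of_ne_bot (ne_bot hb hy)]
    exact le_top
  rcases eq_or_ne y ⊤ with rfl | hy_top
  · rw [EReal.coe_mul_top_of_pos hb, EReal.add_top_of_ne_bot (ne_bot ha hx)]
    exact le_top
  lift x to ℝ using ⟨hx_top, (EReal.bot_lt_zero.trans_le hx).ne'⟩
  lift y to ℝ using ⟨hy_top, (EReal.bot_lt_zero.trans_le hy).ne'⟩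
  exact_mod_cast h x y le_rfl le_rfl

section RateFrom

variable {α A β B : ℝ} {hT : 0 < T} {γ : unitInterval → unitInterval} {π ν : MPath T}

lemma rate_nonneg : 0 ≤ rate α A β B hT π := by
  refine le_trans ?_ (le_iSup _ (zeroTest T))
  unfold J
  split_ifs
  · have JReal_zeroTest : JReal α A β B hT (zeroTest T) π = 0 := by
      simp [JReal, zeroTest, cosTest, bdry_zero]
    rw [JReal_zeroTest, EReal.coe_zero]
  · exact le_top

lemma rateFrom_nonneg : 0 ≤ rateFrom α A β B hT γ π := by
  unfold rateFrom
  split_ifs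
  · exact rate_nonneg
  · exact le_top

variable (hα : α ∈ Icc (0 : ℝ) 1) (hβ : β ∈ Icc (0 : ℝ) 1) (hA : 0 < A) (hB : 0 < B)
include hα hβ hA hB

lemma rate_comb_le_of_le {r s : ℝ} (hr : rate α A β B hT π ≤ r) (hs : rate α A β B hT ν ≤ s)
    (a b : ℝ≥0) (hab : a + b = 1) :
    rate α A β B hT (MPath.comb a b hab π ν) ≤ ((a * r + b * s : ℝ) : EReal) := by
  obtain ⟨⟨hπ, -⟩, hπJ⟩ := rate_le_coe_iff.1 hr
  obtain ⟨⟨hν, -⟩, hνJ⟩ := rate_le_coe_iff.1 hs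
  have hπC := fourierEnergyLe_of_rate_le hα hβ hA hB hr
  have hνC := fourierEnergyLe_of_rate_le hα hβ hA hB hs
  refine rate_le_coe_iff.2 ⟨(hπC.comb a b hab hνC).hasFiniteEnergy
    fun t => (hπ t).comb a b hab (hν t), fun H => ?_⟩
  calc JReal α A β B hT H (MPath.comb a b hab π ν)
      ≤ a * JReal α A β B hT H π + b * JReal α A β B hT H ν :=
        JReal_comb_le a b hab hπ hν hπC hνC α A β B hT H
    _ ≤ a * r + b * s := by
        gcongr
        · exact hπJ H
        · exact hνJ H

lemma rateFrom_comb_le_of_le {r s : ℝ} (hr : rateFrom α A β B hT γ π ≤ r)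
    (hs : rateFrom α A β B hT γ ν ≤ s) (a b : ℝ≥0) (hab : a + b = 1) :
    rateFrom α A β B hT γ (MPath.comb a b hab π ν) ≤ ((a * r + b * s : ℝ) : EReal) := by
  obtain ⟨hπ0, hπ⟩ := rateFrom_le_coe_iff.1 hr
  obtain ⟨hν0, hν⟩ := rateFrom_le_coe_iff.1 hs
  refine rateFrom_le_coe_iff.2 ⟨?_, rate_comb_le_of_le hα hβ hA hB hπ hν a b hab⟩
  filter_upwards [SubMeasure.density_comb a b hab (p := π (timeZero hT)) (q := ν (timeZero hT)),
    hπ0, hν0] with x comb_eq hπx hνx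
  refine comb_eq.trans ?_
  rw [hπx, hνx, ← add_mul, ← NNReal.coe_add, hab, NNReal.coe_one, one_mul]

lemma rateFrom_comb_le (a b : ℝ≥0) (hab : a + b = 1) (π ν : MPath T) :
    rateFrom α A β B hT γ (MPath.comb a b hab π ν) ≤
      ((a : ℝ) : EReal) * rateFrom α A β B hT γ π +
        ((b : ℝ) : EReal) * rateFrom α A β B hT γ ν := by
  rcases eq_or_ne a 0 with rfl | ha
  · obtain rfl : b = 1 := by simpa using hab
    simp [MPath.comb_zero_one]
  rcases eq_or_ne b 0 with rfl | hb
  · obtain rfl : a = 1 := by simpa using hab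
    simp [MPath.comb_one_zero]
  exact le_coe_mul_add_coe_mul_of_forall_coe (by positivity) (by positivity) rateFrom_nonneg
    rateFrom_nonneg fun r s hr hs => rateFrom_comb_le_of_le hα hβ hA hB hr hs a b hab

lemma lowerSemicontinuous_rateFrom : LowerSemicontinuous (rateFrom α A β B hT γ) := by
  rw [lowerSemicontinuous_iff_isClosed_preimage]
  intro q
  induction q with
  | bot =>
    have empty : rateFrom α A β B hT γ ⁻¹' Iic ⊥ = ∅ :=
      eq_empty_of_forall_notMem fun π hπ =>
        (EReal.bot_lt_zero.trans_le rateFrom_nonneg).not_ge hπ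
    rw [empty]
    exact isClosed_empty
  | coe q => exact isClosed_level hα hβ hA hB γ q hT
  | top => simp

end RateFrom

end RobinExclusion

end

theorem theorem2p2_general {α β A B T : ℝ} (hα : α ∈ Icc (0 : ℝ) 1) (hβ : β ∈ Icc (0 : ℝ) 1)
    (hA : 0 < A) (hB : 0 < B) (hT : 0 < T) (γ : unitInterval → unitInterval) :
    (∀ π : RobinExclusion.MPath T, 0 ≤ RobinExclusion.rateFrom α A β B hT γ π) ∧
    (∀ (a b : NNReal) (hab : a + b = 1) (π ν : RobinExclusion.MPath T),
      RobinExclusion.rateFrom α A β B hT γ (RobinExclusion.MPath.comb a b hab π ν) ≤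
        ((a : ℝ) : EReal) * RobinExclusion.rateFrom α A β B hT γ π +
          ((b : ℝ) : EReal) * RobinExclusion.rateFrom α A β B hT γ ν) ∧
    LowerSemicontinuous (RobinExclusion.rateFrom α A β B hT γ) ∧
    (∀ q : ℝ, IsCompact
      {π : RobinExclusion.MPath T | RobinExclusion.rateFrom α A β B hT γ π ≤ (q : EReal)}) :=
  ⟨fun _ => RobinExclusion.rateFrom_nonneg,
    RobinExclusion.rateFrom_comb_le hα hβ hA hB,
    RobinExclusion.lowerSemicontinuous_rateFrom hα hβ hA hB,
    fun q => RobinExclusion.isCompact_level hα hβ hA hB γ q hT⟩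

theorem theorem2p2 (α β A B T : ℝ) (hα : 0 < α) (hαβ : α ≤ β) (hβ : β < 1)
    (hA : 0 < A) (hB : 0 < B) (hT : 0 < T)
    (γ : unitInterval → unitInterval) (hγ : Measurable γ) :
    (∀ π : RobinExclusion.MPath T, 0 ≤ RobinExclusion.rateFrom α A β B hT γ π) ∧
    (∀ (a b : NNReal) (hab : a + b = 1) (π ν : RobinExclusion.MPath T),
      RobinExclusion.rateFrom α A β B hT γ (RobinExclusion.MPath.comb a b hab π ν) ≤
        ((a : ℝ) : EReal) * RobinExclusion.rateFrom α A β B hT γ π +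
          ((b : ℝ) : EReal) * RobinExclusion.rateFrom α A β B hT γ ν) ∧
    LowerSemicontinuous (RobinExclusion.rateFrom α A β B hT γ) ∧
    (∀ q : ℝ, IsCompact
      {π : RobinExclusion.MPath T | RobinExclusion.rateFrom α A β B hT γ π ≤ (q : EReal)}) :=
  theorem2p2_general ⟨hα.le, (hαβ.trans_lt hβ).le⟩ ⟨(hα.trans_le hαβ).le, hβ.le⟩ hA hB hT γ
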